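/- Let $\hat Q=(0,1)^2$ be the reference square, with edges $\hat e_1,\hat e_2,\hat e_3,\hat e_4$ (bottom, right, top, left) and outward unit normal $\mathbf n$. All functions are real valued. $\|\cdot\|_{0,\hat Q}$ is the $L^2(\hat Q)$-norm and $H^s(\hat Q)$, $s>0$, is the Sobolev–Slobodeckij space: with $m=\lfloor s\rfloor$ and $\sigma=s-m$, $$\|v\|_{H^s(\hat Q)}^2=\sum_{|\alpha|\le m}\|\partial^\alpha v\|_{0,\hat Q}^2+\sum_{|\alpha|=m}\int_{\hat Q}\int_{\hat Q}\frac{|\partial^\alpha v(x)-\partial^\alpha v(y)|^2}{|x-y|^{2+2\sigma}}\,dx\,dy,$$ where the last sum is omitted if $\sigma=0$. For $0<s\le 1/2$ put $|f|^2_{H^s(0,1)}=\int_0^1\int_0^1\frac{|f(x)-f(y)|^2}{|x-y|^{1+2s}}\,dx\,dy$ and $$|v|_{AH^s_1(\hat Q)}^2=\int_0^1|v(\cdot,x_2)|^2_{H^s(0,1)}\,dx_2,\qquad |v|_{AH^s_2(\hat Q)}^2=\int_0^1|v(x_1,\cdot)|^2_{H^s(0,1)}\,dx_1 .$$ Let $\mathbf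 H(\mathrm{div},\hat Q)$ be the space of fields $\mathbf u\in L^2(\hat Q)^2$ whose weak divergence lies in $L^2(\hat Q)$, and let $\mathcal{RT}_0(\hat Q)=\{(a+cx_1,\,b+dx_2)^\top:\ a,b,c,d\in\mathbb R\}$. The Raviart–Thomas interpolant $\hat\Pi_{\rm RT}\mathbf u$ is the element of $\mathcal{RT}_0(\hat Q)$ with $$\int_{\hat e_i}\hat\Pi_{\rm RT}\mathbf u\cdot\mathbf n\,ds=(\mathbf u\cdot\mathbf n,1)_{0,\hat e_i},\qquad i=1,2,3,4.$$ Here, if $\mathbf u\in H^s(\hat Q)^2$ with $s>1/2$, $(\mathbf u\cdot\mathbf n,1)_{0,\hat e_i}$ is the integral over $\hat e_i$ of the normal component of the trace of $\mathbf u$. If $\mathbf u\in H^s(\hat Q)^2\cap\mathbf H(\mathrm{div},\hat Q)$ with $0<s\le 1/2$, it is defined by $$(\mathbf u\cdot\mathbf n,1)_{0,\hat e_i}:=(\mathbf u,\nabla\varphi)_{0,\hat Q}+\int_{\hat Q}\mathrm{div}\,\mathbf u\;\varphi$$ for $\varphi\in H^{1-\varepsilon}(\hat Q)$, $0<\varepsilon<s$,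 with trace $1$ on $\hat e_i$ and $0$ on the other edges, where $(\mathbf u,\nabla\cdot)_{0,\hat Q}$ is the continuous extension of the $L^2$-pairing from smooth functions to $H^{1-\varepsilon}(\hat Q)$; the value is the same for all such $\varepsilon$ and $\varphi$. **Theorem.** (i) For every $s>1/2$ there is a constant $C=C(s)$ such that, for all $\mathbf u=(u_1,u_2)\in H^s(\hat Q)^2$, the interpolant $\hat\Pi_{\rm RT}\mathbf u$ exists and is unique, and for $l=1,2$ $$\|(\hat\Pi_{\rm RT}\mathbf u)_l\|_{0,\hat Q}\le C\,\|u_l\|_{H^s(\hat Q)} .$$ (ii) For every $0<s\le 1/2$ there is a constant $C=C(s)$ such that, for all $\mathbf u\in H^s(\hat Q)^2\cap\mathbf H(\mathrm{div},\hat Q)$, the interpolant $\hat\Pi_{\rm RT}\mathbf u$ exists and is unique, and for $l=1,2$ (with the index $l+1$ taken modulo $2$) $$\|(\hat\Pi_{\rm RT}\mathbf u)_l\|_{0,\hat Q}\le C\left(\|u_l\|_{H^s(\hat Q)}+|u_{l+1}|_{AH^s_{l+1}(\hat Q)}+\|\mathrm{div}\,\mathbf u\|_{0,\hat Q}\right).$$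 -/

import Mathlib

open MeasureTheory Set Filter Topology
open scoped NNReal ENNReal ContDiff

namespace RTSquare

noncomputable section

/-- The open reference square `(0,1)²`. -/
def Q : Set (ℝ × ℝ) := Ioo 0 1 ×ˢ Ioo 0 1

/-- Lebesgue measure on the reference square. -/
def μQ : Measure (ℝ × ℝ) := volume.restrict Q

/-- Lebesgue measure on the unit interval `(0,1)`. -/
def μI : Measure ℝ := volume.restrict (Ioo 0 1)

/-- The `L²(Q)` norm. -/
def normL2 (v : ℝ × ℝ → ℝ) : ℝ≥0∞ := eLpNorm v 2 μQ

/-- The classical partial derivative in direction `x₁` (`i = 0`) or `x₂` (`i = 1`). -/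
def pd (i : Fin 2) (f : ℝ × ℝ → ℝ) : ℝ × ℝ → ℝ :=
  fun x => fderiv ℝ f x ((![(1, 0), (0, 1)] : Fin 2 → ℝ × ℝ) i)

/-- The classical derivative `∂₁^{α₁} ∂₂^{α₂} f`. -/
def pdPow (α : ℕ × ℕ) (f : ℝ × ℝ → ℝ) : ℝ × ℝ → ℝ :=
  (pd 0)^[α.1] ((pd 1)^[α.2] f)

/-- Test functions: the elements of `C_c^∞(Q)`. -/
structure IsTest (φ : ℝ × ℝ → ℝ) : Prop where
  smooth : ContDiff ℝ ∞ φ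
  compact : HasCompactSupport φ
  support : tsupport φ ⊆ Q

/-- `w` is the weak derivative `∂^α v` on `Q`. -/
def IsWeakDeriv (α : ℕ × ℕ) (v w : ℝ × ℝ → ℝ) : Prop :=
  ∀ φ, IsTest φ → ∫ x, v x * pdPow α φ x ∂μQ = (-1) ^ (α.1 + α.2) * ∫ x, w x * φ x ∂μQ

/-- `g α`, for `|α| ≤ m`, are the weak derivatives of `v` of order at most `m`,
all of them in `L²(Q)`. -/
structure IsWeakDerivs (m : ℕ) (v : ℝ × ℝ → ℝ) (g : ℕ × ℕ → ℝ × ℝ → ℝ) : Prop where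
  zero : g (0, 0) = v
  memLp : ∀ α : ℕ × ℕ, α.1 + α.2 ≤ m → MemLp (g α) 2 μQ
  weak : ∀ α : ℕ × ℕ, α.1 + α.2 ≤ m → IsWeakDeriv α v (g α)

/-- Euclidean distance in the plane. -/
def euclDist (x y : ℝ × ℝ) : ℝ := √((x.1 - y.1) ^ 2 + (x.2 - y.2) ^ 2)

/-- The square of the Sobolev-Slobodeckij seminorm of order `σ ∈ (0,1)` on `Q`. -/
def gagliardoSq (σ : ℝ) (v : ℝ × ℝ → ℝ) : ℝ≥0∞ :=
  ∫⁻ x, ∫⁻ y, ENNReal.ofReal (|v x - v y| ^ 2 / euclDist x y ^ (2 + 2 * σ)) ∂μQ ∂μQ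

/-- The square of the Sobolev-Slobodeckij seminorm of order `σ ∈ (0,1)` on `(0,1)`. -/
def gagliardoSqI (σ : ℝ) (f : ℝ → ℝ) : ℝ≥0∞ :=
  ∫⁻ x, ∫⁻ y, ENNReal.ofReal (|f x - f y| ^ 2 / |x - y| ^ (1 + 2 * σ)) ∂μI ∂μI

/-- The norm of `H^s(Q)`, `s ≥ 0`: with `m = ⌊s⌋` and `σ = s - m`, its square is the sum of the
`‖∂^α v‖²` over `|α| ≤ m` and, if `σ > 0`, of the `|∂^α v|²_{H^σ}` over `|α| = m`.
The infimum only picks the (almost everywhere unique) weak derivatives; the value is `∞`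
if `v` is not in `H^s(Q)`. -/
def normH (s : ℝ) (v : ℝ × ℝ → ℝ) : ℝ≥0∞ :=
  ⨅ (g : ℕ × ℕ → ℝ × ℝ → ℝ) (_ : IsWeakDerivs ⌊s⌋₊ v g),
    ((∑ k ∈ Finset.range (⌊s⌋₊ + 1),
        ∑ α ∈ Finset.HasAntidiagonal.antidiagonal k, normL2 (g α) ^ 2) +
      (if s = ⌊s⌋₊ then 0
        else ∑ α ∈ Finset.HasAntidiagonal.antidiagonal ⌊s⌋₊, gagliardoSq (s - ⌊s⌋₊) (g α))) ^ (1 / 2 : ℝ)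

/-- Membership in `H^s(Q)`. -/
def MemH (s : ℝ) (v : ℝ × ℝ → ℝ) : Prop := normH s v < ⊤

/-- The anisotropic seminorms: for `i = 0`, `|v|²_{AH₁^s} = ∫ |v(·,x₂)|²_{H^s(0,1)} dx₂`;
for `i = 1`, `|v|²_{AH₂^s} = ∫ |v(x₁,·)|²_{H^s(0,1)} dx₁`. -/
def seminormAH (i : Fin 2) (s : ℝ) (v : ℝ × ℝ → ℝ) : ℝ≥0∞ :=
  (![∫⁻ x₂, gagliardoSqI s (fun x₁ => v (x₁, x₂)) ∂μI,
     ∫⁻ x₁, gagliardoSqI s (fun x₂ => v (x₁, x₂)) ∂μI] i) ^ (1 / 2 : ℝ)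

/-- `d ∈ L²(Q)` is the weak divergence of the field `u = (u 0, u 1)` on `Q`. -/
structure HasWeakDiv (u : Fin 2 → ℝ × ℝ → ℝ) (d : ℝ × ℝ → ℝ) : Prop where
  memLp : MemLp d 2 μQ
  weak : ∀ φ, IsTest φ →
    ∫ x, (u 0 x * pd 0 φ x + u 1 x * pd 1 φ x) ∂μQ = - ∫ x, d x * φ x ∂μQ

/-- Parametrisation by `t ∈ (0,1)` of the four edges: bottom, right, top, left. -/
def edgePt (e : Fin 4) (t : ℝ) : ℝ × ℝ :=
  (![(t, 0), (1, t), (t, 1), (0, t)] : Fin 4 → ℝ × ℝ) e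

/-- Outward unit normals on the four edges. -/
def normal (e : Fin 4) : ℝ × ℝ :=
  (![(0, -1), (1, 0), (0, 1), (-1, 0)] : Fin 4 → ℝ × ℝ) e

/-- `T ∈ L²(e)` is the trace of `v` on the edge `e`: the trace operator on `H^σ(Q)`,
`1/2 < σ < 1`, is the continuous extension of the restriction of smooth functions to `e`.
This covers all spaces `H^s(Q)` with `s > 1/2`, since they embed into such an `H^σ(Q)`. -/
def IsTrace (v : ℝ × ℝ → ℝ) (e : Fin 4) (T : ℝ → ℝ) : Prop :=
  MemLp T 2 μI ∧ ∃ σ : ℝ, 1 / 2 < σ ∧ σ < 1 ∧ ∃ ψ : ℕ → ℝ × ℝ → ℝ,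
    (∀ n, ContDiff ℝ ∞ (ψ n)) ∧
    Tendsto (fun n => normH σ (fun x => ψ n x - v x)) atTop (𝓝 0) ∧
    Tendsto (fun n => eLpNorm (fun t => ψ n (edgePt e t) - T t) 2 μI) atTop (𝓝 0)

/-- `F` is the value at `φ ∈ H^{1-ε}(Q)` of the left-hand side `(u, ∇φ) + ∫ d φ` of Green's
formula (`d = div u`), the pairing `(u, ∇φ)` being the continuous extension of the
`L²` pairing from smooth functions to `H^{1-ε}(Q)`. -/
def IsGreenValue (ε : ℝ) (u : Fin 2 → ℝ × ℝ → ℝ) (d φ : ℝ × ℝ → ℝ) (F : ℝ) : Prop :=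
  ∀ ψ : ℕ → ℝ × ℝ → ℝ, (∀ n, ContDiff ℝ ∞ (ψ n)) →
    Tendsto (fun n => normH (1 - ε) (fun x => ψ n x - φ x)) atTop (𝓝 0) →
    Tendsto (fun n => (∫ x, (u 0 x * pd 0 (ψ n) x + u 1 x * pd 1 (ψ n) x) ∂μQ) +
      ∫ x, d x * ψ n x ∂μQ) atTop (𝓝 F)

/-- `F = (u · n, 1)_e` for a field `u ∈ H^s(Q)²`, `0 < s ≤ 1/2`, with divergence `d ∈ L²(Q)`:
`F` is the value of Green's formula at every `φ ∈ H^{1-ε}(Q)`, `0 < ε < s`, whose trace is `1`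
on the edge `e` and `0` on the other edges. -/
def IsWeakFlux (s : ℝ) (u : Fin 2 → ℝ × ℝ → ℝ) (d : ℝ × ℝ → ℝ) (e : Fin 4) (F : ℝ) : Prop :=
  ∀ ε : ℝ, 0 < ε → ε < s → ∀ φ : ℝ × ℝ → ℝ, MemH (1 - ε) φ →
    (∀ e' : Fin 4, IsTrace φ e' (fun _ => if e' = e then 1 else 0)) →
    IsGreenValue ε u d φ F

/-- `F = ∫_e u · n ds` for a field whose components have traces on the edge `e`. -/
def IsTraceFlux (u : Fin 2 → ℝ × ℝ → ℝ) (e : Fin 4) (F : ℝ) : Prop :=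
  ∃ T : Fin 2 → ℝ → ℝ, (∀ i, IsTrace (u i) e (T i)) ∧
    F = ∫ t, (T 0 t * (normal e).1 + T 1 t * (normal e).2) ∂μI

/-- The lowest order Raviart-Thomas space `{(a + c x₁, b + d x₂)}` on the square. -/
def RT0 : Set (Fin 2 → ℝ × ℝ → ℝ) :=
  {P | ∃ a b c d : ℝ, P = ![fun x => a + c * x.1, fun x => b + d * x.2]}

/-- The degree of freedom `∫_e P · n ds` of a (continuous) field `P`. -/
def edgeFlux (P : Fin 2 → ℝ × ℝ → ℝ) (e : Fin 4) : ℝ :=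
  ∫ t, (P 0 (edgePt e t) * (normal e).1 + P 1 (edgePt e t) * (normal e).2) ∂μI

/-- `P` is the Raviart-Thomas interpolant of a field `u ∈ H^s(Q)²` with `s > 1/2`. -/
def IsRTInterpolant (u P : Fin 2 → ℝ × ℝ → ℝ) : Prop :=
  P ∈ RT0 ∧ ∀ e : Fin 4, IsTraceFlux u e (edgeFlux P e)

/-- `P` is the Raviart-Thomas interpolant of a field `u ∈ H^s(Q)²`, `0 < s ≤ 1/2`, with
divergence `d ∈ L²(Q)`. -/
def IsRTInterpolantDiv (s : ℝ) (u : Fin 2 → ℝ × ℝ → ℝ) (d : ℝ × ℝ → ℝ)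
    (P : Fin 2 → ℝ × ℝ → ℝ) : Prop :=
  P ∈ RT0 ∧ ∀ e : Fin 4, IsWeakFlux s u d e (edgeFlux P e)

end

end RTSquare

open RTSquare

/-! An element of RT₀ is determined by its four edge fluxes, and its l-th component interpolates
affinely between the values on the two edges normal to direction l (`existsUnique_RT0`,
`abs_RT0_le`). Both parts therefore reduce to showing that the edge functionals exist, are unique,
and are bounded on the edges normal to l by the quantities on the right-hand side.

The analytic core consists of two estimates for C¹ functions, both proved by dyadic subdivision. The
trace inequality (`exists_trace_sq_le`) compares means over nested squares. Passing to the half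
scale contracts by (1/2)^(2σ-1), up to a factor close to 1, so the recursion closes for σ > 1/2. The
pairing bound |∫ u ∂ψ| ≤ C ‖u‖_{H^s} ‖ψ‖_{H^σ} (`exists_pairing_le`) subtracts local means of u and
controls ∫ ∂ψ over a square by traces on opposite sides. Here the contraction is (1/2)^(s+σ-1), so s
+ σ > 1 is needed. Remainders depending on a Lipschitz constant vanish as the depth grows.

Density comes from the smoothing `Sm`, which averages v over dilations x ↦ r x + (1-r) w with
centres w in Q. Convexity keeps everything inside Q, so no extension is needed. The operator
converges in H^σ, and it commutes with weak derivatives and the divergence up to the factor r.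

For (i), H^s embeds into some H^σ with 1/2 < σ < 1 (`exists_normH_le`), and the trace inequality
extends to a bounded trace operator. The tangential component drops out of u · n, so only u_l
enters.

For (ii), Green's functional is continuous on H^(1-ε) by the pairing bound, and it tends to 0 along
smooth sequences that are bounded there and have vanishing traces (`tendsto_Lf_zero`). The flux can
thus be computed with one convenient cutoff (`isWeakFlux_iff`). The cutoff is built from the
homogeneous corner function x₂²/(x₁²+x₂²), regularized by η. It lies in every H^σ with σ < 1,
although its trace jumps at the corner. For the tangential term, `cornerCut` has the form x₂ N(x₂)
with N(1) = 0 on each line parallel to the edge, so its derivative annihilates constants there.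
`integral_mul_deriv_eq` rewrites the pairing in terms of differences of u_{l+1} along these lines,
and Cauchy-Schwarz leaves only the anisotropic seminorm, uniformly in η
(`enorm_integral_mul_pd_cornerCut_le`). -/

namespace RTSquare

/-! ### Gagliardo energies on a general measure space. -/

section

/-- The Gagliardo energy of `v` with respect to a kernel `k` and a measure `μ`. -/
noncomputable def energy {X : Type*} [MeasurableSpace X] (k : X → X → ℝ) (μ : Measure X)
    (v : X → ℝ) : ℝ≥0∞ :=
  ∫⁻ x, ∫⁻ y, ENNReal.ofReal (|v x - v y| ^ 2 / k x y) ∂μ ∂μ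

section Energy

variable {X : Type*} [MeasurableSpace X] {k : X → X → ℝ} {μ ν : Measure X} {v w : X → ℝ}

lemma energy_mono (h : ν ≤ μ) : energy k ν v ≤ energy k μ v :=
  lintegral_mono' h fun _ => lintegral_mono' h le_rfl

/-- Expanding the double integral over the sum of measures, only the diagonal terms are kept; the
interaction terms are nonnegative. -/
lemma sum_energy_le {ι : Type*} (s : Finset ι) (m : ι → Measure X) :
    ∑ i ∈ s, energy k (m i) v ≤ energy k (∑ i ∈ s, m i) v := by
  unfold energy
  rw [lintegral_finsetSum_measure]
  refine Finset.sum_le_sum fun i hi => lintegral_mono fun x => ?_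
  rw [lintegral_finsetSum_measure]
  exact Finset.single_le_sum
    (f := fun j => ∫⁻ y, ENNReal.ofReal (|v x - v y| ^ 2 / k x y) ∂(m j)) (fun _ _ => zero_le) hi

lemma energy_congr_ae (h : v =ᵐ[μ] w) : energy k μ v = energy k μ w := by
  unfold energy
  refine lintegral_congr_ae ?_
  filter_upwards [h] with x hx
  refine lintegral_congr_ae ?_
  filter_upwards [h] with y hy
  rw [hx, hy]

lemma energy_integrand_aemeasurable [SFinite μ] (hv : AEMeasurable v μ)
    (hk : Measurable (Function.uncurry k)) :
    AEMeasurable (fun z : X × X => ENNReal.ofReal (|v z.1 - v z.2| ^ 2 / k z.1 z.2))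
      (μ.prod μ) := by
  have h1 : AEMeasurable (fun z : X × X => v z.1) (μ.prod μ) := hv.comp_fst
  have h2 : AEMeasurable (fun z : X × X => v z.2) (μ.prod μ) := hv.comp_snd
  have h3 : Measurable (fun z : X × X => k z.1 z.2) := hk
  exact (((h1.sub h2).norm.pow_const 2).div h3.aemeasurable).ennreal_ofReal

lemma energy_eq_prod [SFinite μ] (hv : AEMeasurable v μ) (hk : Measurable (Function.uncurry k)) :
    energy k μ v = ∫⁻ z, ENNReal.ofReal (|v z.1 - v z.2| ^ 2 / k z.1 z.2) ∂(μ.prod μ) := by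
  rw [lintegral_prod _ (energy_integrand_aemeasurable hv hk)]
  rfl

lemma energy_add_le [SFinite μ] (hv : AEMeasurable v μ) (hw : AEMeasurable w μ)
    (hk : Measurable (Function.uncurry k)) (hk0 : ∀ x y, 0 ≤ k x y) :
    energy k μ (fun x => v x + w x) ≤ 2 * energy k μ v + 2 * energy k μ w := by
  rw [energy_eq_prod hv hk, energy_eq_prod hw hk, energy_eq_prod (v := fun x => v x + w x) (hv.add hw) hk,
    ← lintegral_const_mul'' _ (energy_integrand_aemeasurable hv hk),
    ← lintegral_const_mul'' _ (energy_integrand_aemeasurable hw hk),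
    ← lintegral_add_left' ((energy_integrand_aemeasurable hv hk).const_mul _)]
  refine lintegral_mono fun z => ?_
  rw [← ENNReal.ofReal_ofNat, ← ENNReal.ofReal_mul (by norm_num),
    ← ENNReal.ofReal_mul (by norm_num), ← ENNReal.ofReal_add
    (by have := hk0 z.1 z.2; positivity) (by have := hk0 z.1 z.2; positivity)]
  refine ENNReal.ofReal_le_ofReal ?_
  rw [← mul_div_assoc, ← mul_div_assoc, ← add_div]
  refine div_le_div_of_nonneg_right ?_ (hk0 _ _)
  simp only [sq_abs]
  nlinarith [sq_nonneg ((v z.1 - v z.2) - (w z.1 - w z.2))]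

lemma energy_neg : energy k μ (fun x => - v x) = energy k μ v := by
  unfold energy
  simp only [← neg_sub_neg (v _) (v _), abs_sub_comm]

lemma energy_comp {Y : Type*} [MeasurableSpace Y] {κ : X ≃ᵐ Y} {μ' : Measure Y} {k' : Y → Y → ℝ}
    (hκ : MeasurePreserving κ μ μ') (hk : ∀ x y, k' (κ x) (κ y) = k x y) (f : Y → ℝ) :
    energy k μ (fun x => f (κ x)) = energy k' μ' f := by
  unfold energy
  rw [← hκ.lintegral_comp_emb κ.measurableEmbedding]
  refine lintegral_congr fun x => ?_
  rw [← hκ.lintegral_comp_emb κ.measurableEmbedding]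
  simp only [hk]

lemma lintegral_sq_le (f : X → ℝ≥0∞) (hf : AEMeasurable f μ) :
    (∫⁻ x, f x ∂μ) ^ 2 ≤ μ univ * ∫⁻ x, f x ^ 2 ∂μ := by
  have h := ENNReal.lintegral_mul_le_Lp_mul_Lq μ Real.HolderConjugate.two_two hf
    (aemeasurable_const (b := (1 : ℝ≥0∞)))
  simp only [Pi.mul_apply, mul_one, ENNReal.one_rpow, lintegral_const, one_mul] at h
  calc (∫⁻ x, f x ∂μ) ^ 2 ≤ ((∫⁻ a, f a ^ (2 : ℝ) ∂μ) ^ (1 / 2 : ℝ) * μ univ ^ (1 / 2 : ℝ)) ^ 2 := by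
        gcongr
    _ = _ := by
        rw [mul_pow, ← ENNReal.rpow_natCast, ← ENNReal.rpow_natCast, ← ENNReal.rpow_mul,
          ← ENNReal.rpow_mul]
        norm_num [mul_comm]

lemma enorm_sub_average_le [IsFiniteMeasure μ] (hμ : μ ≠ 0) (hv : Integrable v μ) (x : X) :
    ‖v x - ⨍ y, v y ∂μ‖ₑ ≤ (μ univ)⁻¹ * ∫⁻ y, ‖v x - v y‖ₑ ∂μ := by
  have : NeZero μ := ⟨hμ⟩
  have h : v x - ⨍ y, v y ∂μ = ⨍ y, (v x - v y) ∂μ := by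
    simp only [average_eq]
    rw [integral_sub (integrable_const _) hv, smul_sub, integral_const, smul_smul,
      inv_mul_cancel₀, one_smul]
    simp [Measure.real, ENNReal.toReal_eq_zero_iff, hμ]
  rw [h, average]
  refine (enorm_integral_le_lintegral_enorm _).trans ?_
  rw [lintegral_smul_measure]
  rfl

/-- A Poincaré inequality for the Gagliardo energy. -/
lemma lintegral_sub_average_sq_le [IsFiniteMeasure μ] (hμ : μ ≠ 0) (hv : Integrable v μ)
    (hνμ : ν ≤ μ) {D : ℝ} (hk0 : ∀ x y, 0 ≤ k x y) (hk1 : ∀ x y, k x y = 0 → x = y)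
    (hD : ∀ᵐ x ∂μ, ∀ᵐ y ∂μ, k x y ≤ D) :
    (∫⁻ x, ‖v x - ⨍ y, v y ∂μ‖ₑ ∂ν) ^ 2 ≤
      ν univ * (μ univ)⁻¹ * (ENNReal.ofReal D * energy k μ v) := by
  have : IsFiniteMeasure ν := isFiniteMeasure_of_le μ hνμ
  have hm : AEMeasurable (fun z : X × X => ‖v z.1 - v z.2‖ₑ) (ν.prod μ) :=
    (((hv.1.aemeasurable.mono_measure hνμ).comp_fst).sub hv.1.aemeasurable.comp_snd).enorm
  have hμ0 : μ univ ≠ 0 := by simpa using hμ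
  have hμ1 : μ univ ≠ ⊤ := measure_ne_top _ _
  have h2 : ∫⁻ z, ‖v z.1 - v z.2‖ₑ ^ 2 ∂(ν.prod μ) ≤ ENNReal.ofReal D * energy k μ v := by
    rw [lintegral_prod _ (hm.pow_const 2), energy, ← lintegral_const_mul' _ _ ENNReal.ofReal_ne_top]
    refine (lintegral_mono' hνμ le_rfl).trans (lintegral_mono_ae ?_)
    filter_upwards [hD] with x hx
    rw [← lintegral_const_mul' _ _ ENNReal.ofReal_ne_top]
    refine lintegral_mono_ae ?_
    filter_upwards [hx] with y hy
    have e : ‖v x - v y‖ₑ ^ 2 = ENNReal.ofReal (|v x - v y| ^ 2) := by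
      rw [Real.enorm_eq_ofReal_abs, ENNReal.ofReal_pow (abs_nonneg _)]
    rw [e, ← ENNReal.ofReal_mul ((hk0 x y).trans hy)]
    refine ENNReal.ofReal_le_ofReal ?_
    -- Division by a zero kernel gives 0, so that case is harmless only because a zero kernel forces
    -- x = y, and then the difference vanishes as well.
    rcases (hk0 x y).eq_or_lt with h0 | h0
    · rw [hk1 x y h0.symm]; simp
    · rw [mul_div_assoc', le_div_iff₀ h0, mul_comm]
      gcongr
  have h1 : ∫⁻ x, ‖v x - ⨍ y, v y ∂μ‖ₑ ∂ν ≤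
      (μ univ)⁻¹ * ∫⁻ z, ‖v z.1 - v z.2‖ₑ ∂(ν.prod μ) := by
    rw [lintegral_prod _ hm, ← lintegral_const_mul' _ _ (ENNReal.inv_ne_top.2 hμ0)]
    exact lintegral_mono fun x => enorm_sub_average_le hμ hv x
  calc _ ≤ ((μ univ)⁻¹ * ∫⁻ z, ‖v z.1 - v z.2‖ₑ ∂(ν.prod μ)) ^ 2 := by gcongr
    _ ≤ (μ univ)⁻¹ ^ 2 * ((ν.prod μ) univ * (ENNReal.ofReal D * energy k μ v)) := by
        rw [mul_pow]
        gcongr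
        exact (lintegral_sq_le _ hm).trans (by gcongr)
    _ = (ν univ * (μ univ)⁻¹ * (ENNReal.ofReal D * energy k μ v)) * ((μ univ)⁻¹ * μ univ) := by
        rw [← univ_prod_univ, Measure.prod_prod]; ring
    _ = _ := by rw [ENNReal.inv_mul_cancel hμ0 hμ1, mul_one]

/-- With ν = μ this is a Poincaré inequality; with ν a part of μ it compares the mean over the part
with the mean over the whole. -/
lemma integral_sub_average_le [IsFiniteMeasure μ] (hμ : μ ≠ 0) (hv : Integrable v μ)
    (hνμ : ν ≤ μ) {D : ℝ} (hD0 : 0 ≤ D) (hk0 : ∀ x y, 0 ≤ k x y) (hk1 : ∀ x y, k x y = 0 → x = y)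
    (hD : ∀ᵐ x ∂μ, ∀ᵐ y ∂μ, k x y ≤ D) (hE : energy k μ v ≠ ⊤) :
    ∫ x, |v x - ⨍ y, v y ∂μ| ∂ν ≤
      √(ν.real univ / μ.real univ * D * (energy k μ v).toReal) := by
  have : IsFiniteMeasure ν := isFiniteMeasure_of_le μ hνμ
  have h := lintegral_sub_average_sq_le hμ hv hνμ hk0 hk1 hD
  have hμ0 : μ univ ≠ 0 := by simpa using hμ
  refine Real.le_sqrt_of_sq_le ?_
  have e : ∫ x, |v x - ⨍ y, v y ∂μ| ∂ν = (∫⁻ x, ‖v x - ⨍ y, v y ∂μ‖ₑ ∂ν).toReal := by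
    rw [← integral_norm_eq_lintegral_enorm]
    · rfl
    · exact (hv.1.mono_measure hνμ).sub aestronglyMeasurable_const
  rw [e, ← ENNReal.toReal_pow]
  refine (ENNReal.toReal_mono ?_ h).trans (le_of_eq ?_)
  · finiteness
  · simp [Measure.real, ENNReal.toReal_mul, ENNReal.toReal_inv, ENNReal.toReal_ofReal hD0,
      div_eq_mul_inv, mul_assoc]

end Energy

end

/-! ### Squares, their quarters, and mean values. -/

section

/-- The kernel of the Sobolev-Slobodeckij seminorm of order `σ` in the plane. -/
noncomputable def kerQ (σ : ℝ) (x y : ℝ × ℝ) : ℝ := euclDist x y ^ (2 + 2 * σ)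

lemma gagliardoSq_eq (σ : ℝ) (v : ℝ × ℝ → ℝ) : gagliardoSq σ v = energy (kerQ σ) μQ v := rfl

lemma continuous_euclDist : Continuous (Function.uncurry euclDist) := by
  unfold euclDist Function.uncurry
  fun_prop

lemma measurable_kerQ (σ : ℝ) : Measurable (Function.uncurry (kerQ σ)) :=
  continuous_euclDist.measurable.pow_const _

lemma euclDist_nonneg (x y : ℝ × ℝ) : 0 ≤ euclDist x y := Real.sqrt_nonneg _

lemma kerQ_nonneg (σ : ℝ) (x y : ℝ × ℝ) : 0 ≤ kerQ σ x y :=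
  Real.rpow_nonneg (euclDist_nonneg _ _) _

lemma euclDist_eq_zero {x y : ℝ × ℝ} (h : euclDist x y = 0) : x = y := by
  unfold euclDist at h
  rw [Real.sqrt_eq_zero (by positivity)] at h
  have h1 : (x.1 - y.1) ^ 2 = 0 := by nlinarith [sq_nonneg (x.1 - y.1), sq_nonneg (x.2 - y.2)]
  have h2 : (x.2 - y.2) ^ 2 = 0 := by nlinarith [sq_nonneg (x.1 - y.1), sq_nonneg (x.2 - y.2)]
  ext
  · simpa [sub_eq_zero] using h1
  · simpa [sub_eq_zero] using h2

lemma eq_of_kerQ_eq_zero {σ : ℝ} {x y : ℝ × ℝ} (h : kerQ σ x y = 0) : x = y := by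
  unfold kerQ at h
  exact euclDist_eq_zero ((Real.rpow_eq_zero_iff_of_nonneg (euclDist_nonneg _ _)).1 h).1

/-- The square of side `h` with lower left corner `(p, q)`. -/
def Sq (p q h : ℝ) : Set (ℝ × ℝ) := Ioc p (p + h) ×ˢ Ioc q (q + h)

/-- Lebesgue measure on the square `Sq p q h`. -/
noncomputable def μS (p q h : ℝ) : Measure (ℝ × ℝ) := volume.restrict (Sq p q h)

lemma measurableSet_Sq (p q h : ℝ) : MeasurableSet (Sq p q h) :=
  measurableSet_Ioc.prod measurableSet_Ioc

lemma μS_eq_prod (p q h : ℝ) : μS p q h =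
    (volume.restrict (Ioc p (p + h))).prod (volume.restrict (Ioc q (q + h))) := by
  rw [Measure.prod_restrict]; rfl

lemma μQ_eq_prod : μQ = μI.prod μI := by
  unfold μI
  rw [Measure.prod_restrict]; rfl

lemma μQ_eq_μS : μQ = μS 0 0 1 := by
  rw [μQ_eq_prod, μS_eq_prod]
  simp only [μI, zero_add, restrict_Ioo_eq_restrict_Ioc]

lemma μS_univ (p q : ℝ) {h : ℝ} (hh : 0 ≤ h) : μS p q h univ = ENNReal.ofReal (h ^ 2) := by
  rw [μS_eq_prod, ← univ_prod_univ, Measure.prod_prod]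
  simp [← ENNReal.ofReal_mul hh, sq]

lemma μS_real_univ (p q : ℝ) {h : ℝ} (hh : 0 ≤ h) : (μS p q h).real univ = h ^ 2 := by
  rw [Measure.real, μS_univ p q hh, ENNReal.toReal_ofReal (by positivity)]

instance (p q h : ℝ) : IsFiniteMeasure (μS p q h) := by
  rw [μS_eq_prod]; infer_instance

instance : IsFiniteMeasure μI := by
  unfold μI; infer_instance

instance : IsProbabilityMeasure μI := ⟨by simp [μI]⟩

instance : IsProbabilityMeasure μQ := by
  rw [μQ_eq_prod]; infer_instance

lemma μS_ne_zero (p q : ℝ) {h : ℝ} (hh : 0 < h) : μS p q h ≠ 0 := by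
  intro h0
  have := μS_univ p q hh.le
  rw [h0] at this
  simp only [Measure.coe_zero, Pi.zero_apply] at this
  have h2 := ENNReal.ofReal_pos.2 (pow_pos hh 2)
  rw [← this] at h2
  exact lt_irrefl _ h2

/-- Half-open intervals make the subdivision exactly disjoint, so that no null sets have to be
discarded. -/
lemma Ioc_halves (p : ℝ) {h : ℝ} (hh : 0 ≤ h) :
    (volume.restrict (Ioc p (p + h)) : Measure ℝ) =
      ∑ i : Fin 2, volume.restrict (Ioc (p + (i : ℕ) * (h / 2)) (p + (i : ℕ) * (h / 2) + h / 2)) := by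
  have : Ioc p (p + h) = Ioc p (p + h / 2) ∪ Ioc (p + h / 2) (p + h) :=
    (Ioc_union_Ioc_eq_Ioc (by linarith) (by linarith)).symm
  rw [this, Measure.restrict_union _ measurableSet_Ioc, Fin.sum_univ_two]
  · congr 3 <;> simp
    ring_nf
  · exact Set.disjoint_left.2 fun x hx hy => not_lt_of_ge hx.2 hy.1

/-- The quarters of a square. -/
noncomputable def quarter (p q h : ℝ) (i : Fin 2 × Fin 2) : Measure (ℝ × ℝ) :=
  μS (p + (i.1 : ℕ) * (h / 2)) (q + (i.2 : ℕ) * (h / 2)) (h / 2)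

lemma μS_eq_sum (p q : ℝ) {h : ℝ} (hh : 0 ≤ h) : μS p q h = ∑ i, quarter p q h i := by
  rw [μS_eq_prod, Ioc_halves p hh, Ioc_halves q hh]
  simp only [quarter, μS_eq_prod, Fintype.sum_prod_type, Fin.sum_univ_two, Measure.prod_add,
    Measure.add_prod]
  abel

lemma quarter_le (p q : ℝ) {h : ℝ} (hh : 0 ≤ h) (i : Fin 2 × Fin 2) :
    quarter p q h i ≤ μS p q h := by
  rw [μS_eq_sum p q hh]
  exact Finset.single_le_sum (f := quarter p q h) (fun _ _ => Measure.zero_le _) (Finset.mem_univ i)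

/-- The Gagliardo energy on a square. -/
noncomputable def enS (σ : ℝ) (v : ℝ × ℝ → ℝ) (p q h : ℝ) : ℝ :=
  (energy (kerQ σ) (μS p q h) v).toReal

lemma enS_nonneg (σ : ℝ) (v : ℝ × ℝ → ℝ) (p q h : ℝ) : 0 ≤ enS σ v p q h := ENNReal.toReal_nonneg

lemma quarter_energy_ne_top {σ : ℝ} {v : ℝ × ℝ → ℝ} {p q h : ℝ} (hh : 0 ≤ h)
    (hE : energy (kerQ σ) (μS p q h) v ≠ ⊤) (i : Fin 2 × Fin 2) :
    energy (kerQ σ) (quarter p q h i) v ≠ ⊤ :=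
  ne_top_of_le_ne_top hE (energy_mono (quarter_le p q hh i))

/-- Interactions between different quarters are dropped. This superadditivity is what lets the
dyadic recursions sum over the quarters without losing a constant at each scale. -/
lemma sum_enS_le {σ : ℝ} {v : ℝ × ℝ → ℝ} {p q h : ℝ} (hh : 0 ≤ h)
    (hE : energy (kerQ σ) (μS p q h) v ≠ ⊤) :
    ∑ i : Fin 2 × Fin 2, enS σ v (p + (i.1 : ℕ) * (h / 2)) (q + (i.2 : ℕ) * (h / 2)) (h / 2) ≤
      enS σ v p q h := by
  unfold enS
  change ∑ i, (energy (kerQ σ) (quarter p q h i) v).toReal ≤ _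
  rw [← ENNReal.toReal_sum fun i _ => quarter_energy_ne_top hh hE i]
  refine ENNReal.toReal_mono hE ?_
  have := sum_energy_le (k := kerQ σ) (v := v) Finset.univ (quarter p q h)
  rwa [← μS_eq_sum p q hh] at this

lemma euclDist_le_of_mem {p q h : ℝ} {x y : ℝ × ℝ} (hx : x ∈ Sq p q h) (hy : y ∈ Sq p q h) :
    euclDist x y ≤ 2 * h := by
  obtain ⟨⟨h1, h2⟩, h3, h4⟩ := hx
  obtain ⟨⟨h5, h6⟩, h7, h8⟩ := hy
  refine Real.sqrt_le_iff.2 ⟨by linarith, ?_⟩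
  have a1 : |x.1 - y.1| ≤ h := abs_le.2 ⟨by linarith, by linarith⟩
  have a2 : |x.2 - y.2| ≤ h := abs_le.2 ⟨by linarith, by linarith⟩
  have := pow_le_pow_left₀ (abs_nonneg _) a1 2
  have := pow_le_pow_left₀ (abs_nonneg _) a2 2
  simp only [sq_abs] at *
  nlinarith

lemma kerQ_le_of_mem {σ p q h : ℝ} (hh : 0 ≤ h) (h0 : 0 ≤ σ) (h1 : σ ≤ 1) {x y : ℝ × ℝ}
    (hx : x ∈ Sq p q h) (hy : y ∈ Sq p q h) : kerQ σ x y ≤ 16 * h ^ (2 + 2 * σ) := by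
  calc kerQ σ x y ≤ (2 * h) ^ (2 + 2 * σ) :=
        Real.rpow_le_rpow (euclDist_nonneg _ _) (euclDist_le_of_mem hx hy) (by linarith)
    _ = 2 ^ (2 + 2 * σ) * h ^ (2 + 2 * σ) := Real.mul_rpow (by norm_num) hh
    -- The exponent is at most 4 because σ ≤ 1; this is the origin of the constant 16.
    _ ≤ 2 ^ (4 : ℝ) * h ^ (2 + 2 * σ) := by
        gcongr
        · norm_num
        · linarith
    _ = _ := by norm_num

lemma ae_kerQ_le {σ p q h : ℝ} (hh : 0 ≤ h) (h0 : 0 ≤ σ) (h1 : σ ≤ 1) :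
    ∀ᵐ x ∂(μS p q h), ∀ᵐ y ∂(μS p q h), kerQ σ x y ≤ 16 * h ^ (2 + 2 * σ) := by
  filter_upwards [ae_restrict_mem (measurableSet_Sq p q h)] with x hx
  filter_upwards [ae_restrict_mem (measurableSet_Sq p q h)] with y hy
  exact kerQ_le_of_mem hh h0 h1 hx hy

/-- The mean value on a square. -/
noncomputable def mS (v : ℝ × ℝ → ℝ) (p q h : ℝ) : ℝ := ⨍ x, v x ∂(μS p q h)

variable {σ : ℝ} {v : ℝ × ℝ → ℝ} {p q h : ℝ}

lemma integral_sub_mS_le (hh : 0 < h) (h0 : 0 ≤ σ) (h1 : σ ≤ 1) (hv : Integrable v (μS p q h))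
    (hE : energy (kerQ σ) (μS p q h) v ≠ ⊤) :
    ∫ x, |v x - mS v p q h| ∂(μS p q h) ≤ 4 * h ^ (1 + σ) * √(enS σ v p q h) := by
  have := integral_sub_average_le (μS_ne_zero p q hh) hv le_rfl (by positivity)
    (kerQ_nonneg σ) (fun x y => eq_of_kerQ_eq_zero) (ae_kerQ_le hh.le h0 h1) hE
  refine this.trans (Real.sqrt_le_iff.2 ⟨by positivity, ?_⟩)
  rw [μS_real_univ p q hh.le, div_self (by positivity), one_mul, mul_pow, mul_pow,
    Real.sq_sqrt (enS_nonneg _ _ _ _ _), ← Real.rpow_natCast (h ^ (1 + σ)),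
    ← Real.rpow_mul hh.le]
  norm_num [enS]
  ring_nf
  rfl

/-- The difference is the mean over the quarter of v minus its mean over the square. The Poincaré
inequality bounds the integral by 2 h^(1+σ) times the root of the energy (mass ratio 1/4, kernel at
most 16 h^(2+2σ)), and division by the area h²/4 gives the factor 8. -/
lemma abs_mS_quarter_sub_le (hh : 0 < h) (h0 : 0 ≤ σ) (h1 : σ ≤ 1) (hv : Integrable v (μS p q h))
    (hE : energy (kerQ σ) (μS p q h) v ≠ ⊤) (i : Fin 2 × Fin 2) :
    |mS v (p + (i.1 : ℕ) * (h / 2)) (q + (i.2 : ℕ) * (h / 2)) (h / 2) - mS v p q h| ≤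
      8 * h ^ (σ - 1) * √(enS σ v p q h) := by
  have hle := quarter_le p q hh.le i
  have hU := μS_real_univ (p + (i.1 : ℕ) * (h / 2)) (q + (i.2 : ℕ) * (h / 2)) (half_pos hh).le
  have hvq : Integrable v (quarter p q h i) := hv.mono_measure hle
  have key := integral_sub_average_le (μS_ne_zero p q hh) hv hle
    (show (0 : ℝ) ≤ 16 * h ^ (2 + 2 * σ) by positivity)
    (kerQ_nonneg σ) (fun x y => eq_of_kerQ_eq_zero) (ae_kerQ_le hh.le h0 h1) hE
  have : IsFiniteMeasure (quarter p q h i) := isFiniteMeasure_of_le _ hle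
  have e : mS v (p + (i.1 : ℕ) * (h / 2)) (q + (i.2 : ℕ) * (h / 2)) (h / 2) - mS v p q h =
      ((h / 2) ^ 2)⁻¹ * ∫ x, (v x - mS v p q h) ∂(quarter p q h i) := by
    rw [integral_sub hvq (integrable_const _), integral_const]
    simp only [quarter, hU, mul_sub, smul_eq_mul]
    rw [← mul_assoc, inv_mul_cancel₀ (by positivity), one_mul]
    congr 1
    rw [mS, average_eq, hU, smul_eq_mul]
  rw [e, abs_mul, abs_of_pos (by positivity), inv_mul_le_iff₀ (by positivity)]
  refine abs_integral_le_integral_abs.trans (key.trans (Real.sqrt_le_iff.2 ⟨by positivity, ?_⟩))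
  rw [mul_pow, mul_pow, mul_pow, Real.sq_sqrt (enS_nonneg _ _ _ _ _), ← Real.rpow_natCast (h ^ (σ - 1)),
    ← Real.rpow_mul hh.le]
  have e2 : h ^ (2 + 2 * σ) = h ^ 4 * h ^ ((σ - 1) * (2 : ℕ)) := by
    rw [← Real.rpow_natCast, ← Real.rpow_add hh]; push_cast; ring_nf
  rw [e2]
  have hU' : (quarter p q h i).real univ = (h / 2) ^ 2 := hU
  rw [hU', μS_real_univ p q hh.le]
  change _ * (enS σ v p q h) ≤ _
  apply le_of_eq
  field_simp
  norm_num
  ring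

end

/-! ### The trace inequality on squares by dyadic recursion. -/

section

/-- The free parameter keeps the coefficient of a² close to 1; with the usual factor 2 the trace
recursion would not contract for all σ > 1/2. -/
lemma sq_add_le_young {η : ℝ} (hη : 0 < η) (a b : ℝ) :
    (a + b) ^ 2 ≤ (1 + η) * a ^ 2 + (1 + 1 / η) * b ^ 2 := by
  have : (1 + η) * a ^ 2 + (1 + 1 / η) * b ^ 2 - (a + b) ^ 2 = (η * a - b) ^ 2 / η := by
    field_simp
    ring
  have h2 : 0 ≤ (η * a - b) ^ 2 / η := by positivity
  linarith

lemma integral_Ioc_halves (f : ℝ → ℝ) (hf : Continuous f) (q : ℝ) {h : ℝ} (hh : 0 ≤ h) :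
    ∫ t in Ioc q (q + h), f t =
      ∑ j : Fin 2, ∫ t in Ioc (q + (j : ℕ) * (h / 2)) (q + (j : ℕ) * (h / 2) + h / 2), f t := by
  rw [Ioc_halves q hh, integral_finsetSum_measure]
  exact fun i _ => hf.integrableOn_Ioc

/-- The closed unit square. -/
def Qc : Set (ℝ × ℝ) := Icc 0 1 ×ˢ Icc 0 1

lemma Sq_subset_Qc {p q h : ℝ} (hp : 0 ≤ p) (hp1 : p + h ≤ 1) (hq : 0 ≤ q) (hq1 : q + h ≤ 1) :
    Sq p q h ⊆ Qc := fun _ hx =>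
  ⟨⟨hp.trans hx.1.1.le, hx.1.2.trans hp1⟩, ⟨hq.trans hx.2.1.le, hx.2.2.trans hq1⟩⟩

lemma integrable_μS {f : ℝ × ℝ → ℝ} (hf : Continuous f) (p q h : ℝ) : Integrable f (μS p q h) := by
  have : IsCompact (Icc p (p + h) ×ˢ Icc q (q + h)) := isCompact_Icc.prod isCompact_Icc
  exact (hf.continuousOn.integrableOn_compact this).mono_set
    (prod_mono Ioc_subset_Icc_self Ioc_subset_Icc_self)

lemma abs_sub_mS_le {ψ : ℝ × ℝ → ℝ} (hψ : Continuous ψ) {L p q h : ℝ} (hh : 0 < h) {x : ℝ × ℝ}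
    (hL : ∀ y ∈ Sq p q h, |ψ x - ψ y| ≤ L) : |ψ x - mS ψ p q h| ≤ L := by
  have hU := μS_real_univ p q hh.le
  have e : ψ x - mS ψ p q h = (h ^ 2)⁻¹ * ∫ y, (ψ x - ψ y) ∂(μS p q h) := by
    rw [integral_sub (integrable_const _) (integrable_μS hψ p q h), integral_const, hU, mS,
      average_eq, hU, mul_sub, smul_eq_mul, smul_eq_mul, ← mul_assoc,
      inv_mul_cancel₀ (by positivity), one_mul]
  rw [e, abs_mul, abs_of_pos (by positivity), inv_mul_le_iff₀ (by positivity)]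
  have := norm_integral_le_of_norm_le_const (μ := μS p q h) (f := fun y => ψ x - ψ y) (C := L) (by
    filter_upwards [ae_restrict_mem (measurableSet_Sq p q h)] with y hy using hL y hy)
  rw [hU] at this
  rw [mul_comm]
  exact this

lemma exists_half (p : ℝ) {h c : ℝ} (hc : c ∈ Icc p (p + h)) :
    ∃ i : Fin 2, c ∈ Icc (p + (i : ℕ) * (h / 2)) (p + (i : ℕ) * (h / 2) + h / 2) := by
  rcases le_total c (p + h / 2) with h1 | h1
  · exact ⟨0, by simpa using ⟨hc.1, h1⟩⟩
  · exact ⟨1, by simpa using ⟨h1, by linarith [hc.2]⟩⟩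

lemma half_bounds (p : ℝ) {h : ℝ} (hh : 0 ≤ h) (hp : 0 ≤ p) (hp1 : p + h ≤ 1) (i : Fin 2) :
    0 ≤ p + (i : ℕ) * (h / 2) ∧ p + (i : ℕ) * (h / 2) + h / 2 ≤ 1 := by
  fin_cases i
  · exact ⟨by simpa using hp, by simp; linarith⟩
  · exact ⟨by simp; linarith, by simp; linarith⟩

/-- Induction on the depth n. At depth 0 the Lipschitz bound gives L²h³. In the step, the segment is
covered by two quarters of the square; on each, the reference mean is changed to that of the quarter
at the cost of `abs_mS_quarter_sub_le`, and Young's inequality separates the two contributions. The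
hypothesis on K says exactly that K survives one step. -/
lemma trace_sq_le_approx {σ η K : ℝ} (hσ0 : 0 ≤ σ) (hσ1 : σ ≤ 1) (hη : 0 < η) (hη1 : η ≤ 1)
    (hK : (1 + η) * K * (1 / 2) ^ (2 * σ - 1) + (1 + 1 / η) * 64 ≤ K) (hK0 : 0 ≤ K)
    {ψ : ℝ × ℝ → ℝ} (hψ : Continuous ψ) {L : ℝ} (hL0 : 0 ≤ L)
    (hL : ∀ x ∈ Qc, ∀ y ∈ Qc, |ψ x - ψ y| ≤ L * dist x y) (n : ℕ) :
    ∀ p q h c : ℝ, 0 < h → 0 ≤ p → p + h ≤ 1 → 0 ≤ q → q + h ≤ 1 → c ∈ Icc p (p + h) →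
      energy (kerQ σ) (μS p q h) ψ ≠ ⊤ →
      ∫ t in Ioc q (q + h), (ψ (c, t) - mS ψ p q h) ^ 2 ≤
        K * h ^ (2 * σ - 1) * enS σ ψ p q h + L ^ 2 * (1 / 2) ^ n * h ^ 3 := by
  induction n with
  | zero =>
    intro p q h c hh hp hp1 hq hq1 hc _
    have h1 : ∫ t in Ioc q (q + h), (ψ (c, t) - mS ψ p q h) ^ 2 ≤
        ∫ t in Ioc q (q + h), (L * h) ^ 2 := by
      refine setIntegral_mono_on (Continuous.integrableOn_Ioc (by fun_prop))
        (continuous_const.integrableOn_Ioc) measurableSet_Ioc fun t ht => ?_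
      refine sq_le_sq' ?_ ?_ <;> [refine neg_le_of_abs_le ?_; refine le_of_abs_le ?_] <;>
      · refine abs_sub_mS_le hψ hh fun y hy => ?_
        refine (hL _ ⟨⟨hp.trans hc.1, hc.2.trans hp1⟩, ⟨hq.trans ht.1.le, ht.2.trans hq1⟩⟩ _
          (Sq_subset_Qc hp hp1 hq hq1 hy)).trans (mul_le_mul_of_nonneg_left ?_ hL0)
        rw [Prod.dist_eq]
        obtain ⟨⟨a1, a2⟩, a3, a4⟩ := hy
        refine max_le ?_ ?_ <;> rw [Real.dist_eq, abs_le] <;> constructor <;>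
          linarith [hc.1, hc.2, ht.1, ht.2]
    refine h1.trans ?_
    have := enS_nonneg σ ψ p q h
    have h2 : 0 ≤ K * h ^ (2 * σ - 1) * enS σ ψ p q h := by positivity
    simp [hh.le]
    nlinarith
  | succ n ih =>
    intro p q h c hh hp hp1 hq hq1 hc hE
    obtain ⟨i, hi⟩ := exists_half p hc
    set P := p + (i : ℕ) * (h / 2) with hP
    set Y : Fin 2 → ℝ := fun j => q + (j : ℕ) * (h / 2) with hY
    set m : Fin 2 → ℝ := fun j => mS ψ P (Y j) (h / 2) with hm
    have hint := integrable_μS hψ p q h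
    have hh2 : 0 < h / 2 := half_pos hh
    have step : ∀ j : Fin 2, ∫ t in Ioc (Y j) (Y j + h / 2), (ψ (c, t) - mS ψ p q h) ^ 2 ≤
        (1 + η) * (K * (h / 2) ^ (2 * σ - 1) * enS σ ψ P (Y j) (h / 2) +
          L ^ 2 * (1 / 2) ^ n * (h / 2) ^ 3) +
        (1 + 1 / η) * (h / 2) * (64 * h ^ (2 * σ - 2) * enS σ ψ p q h) := by
      intro j
      have hb1 := half_bounds p hh.le hp hp1 i
      have hb2 := half_bounds q hh.le hq hq1 j
      have ih' := ih P (Y j) (h / 2) c hh2 hb1.1 hb1.2 hb2.1 hb2.2 hi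
        (quarter_energy_ne_top hh.le hE (i, j))
      have hd := abs_mS_quarter_sub_le hh hσ0 hσ1 hint hE (i, j)
      have hd2 : (m j - mS ψ p q h) ^ 2 ≤ 64 * h ^ (2 * σ - 2) * enS σ ψ p q h := by
        have := pow_le_pow_left₀ (abs_nonneg _) hd 2
        rw [sq_abs, mul_pow, mul_pow, Real.sq_sqrt (enS_nonneg _ _ _ _ _),
          ← Real.rpow_natCast (h ^ (σ - 1)), ← Real.rpow_mul hh.le] at this
        refine this.trans (le_of_eq ?_)
        norm_num
        ring_nf
        simp
      calc ∫ t in Ioc (Y j) (Y j + h / 2), (ψ (c, t) - mS ψ p q h) ^ 2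
          ≤ ∫ t in Ioc (Y j) (Y j + h / 2), ((1 + η) * (ψ (c, t) - m j) ^ 2 +
              (1 + 1 / η) * (m j - mS ψ p q h) ^ 2) := by
            refine setIntegral_mono_on (Continuous.integrableOn_Ioc (by fun_prop))
              (Continuous.integrableOn_Ioc (by fun_prop)) measurableSet_Ioc fun t _ => ?_
            have := sq_add_le_young hη (ψ (c, t) - m j) (m j - mS ψ p q h)
            simpa using this
        _ = (1 + η) * (∫ t in Ioc (Y j) (Y j + h / 2), (ψ (c, t) - m j) ^ 2) +
              (1 + 1 / η) * (h / 2) * (m j - mS ψ p q h) ^ 2 := by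
            rw [integral_add (Continuous.integrableOn_Ioc (by fun_prop))
              (Continuous.integrableOn_Ioc (by fun_prop)), integral_const_mul]
            simp [hh2.le]
            ring
        _ ≤ _ := by gcongr
    rw [integral_Ioc_halves _ (by fun_prop) q hh.le]
    refine (Finset.sum_le_sum fun j _ => step j).trans ?_
    -- Only the two quarters in the column containing the abscissa c are used, and their energies
    -- are part of the sum over all four.
    have hsum : ∑ j : Fin 2, enS σ ψ P (Y j) (h / 2) ≤ enS σ ψ p q h := by
      refine le_trans ?_ (sum_enS_le hh.le hE)
      rw [Fintype.sum_prod_type]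
      exact Finset.single_le_sum (f := fun i' : Fin 2 => ∑ j : Fin 2,
        enS σ ψ (p + (i' : ℕ) * (h / 2)) (q + (j : ℕ) * (h / 2)) (h / 2))
        (fun _ _ => Finset.sum_nonneg fun _ _ => enS_nonneg _ _ _ _ _) (Finset.mem_univ i)
    have e1 : (h / 2) ^ (2 * σ - 1) = (1 / 2) ^ (2 * σ - 1) * h ^ (2 * σ - 1) := by
      rw [← Real.mul_rpow (by norm_num) hh.le]; ring_nf
    have e2 : h * h ^ (2 * σ - 2) = h ^ (2 * σ - 1) := by
      nth_rewrite 1 [← Real.rpow_one h]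
      rw [← Real.rpow_add hh]; ring_nf
    have he := enS_nonneg σ ψ p q h
    -- The two halves contribute (h/2)³ each, so the Lipschitz remainder is multiplied by (1 + η)/4,
    -- which is at most 1/2 since η ≤ 1.
    calc _ = (1 + η) * K * (h / 2) ^ (2 * σ - 1) * (∑ j : Fin 2, enS σ ψ P (Y j) (h / 2)) +
          (1 + 1 / η) * 64 * (h * h ^ (2 * σ - 2)) * enS σ ψ p q h +
          (1 + η) / 2 * (L ^ 2 * (1 / 2) ^ (n + 1) * h ^ 3) := by
            simp only [Fin.sum_univ_two]; ring
      _ ≤ (1 + η) * K * (h / 2) ^ (2 * σ - 1) * enS σ ψ p q h +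
          (1 + 1 / η) * 64 * (h * h ^ (2 * σ - 2)) * enS σ ψ p q h +
          1 * (L ^ 2 * (1 / 2) ^ (n + 1) * h ^ 3) := by gcongr; linarith
      _ = ((1 + η) * K * (1 / 2) ^ (2 * σ - 1) + (1 + 1 / η) * 64) * h ^ (2 * σ - 1) *
          enS σ ψ p q h + L ^ 2 * (1 / 2) ^ (n + 1) * h ^ 3 := by rw [e1, e2]; ring
      _ ≤ _ := by gcongr

lemma exists_lipschitz_Qc {ψ : ℝ × ℝ → ℝ} (hψ : ContDiff ℝ 1 ψ) :
    ∃ L : ℝ, 0 ≤ L ∧ (∀ x ∈ Qc, ∀ y ∈ Qc, |ψ x - ψ y| ≤ L * dist x y) ∧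
      ∀ x ∈ Qc, ‖fderiv ℝ ψ x‖ ≤ L := by
  have hc : IsCompact Qc := isCompact_Icc.prod isCompact_Icc
  obtain ⟨L, hL⟩ := hc.exists_bound_of_continuousOn (hψ.continuous_fderiv one_ne_zero).continuousOn
  have h0 : (0, 0) ∈ Qc := by simp [Qc]
  refine ⟨L, (norm_nonneg _).trans (hL _ h0), fun x hx y hy => ?_, hL⟩
  have hconv : Convex ℝ Qc := (convex_Icc 0 1).prod (convex_Icc 0 1)
  have := hconv.norm_image_sub_le_of_norm_fderiv_le
    (fun x _ => (hψ.differentiable one_ne_zero) x) hL hy hx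
  rwa [← dist_eq_norm x y] at this

/-- The trace inequality on squares. -/
lemma exists_trace_sq_le {σ : ℝ} (hσ : 1 / 2 < σ) (hσ1 : σ < 1) :
    ∃ K : ℝ, 0 < K ∧ ∀ ψ : ℝ × ℝ → ℝ, ContDiff ℝ 1 ψ →
      ∀ p q h c : ℝ, 0 < h → 0 ≤ p → p + h ≤ 1 → 0 ≤ q → q + h ≤ 1 → c ∈ Icc p (p + h) →
      energy (kerQ σ) (μS p q h) ψ ≠ ⊤ →
      ∫ t in Ioc q (q + h), (ψ (c, t) - mS ψ p q h) ^ 2 ≤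
        K * h ^ (2 * σ - 1) * enS σ ψ p q h := by
  set r : ℝ := (1 / 2) ^ (2 * σ - 1) with hr
  have hr0 : 0 < r := by positivity
  have hr1 : r < 1 := Real.rpow_lt_one (by norm_num) (by norm_num) (by linarith)
  -- This choice keeps (1 + η) r below 1, which is where σ > 1/2 is used.
  set η := (1 - r) / 2 with hη
  have hη0 : 0 < η := by rw [hη]; linarith
  have hlt : 0 < 1 - (1 + η) * r := by rw [hη]; nlinarith
  -- The constant is the fixed point of K ↦ (1 + η) r K + 64 (1 + 1/η). Letting the depth tend to
  -- infinity then removes the Lipschitz remainder.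
  refine ⟨(1 + 1 / η) * 64 / (1 - (1 + η) * r), by positivity, ?_⟩
  intro ψ hψ p q h c hh hp hp1 hq hq1 hc hE
  obtain ⟨L, hL0, hL, -⟩ := exists_lipschitz_Qc hψ
  have key := fun n => trace_sq_le_approx (σ := σ) (η := η)
    (K := (1 + 1 / η) * 64 / (1 - (1 + η) * r)) (by linarith) hσ1.le hη0
    (by rw [hη]; linarith) (by rw [← hr]; field_simp; ring_nf; rfl) (by positivity)
    hψ.continuous hL0 hL n p q h c hh hp hp1 hq hq1 hc hE
  refine ge_of_tendsto' (x := atTop) ?_ key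
  have h1 : Tendsto (fun n : ℕ => ((1 : ℝ) / 2) ^ n) atTop (𝓝 0) :=
    tendsto_pow_atTop_nhds_zero_of_lt_one (by norm_num) (by norm_num)
  simpa using ((h1.const_mul (L ^ 2)).mul_const (h ^ 3)).const_add
    ((1 + 1 / η) * 64 / (1 - (1 + η) * r) * h ^ (2 * σ - 1) * enS σ ψ p q h)

end

/-! ### Integrals of derivatives and the dyadic pairing estimate. -/

section

lemma integral_abs_sq_le {X : Type*} [MeasurableSpace X] {μ : Measure X} [IsFiniteMeasure μ]
    {f : X → ℝ} (hf : MemLp f 2 μ) : (∫ x, |f x| ∂μ) ^ 2 ≤ μ.real univ * ∫ x, f x ^ 2 ∂μ := by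
  have h := lintegral_sq_le (μ := μ) (fun x => ‖f x‖ₑ) hf.1.enorm
  have e1 : ∫ x, |f x| ∂μ = (∫⁻ x, ‖f x‖ₑ ∂μ).toReal :=
    integral_norm_eq_lintegral_enorm hf.1
  have e2 : ∫ x, f x ^ 2 ∂μ = (∫⁻ x, ‖f x‖ₑ ^ 2 ∂μ).toReal := by
    rw [integral_eq_lintegral_of_nonneg_ae (ae_of_all _ fun _ => sq_nonneg _) (hf.1.pow 2)]
    congr 2 with x
    rw [Real.enorm_eq_ofReal_abs, ← ENNReal.ofReal_pow (abs_nonneg _), sq_abs]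
  have hfin : ∫⁻ x, ‖f x‖ₑ ^ 2 ∂μ ≠ ⊤ := by
    have := lintegral_rpow_enorm_lt_top_of_eLpNorm_lt_top (p := 2) two_ne_zero (by simp) hf.2
    simpa using this.ne
  rw [e1, e2, ← ENNReal.toReal_pow, Measure.real, ← ENNReal.toReal_mul]
  exact ENNReal.toReal_mono (by finiteness) h

lemma hasDerivAt_slice_fst {ψ : ℝ × ℝ → ℝ} (hψ : ContDiff ℝ 1 ψ) (a b : ℝ) :
    HasDerivAt (fun t => ψ (t, b)) (pd 0 ψ (a, b)) a := by
  have h := ((hψ.differentiable one_ne_zero) (a, b)).hasFDerivAt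
  have h2 : HasDerivAt (fun t : ℝ => (t, b)) ((1 : ℝ), (0 : ℝ)) a :=
    (hasDerivAt_id a).prodMk (hasDerivAt_const a b)
  exact h.comp_hasDerivAt a h2

lemma hasDerivAt_slice_snd {ψ : ℝ × ℝ → ℝ} (hψ : ContDiff ℝ 1 ψ) (a b : ℝ) :
    HasDerivAt (fun t => ψ (a, t)) (pd 1 ψ (a, b)) b := by
  have h := ((hψ.differentiable one_ne_zero) (a, b)).hasFDerivAt
  have h2 : HasDerivAt (fun t : ℝ => (a, t)) ((0 : ℝ), (1 : ℝ)) b :=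
    (hasDerivAt_const b a).prodMk (hasDerivAt_id b)
  exact h.comp_hasDerivAt b h2

lemma continuous_pd {ψ : ℝ × ℝ → ℝ} (hψ : ContDiff ℝ 1 ψ) (i : Fin 2) : Continuous (pd i ψ) := by
  have := hψ.continuous_fderiv one_ne_zero
  unfold pd
  fun_prop

lemma abs_pd_le (ψ : ℝ × ℝ → ℝ) (i : Fin 2) (x : ℝ × ℝ) : |pd i ψ x| ≤ ‖fderiv ℝ ψ x‖ := by
  refine ((fderiv ℝ ψ x).le_opNorm _).trans ?_
  have : ‖(![((1 : ℝ), (0 : ℝ)), (0, 1)] : Fin 2 → ℝ × ℝ) i‖ = 1 := by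
    fin_cases i <;> simp [Prod.norm_def]
  rw [this, mul_one]

lemma integral_pd_zero {ψ : ℝ × ℝ → ℝ} (hψ : ContDiff ℝ 1 ψ) (p q : ℝ) {h : ℝ} (hh : 0 ≤ h) :
    ∫ x, pd 0 ψ x ∂(μS p q h) = ∫ t in Ioc q (q + h), (ψ (p + h, t) - ψ (p, t)) := by
  have hi := integrable_μS (continuous_pd hψ 0) p q h
  rw [μS_eq_prod] at hi ⊢
  rw [integral_prod_symm _ hi]
  refine integral_congr_ae (ae_of_all _ fun t => ?_)
  simp only
  have hle : p ≤ p + h := by linarith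
  rw [← intervalIntegral.integral_of_le hle]
  refine intervalIntegral.integral_eq_sub_of_hasDerivAt
    (fun x _ => hasDerivAt_slice_fst hψ x t) (Continuous.intervalIntegrable ?_ _ _)
  have := continuous_pd hψ 0
  fun_prop

lemma integral_pd_one {ψ : ℝ × ℝ → ℝ} (hψ : ContDiff ℝ 1 ψ) (p q : ℝ) {h : ℝ} (hh : 0 ≤ h) :
    ∫ x, pd 1 ψ x ∂(μS p q h) = ∫ t in Ioc p (p + h), (ψ (t, q + h) - ψ (t, q)) := by
  have hi := integrable_μS (continuous_pd hψ 1) p q h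
  rw [μS_eq_prod] at hi ⊢
  rw [integral_prod _ hi]
  refine integral_congr_ae (ae_of_all _ fun t => ?_)
  simp only
  have hle : q ≤ q + h := by linarith
  rw [← intervalIntegral.integral_of_le hle]
  refine intervalIntegral.integral_eq_sub_of_hasDerivAt
    (fun x _ => hasDerivAt_slice_snd hψ t x) (Continuous.intervalIntegrable ?_ _ _)
  have := continuous_pd hψ 1
  fun_prop

/-- The integral of ∂₁ψ is the difference of the integrals of ψ over the two vertical sides.
Subtracting the same mean from both and applying the trace inequality to each side gives the bound,
with σ > 1/2 but no derivative of ψ on the right. -/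
lemma exists_abs_integral_pd_zero_le {σ : ℝ} (hσ : 1 / 2 < σ) (hσ1 : σ < 1) :
    ∃ K : ℝ, 0 < K ∧ ∀ ψ : ℝ × ℝ → ℝ, ContDiff ℝ 1 ψ →
      ∀ p q h : ℝ, 0 < h → 0 ≤ p → p + h ≤ 1 → 0 ≤ q → q + h ≤ 1 →
      energy (kerQ σ) (μS p q h) ψ ≠ ⊤ →
      |∫ x, pd 0 ψ x ∂(μS p q h)| ≤ K * h ^ σ * √(enS σ ψ p q h) := by
  obtain ⟨K, hK0, hK⟩ := exists_trace_sq_le hσ hσ1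
  refine ⟨2 * √K, by positivity, ?_⟩
  intro ψ hψ p q h hh hp hp1 hq hq1 hE
  have hψc := hψ.continuous
  have key : ∀ c ∈ Icc p (p + h), ∫ t in Ioc q (q + h), |ψ (c, t) - mS ψ p q h| ≤
      √K * h ^ σ * √(enS σ ψ p q h) := by
    intro c hc
    have h1 := hK ψ hψ p q h c hh hp hp1 hq hq1 hc hE
    have hm : MemLp (fun t => ψ (c, t) - mS ψ p q h) 2 (volume.restrict (Ioc q (q + h))) := by
      have hcont : Continuous (fun t => ψ (c, t) - mS ψ p q h) := by fun_prop
      exact (memLp_two_iff_integrable_sq hcont.aestronglyMeasurable).2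
        (Continuous.integrableOn_Ioc (by fun_prop))
    have h2 := integral_abs_sq_le hm
    refine (Real.le_sqrt_of_sq_le (y := K * (h ^ σ) ^ 2 * enS σ ψ p q h) (h2.trans ?_)).trans
      (le_of_eq ?_)
    · have : (volume.restrict (Ioc q (q + h))).real univ = h := by simp [hh.le]
      rw [this]
      refine (mul_le_mul_of_nonneg_left h1 hh.le).trans (le_of_eq ?_)
      have : (h ^ σ) ^ 2 = h * h ^ (2 * σ - 1) := by
        nth_rewrite 2 [← Real.rpow_one h]
        rw [← Real.rpow_add hh, ← Real.rpow_natCast, ← Real.rpow_mul hh.le]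
        push_cast; ring_nf
      rw [this]; ring
    · rw [Real.sqrt_mul (by positivity), Real.sqrt_mul hK0.le, Real.sqrt_sq (by positivity)]
  rw [integral_pd_zero hψ p q hh.le]
  have e : ∫ t in Ioc q (q + h), (ψ (p + h, t) - ψ (p, t)) =
      (∫ t in Ioc q (q + h), (ψ (p + h, t) - mS ψ p q h)) -
        ∫ t in Ioc q (q + h), (ψ (p, t) - mS ψ p q h) := by
    rw [← integral_sub (Continuous.integrableOn_Ioc (by fun_prop))
      (Continuous.integrableOn_Ioc (by fun_prop))]
    simp
  rw [e]
  refine (abs_sub _ _).trans ?_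
  have k1 := abs_integral_le_integral_abs.trans (key (p + h) ⟨by linarith, le_rfl⟩)
  have k2 := abs_integral_le_integral_abs.trans (key p ⟨le_rfl, by linarith⟩)
  linarith

lemma sum_sqrt_le_two (f : Fin 2 × Fin 2 → ℝ) (hf : ∀ i, 0 ≤ f i) :
    ∑ i, √(f i) ≤ 2 * √(∑ i, f i) := by
  have := Real.sum_sqrt_mul_sqrt_le Finset.univ (f := fun _ : Fin 2 × Fin 2 => (1 : ℝ)) (g := f)
    (fun _ => zero_le_one) hf
  simp only [Real.sqrt_one, one_mul, Finset.sum_const, Finset.card_univ, Fintype.card_prod,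
    Fintype.card_fin] at this
  refine this.trans (le_of_eq ?_)
  congr 1
  rw [show ((2 * 2) • (1 : ℝ)) = 2 ^ 2 by norm_num, Real.sqrt_sq (by norm_num)]

/-- Again induction on the depth. At depth 0 the derivative is bounded by L and the Poincaré
inequality handles u. In the step, the pairings on the quarters are summed by Cauchy-Schwarz and
superadditivity of both energies, gaining (1/2)^(s+σ-1), while the four changes of mean cost 4 · 8 ·
K' = 32 K'. -/
lemma pairing_approx {s σ K K' : ℝ} (hs0 : 0 < s) (hs1 : s ≤ 1)
    (hK' : 0 ≤ K') (hK : K * (1 / 2) ^ (s + σ - 1) + 32 * K' ≤ K) (hK0 : 0 ≤ K) (hσ0 : 0 ≤ σ)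
    {ψ : ℝ × ℝ → ℝ} (hψ : ContDiff ℝ 1 ψ)
    (hflux : ∀ p q h : ℝ, 0 < h → 0 ≤ p → p + h ≤ 1 → 0 ≤ q → q + h ≤ 1 →
      energy (kerQ σ) (μS p q h) ψ ≠ ⊤ →
      |∫ x, pd 0 ψ x ∂(μS p q h)| ≤ K' * h ^ σ * √(enS σ ψ p q h))
    {L : ℝ} (hL0 : 0 ≤ L) (hL : ∀ x ∈ Qc, |pd 0 ψ x| ≤ L) (u : ℝ × ℝ → ℝ) (n : ℕ) :
    ∀ p q h : ℝ, 0 < h → 0 ≤ p → p + h ≤ 1 → 0 ≤ q → q + h ≤ 1 →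
      energy (kerQ σ) (μS p q h) ψ ≠ ⊤ → energy (kerQ s) (μS p q h) u ≠ ⊤ →
      Integrable u (μS p q h) →
      |∫ x, (u x - mS u p q h) * pd 0 ψ x ∂(μS p q h)| ≤
        K * h ^ (s + σ - 1) * (√(enS s u p q h) * √(enS σ ψ p q h)) +
          4 * L * ((1 / 2) ^ s) ^ n * h ^ (1 + s) * √(enS s u p q h) := by
  induction n with
  | zero =>
    intro p q h hh hp hp1 hq hq1 _ hEu hu
    have h1 := integral_sub_mS_le hh hs0.le hs1 hu hEu
    have hi : Integrable (fun x => |u x - mS u p q h|) (μS p q h) :=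
      (hu.sub (integrable_const _)).abs
    have h2 : |∫ x, (u x - mS u p q h) * pd 0 ψ x ∂(μS p q h)| ≤
        L * ∫ x, |u x - mS u p q h| ∂(μS p q h) := by
      rw [← integral_const_mul]
      refine norm_integral_le_of_norm_le (f := fun x => (u x - mS u p q h) * pd 0 ψ x)
        (hi.const_mul L) ?_
      filter_upwards [ae_restrict_mem (measurableSet_Sq p q h)] with x hx
      rw [norm_mul, mul_comm]
      exact mul_le_mul_of_nonneg_right (hL x (Sq_subset_Qc hp hp1 hq hq1 hx)) (norm_nonneg _)
    have h3 : 0 ≤ K * h ^ (s + σ - 1) * (√(enS s u p q h) * √(enS σ ψ p q h)) := by positivity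
    have h4 := mul_le_mul_of_nonneg_left h1 hL0
    simp only [pow_zero, mul_one]
    nlinarith
  | succ n ih =>
    intro p q h hh hp hp1 hq hq1 hEψ hEu hu
    set P : Fin 2 × Fin 2 → ℝ := fun i => p + (i.1 : ℕ) * (h / 2) with hP
    set Y : Fin 2 × Fin 2 → ℝ := fun i => q + (i.2 : ℕ) * (h / 2) with hY
    have hh2 : 0 < h / 2 := half_pos hh
    have hbd : ∀ᵐ x ∂(μS p q h), ‖pd 0 ψ x‖ ≤ L := by
      filter_upwards [ae_restrict_mem (measurableSet_Sq p q h)] with x hx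
        using hL x (Sq_subset_Qc hp hp1 hq hq1 hx)
    have hmul : ∀ m : ℝ, Integrable (fun x => (u x - m) * pd 0 ψ x) (μS p q h) := fun m =>
      (hu.sub (integrable_const m)).mul_bdd (c := L) (continuous_pd hψ 0).aestronglyMeasurable hbd
    have hpd : Integrable (pd 0 ψ) (μS p q h) := integrable_μS (continuous_pd hψ 0) p q h
    have step : ∀ i : Fin 2 × Fin 2,
        |∫ x, (u x - mS u p q h) * pd 0 ψ x ∂(quarter p q h i)| ≤
          K * (h / 2) ^ (s + σ - 1) *
            (√(enS s u (P i) (Y i) (h / 2)) * √(enS σ ψ (P i) (Y i) (h / 2))) +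
          4 * L * ((1 / 2) ^ s) ^ n * (h / 2) ^ (1 + s) * √(enS s u (P i) (Y i) (h / 2)) +
          8 * h ^ (s - 1) * √(enS s u p q h) * (K' * h ^ σ * √(enS σ ψ p q h)) := by
      intro i
      have hle := quarter_le p q hh.le i
      have hb1 := half_bounds p hh.le hp hp1 i.1
      have hb2 := half_bounds q hh.le hq hq1 i.2
      have ih' := ih (P i) (Y i) (h / 2) hh2 hb1.1 hb1.2 hb2.1 hb2.2
        (quarter_energy_ne_top hh.le hEψ i) (quarter_energy_ne_top hh.le hEu i)
        (hu.mono_measure hle)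
      have hd := abs_mS_quarter_sub_le hh hs0.le hs1 hu hEu i
      have hf := hflux (P i) (Y i) (h / 2) hh2 hb1.1 hb1.2 hb2.1 hb2.2
        (quarter_energy_ne_top hh.le hEψ i)
      have hf2 : |∫ x, pd 0 ψ x ∂(quarter p q h i)| ≤ K' * h ^ σ * √(enS σ ψ p q h) := by
        refine hf.trans ?_
        have : enS σ ψ (P i) (Y i) (h / 2) ≤ enS σ ψ p q h :=
          ENNReal.toReal_mono hEψ (energy_mono hle)
        gcongr
        linarith
      -- The reference mean is moved from the square to the quarter; the resulting constant jump
      -- multiplies the integral of ∂₁ψ alone, to which the flux hypothesis applies.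
      have e : ∫ x, (u x - mS u p q h) * pd 0 ψ x ∂(quarter p q h i) =
          ∫ x, (u x - mS u (P i) (Y i) (h / 2)) * pd 0 ψ x ∂(μS (P i) (Y i) (h / 2)) +
            (mS u (P i) (Y i) (h / 2) - mS u p q h) * ∫ x, pd 0 ψ x ∂(quarter p q h i) := by
        rw [← integral_const_mul]
        change _ = ∫ x, _ ∂(quarter p q h i) + _
        rw [← integral_add ((hmul _).mono_measure hle) ((hpd.mono_measure hle).const_mul _)]
        congr 1 with x
        ring
      rw [e]
      refine (abs_add_le _ _).trans (add_le_add ih' ?_)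
      rw [abs_mul]
      gcongr
    rw [μS_eq_sum p q hh.le, integral_finsetSum_measure
      fun i _ => (hmul _).mono_measure (quarter_le p q hh.le i)]
    refine (Finset.abs_sum_le_sum_abs _ _).trans ((Finset.sum_le_sum fun i _ => step i).trans ?_)
    have hsu := sum_enS_le hh.le hEu
    have hsψ := sum_enS_le hh.le hEψ
    have cs : ∑ i, √(enS s u (P i) (Y i) (h / 2)) * √(enS σ ψ (P i) (Y i) (h / 2)) ≤
        √(enS s u p q h) * √(enS σ ψ p q h) :=
      (Real.sum_sqrt_mul_sqrt_le _ (fun _ => enS_nonneg _ _ _ _ _)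
        (fun _ => enS_nonneg _ _ _ _ _)).trans (by gcongr)
    have cs2 : ∑ i, √(enS s u (P i) (Y i) (h / 2)) ≤ 2 * √(enS s u p q h) :=
      (sum_sqrt_le_two _ (fun _ => enS_nonneg _ _ _ _ _)).trans (by gcongr)
    have e1 : (h / 2) ^ (s + σ - 1) = (1 / 2) ^ (s + σ - 1) * h ^ (s + σ - 1) := by
      rw [← Real.mul_rpow (by norm_num) hh.le]; ring_nf
    have e2 : h ^ (s - 1) * h ^ σ = h ^ (s + σ - 1) := by
      rw [← Real.rpow_add hh]; ring_nf
    have e3 : (h / 2) ^ (1 + s) * 2 = (1 / 2) ^ s * h ^ (1 + s) := by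
      rw [show h / 2 = 1 / 2 * h by ring, Real.mul_rpow (by norm_num) hh.le,
        Real.rpow_add (by norm_num) 1 s, Real.rpow_one]
      ring
    rw [Finset.sum_add_distrib, Finset.sum_add_distrib, ← Finset.mul_sum, ← Finset.mul_sum,
      Finset.sum_const]
    simp only [Finset.card_univ, Fintype.card_prod, Fintype.card_fin, nsmul_eq_mul]
    -- In the remainder, summing four square roots costs a factor 2, and 2 (h/2)^(1+s) = (1/2)^s
    -- h^(1+s), so it decays geometrically in the depth.
    calc _ ≤ K * (h / 2) ^ (s + σ - 1) * (√(enS s u p q h) * √(enS σ ψ p q h)) +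
          4 * L * ((1 / 2) ^ s) ^ n * (h / 2) ^ (1 + s) * (2 * √(enS s u p q h)) +
          ((2 * 2 : ℕ) : ℝ) *
            (8 * h ^ (s - 1) * √(enS s u p q h) * (K' * h ^ σ * √(enS σ ψ p q h))) := by
          gcongr
      _ = (K * (1 / 2) ^ (s + σ - 1) + 32 * K') * h ^ (s + σ - 1) *
            (√(enS s u p q h) * √(enS σ ψ p q h)) +
          4 * L * ((1 / 2) ^ s) ^ n * ((h / 2) ^ (1 + s) * 2) * √(enS s u p q h) := by
          rw [e1, ← e2]; push_cast; ring
      _ ≤ K * h ^ (s + σ - 1) * (√(enS s u p q h) * √(enS σ ψ p q h)) +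
          4 * L * ((1 / 2) ^ s) ^ n * ((h / 2) ^ (1 + s) * 2) * √(enS s u p q h) := by
          gcongr
      _ = _ := by rw [e3, pow_succ]; ring

end

/-! ### Norms on the unit square; global pairing and trace bounds. -/

section

lemma ennreal_add_sq_le (a b : ℝ≥0∞) : (a + b) ^ 2 ≤ 2 * a ^ 2 + 2 * b ^ 2 := by
  have := ENNReal.rpow_add_le_mul_rpow_add_rpow a b (p := 2) (by norm_num)
  norm_num at this
  rwa [mul_add] at this

lemma ennreal_le_of_sq_le {a b : ℝ≥0∞} (h : a ^ 2 ≤ b ^ 2) : a ≤ b :=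
  (ENNReal.rpow_le_rpow_iff (z := 2) (by norm_num)).1 (by simpa using h)

lemma eLpNorm_two_sq {X : Type*} [MeasurableSpace X] (μ : Measure X) (f : X → ℝ) :
    eLpNorm f 2 μ ^ 2 = ∫⁻ x, ‖f x‖ₑ ^ 2 ∂μ := by
  have := eLpNorm_nnreal_pow_eq_lintegral (μ := μ) (f := f) (p := 2) two_ne_zero
  simpa using this

lemma eLpNorm_two_sq_eq_integral {X : Type*} [MeasurableSpace X] {μ : Measure X} {f : X → ℝ}
    (hf : MemLp f 2 μ) : eLpNorm f 2 μ ^ 2 = ENNReal.ofReal (∫ x, f x ^ 2 ∂μ) := by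
  rw [eLpNorm_two_sq, ofReal_integral_eq_lintegral_ofReal hf.integrable_sq
    (ae_of_all _ fun _ => sq_nonneg _)]
  refine lintegral_congr fun x => ?_
  rw [Real.enorm_eq_ofReal_abs, ← ENNReal.ofReal_pow (abs_nonneg _), sq_abs]

/-- The square of the norm of `H^σ(Q)`, `0 < σ < 1`. -/
noncomputable def NQ (σ : ℝ) (v : ℝ × ℝ → ℝ) : ℝ≥0∞ := normL2 v ^ 2 + gagliardoSq σ v

lemma isWeakDeriv_zero (v : ℝ × ℝ → ℝ) : IsWeakDeriv (0, 0) v v := by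
  intro φ _
  simp [pdPow]

lemma memLp_of_normH_lt_top {s : ℝ} {v : ℝ × ℝ → ℝ} (h : normH s v < ⊤) : MemLp v 2 μQ := by
  unfold normH at h
  simp only [iInf_lt_top] at h
  obtain ⟨g, hg, -⟩ := h
  have := hg.memLp (0, 0) (by simp)
  rwa [hg.zero] at this

/-- For σ < 1 the integer part is 0, so only the member of index (0, 0) enters, and it equals v. All
admissible families give the same value, and the constant family shows that the infimum is not over
an empty set. -/
lemma normH_eq {σ : ℝ} (h0 : 0 < σ) (h1 : σ < 1) {v : ℝ × ℝ → ℝ} (hv : MemLp v 2 μQ) :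
    normH σ v = NQ σ v ^ (1 / 2 : ℝ) := by
  have hf : ⌊σ⌋₊ = 0 := Nat.floor_eq_zero.2 h1
  have e : ∀ g : ℕ × ℕ → ℝ × ℝ → ℝ, g (0, 0) = v →
      ((∑ k ∈ Finset.range (⌊σ⌋₊ + 1),
        ∑ α ∈ Finset.HasAntidiagonal.antidiagonal k, normL2 (g α) ^ 2) +
      (if σ = ⌊σ⌋₊ then 0
        else ∑ α ∈ Finset.HasAntidiagonal.antidiagonal ⌊σ⌋₊, gagliardoSq (σ - ⌊σ⌋₊) (g α)))
          ^ (1 / 2 : ℝ) = NQ σ v ^ (1 / 2 : ℝ) := by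
    intro g hg
    simp [hf, h0.ne', hg, NQ]
  unfold normH
  refine le_antisymm ?_ (le_iInf₂ fun g hg => (e g hg.zero).ge)
  have hg : IsWeakDerivs ⌊σ⌋₊ v (fun _ => v) := by
    rw [hf]
    have h00 : ∀ α : ℕ × ℕ, α.1 + α.2 ≤ 0 → α = (0, 0) := fun α hα => by
      ext <;> simp only <;> omega
    exact ⟨rfl, fun _ _ => hv, fun α hα => by rw [h00 α hα]; exact isWeakDeriv_zero v⟩
  exact (iInf₂_le (fun _ => v) hg).trans (e _ rfl).le

lemma normH_sq {σ : ℝ} (h0 : 0 < σ) (h1 : σ < 1) {v : ℝ × ℝ → ℝ} (hv : MemLp v 2 μQ) :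
    normH σ v ^ 2 = NQ σ v := by
  rw [normH_eq h0 h1 hv, ← ENNReal.rpow_natCast, ← ENNReal.rpow_mul]
  norm_num

lemma NQ_lt_top {σ : ℝ} (h0 : 0 < σ) (h1 : σ < 1) {v : ℝ × ℝ → ℝ} (h : normH σ v < ⊤) :
    NQ σ v < ⊤ := by
  rw [← normH_sq h0 h1 (memLp_of_normH_lt_top h)]
  exact ENNReal.pow_lt_top h

lemma memLp_of_continuous {ψ : ℝ × ℝ → ℝ} (hψ : Continuous ψ) : MemLp ψ 2 μQ := by
  rw [μQ_eq_μS]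
  exact (memLp_two_iff_integrable_sq hψ.aestronglyMeasurable).2
    (integrable_μS (hψ.pow 2) 0 0 1)

lemma NQ_add_le {σ : ℝ} {v w : ℝ × ℝ → ℝ} (hv : MemLp v 2 μQ) (hw : MemLp w 2 μQ) :
    NQ σ (fun x => v x + w x) ≤ 2 * NQ σ v + 2 * NQ σ w := by
  have h1 := energy_add_le (k := kerQ σ) hv.1.aemeasurable hw.1.aemeasurable (measurable_kerQ σ)
    (kerQ_nonneg σ)
  have h2 : normL2 (fun x => v x + w x) ^ 2 ≤ 2 * normL2 v ^ 2 + 2 * normL2 w ^ 2 := by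
    have h3 : normL2 (fun x => v x + w x) ≤ normL2 v + normL2 w :=
      eLpNorm_add_le hv.1 hw.1 (by norm_num)
    exact (pow_le_pow_left' h3 2).trans (ennreal_add_sq_le _ _)
  unfold NQ
  simp only [gagliardoSq_eq]
  calc _ ≤ _ := add_le_add h2 h1
    _ = _ := by ring

lemma NQ_neg {σ : ℝ} (v : ℝ × ℝ → ℝ) : NQ σ (fun x => - v x) = NQ σ v := by
  unfold NQ
  rw [gagliardoSq_eq, gagliardoSq_eq, energy_neg]
  congr 2
  exact eLpNorm_neg v 2 μQ

lemma NQ_sub_comm {σ : ℝ} (v w : ℝ × ℝ → ℝ) :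
    NQ σ (fun x => v x - w x) = NQ σ (fun x => w x - v x) := by
  rw [← NQ_neg]
  simp only [neg_sub]

lemma NQ_sub_le {σ : ℝ} {v w : ℝ × ℝ → ℝ} (hv : MemLp v 2 μQ) (hw : MemLp w 2 μQ) :
    NQ σ (fun x => v x - w x) ≤ 2 * NQ σ v + 2 * NQ σ w := by
  rw [← NQ_neg w]
  simpa only [sub_eq_add_neg] using NQ_add_le hv (w := fun x => - w x) hw.neg

/-- Distances in the square are at most 2 and the exponents differ by at most 2, which gives the
factor 2² = 4. -/
lemma gagliardoSq_anti {σ σ' : ℝ} (h : σ' ≤ σ) (h0 : 0 ≤ σ') (h1 : σ ≤ 1) (v : ℝ × ℝ → ℝ) :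
    gagliardoSq σ' v ≤ 4 * gagliardoSq σ v := by
  have hQ : MeasurableSet Q := measurableSet_Ioo.prod measurableSet_Ioo
  unfold gagliardoSq
  rw [← lintegral_const_mul' _ _ (by simp)]
  refine lintegral_mono_ae ?_
  filter_upwards [ae_restrict_mem hQ] with x hx
  rw [← lintegral_const_mul' _ _ (by simp)]
  refine lintegral_mono_ae ?_
  filter_upwards [ae_restrict_mem hQ] with y hy
  have hd : euclDist x y ≤ 2 := by
    have := euclDist_le_of_mem (p := 0) (q := 0) (h := 1) (x := x) (y := y)
      ⟨by simpa using Ioo_subset_Ioc_self hx.1, by simpa using Ioo_subset_Ioc_self hx.2⟩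
      ⟨by simpa using Ioo_subset_Ioc_self hy.1, by simpa using Ioo_subset_Ioc_self hy.2⟩
    linarith
  rcases (euclDist_nonneg x y).eq_or_lt with h3 | h3
  · rw [euclDist_eq_zero h3.symm]; simp
  rw [← ENNReal.ofReal_ofNat 4, ← ENNReal.ofReal_mul (by norm_num)]
  refine ENNReal.ofReal_le_ofReal ?_
  have e : euclDist x y ^ (2 + 2 * σ) =
      euclDist x y ^ (2 + 2 * σ') * euclDist x y ^ (2 * (σ - σ')) := by
    rw [← Real.rpow_add h3]; ring_nf
  have h4 : euclDist x y ^ (2 * (σ - σ')) ≤ 4 := by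
    calc _ ≤ (2 : ℝ) ^ (2 * (σ - σ')) := Real.rpow_le_rpow h3.le hd (by linarith)
      _ ≤ 2 ^ (2 : ℝ) := Real.rpow_le_rpow_of_exponent_le (by norm_num) (by linarith)
      _ = 4 := by norm_num
  have h5 : 0 < euclDist x y ^ (2 + 2 * σ') := Real.rpow_pos_of_pos h3 _
  have h6 : 0 < euclDist x y ^ (2 * (σ - σ')) := Real.rpow_pos_of_pos h3 _
  rw [e, mul_div_assoc', div_le_div_iff₀ h5 (by positivity)]
  have : 0 ≤ |v x - v y| ^ 2 := by positivity
  calc _ = (|v x - v y| ^ 2 * euclDist x y ^ (2 + 2 * σ')) * euclDist x y ^ (2 * (σ - σ')) := by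
        ring
    _ ≤ (|v x - v y| ^ 2 * euclDist x y ^ (2 + 2 * σ')) * 4 := by gcongr
    _ = _ := by ring

lemma NQ_anti {σ σ' : ℝ} (h : σ' ≤ σ) (h0 : 0 ≤ σ') (h1 : σ ≤ 1) (v : ℝ × ℝ → ℝ) :
    NQ σ' v ≤ 4 * NQ σ v := by
  unfold NQ
  rw [mul_add]
  refine add_le_add ?_ (gagliardoSq_anti h h0 h1 v)
  exact le_mul_of_one_le_left zero_le (by norm_num)

/-- The swap of coordinates. -/
def swp : ℝ × ℝ ≃ᵐ ℝ × ℝ := MeasurableEquiv.prodComm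

lemma swp_apply (x : ℝ × ℝ) : swp x = (x.2, x.1) := rfl

lemma measurePreserving_swp : MeasurePreserving swp μQ μQ := by
  rw [μQ_eq_prod]
  exact Measure.measurePreserving_swap

lemma euclDist_swp (x y : ℝ × ℝ) : euclDist (swp x) (swp y) = euclDist x y := by
  simp [euclDist, swp_apply, add_comm]

lemma NQ_comp {κ : ℝ × ℝ ≃ᵐ ℝ × ℝ} (hκ : MeasurePreserving κ μQ μQ)
    (hd : ∀ x y, euclDist (κ x) (κ y) = euclDist x y) {σ : ℝ} {v : ℝ × ℝ → ℝ}
    (hv : AEStronglyMeasurable v μQ) : NQ σ (fun x => v (κ x)) = NQ σ v := by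
  unfold NQ
  rw [gagliardoSq_eq, gagliardoSq_eq, energy_comp hκ (k' := kerQ σ)
    (fun x y => by simp [kerQ, hd])]
  congr 2
  exact eLpNorm_comp_measurePreserving hv hκ

lemma pd_zero_comp_swp {ψ : ℝ × ℝ → ℝ} (hψ : ContDiff ℝ 1 ψ) (x : ℝ × ℝ) :
    pd 0 (fun y => ψ (swp y)) x = pd 1 ψ (swp x) := by
  have h1 := hasDerivAt_slice_snd hψ x.2 x.1
  have hs : ContDiff ℝ 1 (fun y : ℝ × ℝ => ψ (swp y)) := by
    simp only [swp_apply]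
    fun_prop
  exact (hasDerivAt_slice_fst hs x.1 x.2).unique h1

lemma NQ_ne_top_iff {σ : ℝ} {v : ℝ × ℝ → ℝ} (hv : MemLp v 2 μQ) :
    NQ σ v ≠ ⊤ ↔ gagliardoSq σ v ≠ ⊤ := by
  have : normL2 v ^ 2 ≠ ⊤ := ENNReal.pow_ne_top hv.2.ne
  simp [NQ, this]

/-- The norm of `H^σ(Q)`, `0 < σ < 1`, as a real number. -/
noncomputable def nQ (σ : ℝ) (v : ℝ × ℝ → ℝ) : ℝ := √(NQ σ v).toReal

lemma nQ_nonneg (σ : ℝ) (v : ℝ × ℝ → ℝ) : 0 ≤ nQ σ v := Real.sqrt_nonneg _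

lemma sqrt_enS_le_nQ {σ : ℝ} {v : ℝ × ℝ → ℝ} (h : NQ σ v ≠ ⊤) : √(enS σ v 0 0 1) ≤ nQ σ v := by
  refine Real.sqrt_le_sqrt (ENNReal.toReal_mono h ?_)
  rw [← μQ_eq_μS]
  exact le_add_self

lemma integral_sq_le_nQ {σ : ℝ} {v : ℝ × ℝ → ℝ} (hv : MemLp v 2 μQ) (h : NQ σ v ≠ ⊤) :
    ∫ x, v x ^ 2 ∂μQ ≤ nQ σ v ^ 2 := by
  rw [nQ, Real.sq_sqrt ENNReal.toReal_nonneg]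
  have e : ∫ x, v x ^ 2 ∂μQ = (normL2 v ^ 2).toReal := by
    rw [normL2, eLpNorm_two_sq_eq_integral hv,
      ENNReal.toReal_ofReal (integral_nonneg fun _ => sq_nonneg _)]
  rw [e]
  exact ENNReal.toReal_mono h le_self_add

lemma integral_abs_le_nQ {σ : ℝ} {v : ℝ × ℝ → ℝ} (hv : MemLp v 2 μQ) (h : NQ σ v ≠ ⊤) :
    ∫ x, |v x| ∂μQ ≤ nQ σ v := by
  refine le_of_sq_le_sq ?_ (nQ_nonneg _ _)
  refine (integral_abs_sq_le hv).trans ?_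
  simpa using integral_sq_le_nQ hv h

lemma abs_mS_le_nQ {σ : ℝ} {v : ℝ × ℝ → ℝ} (hv : MemLp v 2 μQ) (h : NQ σ v ≠ ⊤) :
    |mS v 0 0 1| ≤ nQ σ v := by
  rw [mS, ← μQ_eq_μS, average_eq_integral]
  exact abs_integral_le_integral_abs.trans (integral_abs_le_nQ hv h)

/-- Splitting off the mean of u, the oscillating part is the limit of the dyadic estimate on the
unit square, and the mean multiplies the integral of ∂₁ψ over that square. -/
lemma exists_pairing_zero_le {s σ : ℝ} (hs0 : 0 < s) (hs1 : s < 1) (hσ : 1 / 2 < σ) (hσ1 : σ < 1)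
    (hsσ : 1 < s + σ) :
    ∃ C : ℝ, 0 < C ∧ ∀ u ψ : ℝ × ℝ → ℝ, MemLp u 2 μQ → NQ s u ≠ ⊤ → ContDiff ℝ 1 ψ →
      NQ σ ψ ≠ ⊤ → |∫ x, u x * pd 0 ψ x ∂μQ| ≤ C * nQ s u * nQ σ ψ := by
  obtain ⟨K', hK', hflux⟩ := exists_abs_integral_pd_zero_le hσ hσ1
  set r : ℝ := (1 / 2) ^ (s + σ - 1) with hr
  have hr0 : 0 < r := by positivity
  have hr1 : r < 1 := Real.rpow_lt_one (by norm_num) (by norm_num) (by linarith)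
  have hr2 : 0 < 1 - r := by linarith
  -- The fixed point of K ↦ r K + 32 K'; it is finite because s + σ > 1 makes r < 1.
  set K := 32 * K' / (1 - r) with hK
  have hK0 : 0 < K := by positivity
  refine ⟨K + K', by positivity, ?_⟩
  intro u ψ hu hNu hψ hNψ
  obtain ⟨L, hL0, -, hL⟩ := exists_lipschitz_Qc hψ
  have hEu : energy (kerQ s) (μS 0 0 1) u ≠ ⊤ := by
    rw [← μQ_eq_μS]; exact (NQ_ne_top_iff hu).1 hNu
  have hEψ : energy (kerQ σ) (μS 0 0 1) ψ ≠ ⊤ := by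
    rw [← μQ_eq_μS]; exact (NQ_ne_top_iff (memLp_of_continuous hψ.continuous)).1 hNψ
  have hui : Integrable u μQ := hu.integrable (by norm_num)
  have key := fun n => pairing_approx (K := K) (K' := K') hs0 hs1.le hK'.le
    (by rw [← hr, hK]; field_simp; ring_nf; rfl) hK0.le (by linarith) hψ (hflux ψ hψ) hL0
    (fun x hx => (abs_pd_le ψ 0 x).trans (hL x hx)) u n 0 0 1 one_pos le_rfl (by norm_num) le_rfl
    (by norm_num) hEψ hEu (by rwa [← μQ_eq_μS])
  have key2 : |∫ x, (u x - mS u 0 0 1) * pd 0 ψ x ∂μQ| ≤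
      K * (√(enS s u 0 0 1) * √(enS σ ψ 0 0 1)) := by
    rw [μQ_eq_μS]
    refine ge_of_tendsto' (x := atTop) ?_ key
    have h1 : Tendsto (fun n : ℕ => (((1 : ℝ) / 2) ^ s) ^ n) atTop (𝓝 0) :=
      tendsto_pow_atTop_nhds_zero_of_lt_one (by positivity)
        (Real.rpow_lt_one (by norm_num) (by norm_num) hs0)
    simpa using (((h1.const_mul (4 * L)).mul_const ((1 : ℝ) ^ (1 + s))).mul_const
      √(enS s u 0 0 1)).const_add (K * 1 ^ (s + σ - 1) * (√(enS s u 0 0 1) * √(enS σ ψ 0 0 1)))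
  have hf := hflux ψ hψ 0 0 1 one_pos le_rfl (by norm_num) le_rfl (by norm_num) hEψ
  rw [← μQ_eq_μS, Real.one_rpow, mul_one] at hf
  have hpd : Integrable (pd 0 ψ) μQ := by
    rw [μQ_eq_μS]; exact integrable_μS (continuous_pd hψ 0) 0 0 1
  have hmul : Integrable (fun x => (u x - mS u 0 0 1) * pd 0 ψ x) μQ := by
    refine (hui.sub (integrable_const _)).mul_bdd (c := L) (continuous_pd hψ 0).aestronglyMeasurable ?_
    rw [μQ_eq_μS]
    filter_upwards [ae_restrict_mem (measurableSet_Sq 0 0 1)] with x hx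
    exact (abs_pd_le ψ 0 x).trans (hL x (Sq_subset_Qc le_rfl (by norm_num) le_rfl (by norm_num) hx))
  have e : ∫ x, u x * pd 0 ψ x ∂μQ =
      ∫ x, (u x - mS u 0 0 1) * pd 0 ψ x ∂μQ + mS u 0 0 1 * ∫ x, pd 0 ψ x ∂μQ := by
    rw [← integral_const_mul, ← integral_add hmul (hpd.const_mul _)]
    congr 1 with x
    ring
  rw [e]
  refine (abs_add_le _ _).trans ?_
  rw [abs_mul]
  have a1 := sqrt_enS_le_nQ hNu
  have a2 := sqrt_enS_le_nQ hNψ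
  have a3 := abs_mS_le_nQ hu hNu
  have a4 := nQ_nonneg s u
  have a5 := nQ_nonneg σ ψ
  calc _ ≤ K * (nQ s u * nQ σ ψ) + nQ s u * (K' * nQ σ ψ) := by
        gcongr
        · exact key2.trans (by gcongr)
        · exact hf.trans (by gcongr)
    _ = _ := by ring

lemma nQ_comp_swp {σ : ℝ} {v : ℝ × ℝ → ℝ} (hv : AEStronglyMeasurable v μQ) :
    nQ σ (fun x => v (swp x)) = nQ σ v := by
  rw [nQ, nQ, NQ_comp measurePreserving_swp euclDist_swp hv]

/-- The pairing of `H^s(Q)` with derivatives of functions in `H^σ(Q)`, `s + σ > 1`. -/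
lemma exists_pairing_le {s σ : ℝ} (hs0 : 0 < s) (hs1 : s < 1) (hσ : 1 / 2 < σ) (hσ1 : σ < 1)
    (hsσ : 1 < s + σ) :
    ∃ C : ℝ, 0 < C ∧ ∀ u ψ : ℝ × ℝ → ℝ, MemLp u 2 μQ → NQ s u ≠ ⊤ → ContDiff ℝ 1 ψ →
      NQ σ ψ ≠ ⊤ → ∀ i, |∫ x, u x * pd i ψ x ∂μQ| ≤ C * nQ s u * nQ σ ψ := by
  obtain ⟨C, hC0, hC⟩ := exists_pairing_zero_le hs0 hs1 hσ hσ1 hsσ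
  refine ⟨C, hC0, fun u ψ hu hNu hψ hNψ i => ?_⟩
  have hψm : AEStronglyMeasurable ψ μQ := hψ.continuous.aestronglyMeasurable
  fin_cases i
  · exact hC u ψ hu hNu hψ hNψ
  · have hψ' : ContDiff ℝ 1 (fun x => ψ (swp x)) := by
      simp only [swp_apply]
      fun_prop
    have h := hC (fun x => u (swp x)) (fun x => ψ (swp x))
      (hu.comp_measurePreserving measurePreserving_swp)
      (by rwa [NQ_comp measurePreserving_swp euclDist_swp hu.1]) hψ'
      (by rwa [NQ_comp measurePreserving_swp euclDist_swp hψm])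
    rw [nQ_comp_swp hu.1, nQ_comp_swp hψm] at h
    simp only [pd_zero_comp_swp hψ] at h
    rwa [measurePreserving_swp.integral_comp swp.measurableEmbedding
      (fun x => u x * pd 1 ψ x)] at h

/-- The trace inequality controls the deviation from the mean, and the mean itself is bounded by the
L² norm. -/
lemma exists_trace_vertical_le {σ : ℝ} (hσ : 1 / 2 < σ) (hσ1 : σ < 1) :
    ∃ C : ℝ, 0 < C ∧ ∀ ψ : ℝ × ℝ → ℝ, ContDiff ℝ 1 ψ → NQ σ ψ ≠ ⊤ → ∀ c ∈ Icc (0 : ℝ) 1,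
      ∫ t, ψ (c, t) ^ 2 ∂μI ≤ C * nQ σ ψ ^ 2 := by
  obtain ⟨K, hK0, hK⟩ := exists_trace_sq_le hσ hσ1
  refine ⟨2 * K + 2, by positivity, fun ψ hψ hN c hc => ?_⟩
  have hψc := hψ.continuous
  have hu := memLp_of_continuous hψc
  have hE : energy (kerQ σ) (μS 0 0 1) ψ ≠ ⊤ := by
    rw [← μQ_eq_μS]; exact (NQ_ne_top_iff hu).1 hN
  have h := hK ψ hψ 0 0 1 c one_pos le_rfl (by norm_num) le_rfl (by norm_num) (by simpa using hc) hE
  simp only [zero_add, Real.one_rpow, mul_one] at h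
  rw [μI, restrict_Ioo_eq_restrict_Ioc]
  calc ∫ t in Ioc 0 1, ψ (c, t) ^ 2
      ≤ ∫ t in Ioc (0 : ℝ) 1, (2 * (ψ (c, t) - mS ψ 0 0 1) ^ 2 + 2 * (mS ψ 0 0 1) ^ 2) := by
        refine setIntegral_mono_on (Continuous.integrableOn_Ioc (by fun_prop))
          (Continuous.integrableOn_Ioc (by fun_prop)) measurableSet_Ioc fun t _ => ?_
        nlinarith [sq_nonneg (ψ (c, t) - 2 * mS ψ 0 0 1)]
    _ = 2 * (∫ t in Ioc (0 : ℝ) 1, (ψ (c, t) - mS ψ 0 0 1) ^ 2) + 2 * (mS ψ 0 0 1) ^ 2 := by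
        rw [integral_add (Continuous.integrableOn_Ioc (by fun_prop))
          (Continuous.integrableOn_Ioc (by fun_prop)), integral_const_mul]
        simp
    _ ≤ 2 * (K * nQ σ ψ ^ 2) + 2 * nQ σ ψ ^ 2 := by
        have h1 := sqrt_enS_le_nQ hN
        have h2 := pow_le_pow_left₀ (Real.sqrt_nonneg _) h1 2
        rw [Real.sq_sqrt (enS_nonneg _ _ _ _ _)] at h2
        have h3 := pow_le_pow_left₀ (abs_nonneg _) (abs_mS_le_nQ hu hN) 2
        rw [sq_abs] at h3
        gcongr
        exact h.trans (by gcongr)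
    _ = _ := by ring

lemma continuous_edgePt (e : Fin 4) : Continuous (edgePt e) := by
  fin_cases e
  · exact continuous_id.prodMk continuous_const
  · exact continuous_const.prodMk continuous_id
  · exact continuous_id.prodMk continuous_const
  · exact continuous_const.prodMk continuous_id

lemma memLp_comp_edgePt {ψ : ℝ × ℝ → ℝ} (hψ : Continuous ψ) (e : Fin 4) :
    MemLp (fun t => ψ (edgePt e t)) 2 μI := by
  have hc : Continuous (fun t => ψ (edgePt e t)) := hψ.comp (continuous_edgePt e)
  rw [μI, restrict_Ioo_eq_restrict_Ioc]
  exact (memLp_two_iff_integrable_sq hc.aestronglyMeasurable).2 (hc.pow 2).integrableOn_Ioc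

lemma exists_trace_sq_integral_le {σ : ℝ} (hσ : 1 / 2 < σ) (hσ1 : σ < 1) :
    ∃ C : ℝ, 0 < C ∧ ∀ ψ : ℝ × ℝ → ℝ, ContDiff ℝ 1 ψ → NQ σ ψ ≠ ⊤ → ∀ e,
      ∫ t, ψ (edgePt e t) ^ 2 ∂μI ≤ C * nQ σ ψ ^ 2 := by
  obtain ⟨C, hC0, hC⟩ := exists_trace_vertical_le hσ hσ1
  refine ⟨C, hC0, fun ψ hψ hN e => ?_⟩
  have hψm : AEStronglyMeasurable ψ μQ := hψ.continuous.aestronglyMeasurable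
  have hψ' : ContDiff ℝ 1 (fun x => ψ (swp x)) := by
    simp only [swp_apply]
    fun_prop
  have h2 := hC (fun x => ψ (swp x)) hψ' (by rwa [NQ_comp measurePreserving_swp euclDist_swp hψm])
  rw [nQ_comp_swp hψm] at h2
  fin_cases e
  · exact h2 0 (by simp)
  · exact hC ψ hψ hN 1 (by simp)
  · exact h2 1 (by simp)
  · exact hC ψ hψ hN 0 (by simp)

/-- The trace inequality on `Q`. -/
lemma exists_trace_le {σ : ℝ} (hσ : 1 / 2 < σ) (hσ1 : σ < 1) :
    ∃ C : ℝ≥0, 0 < C ∧ ∀ ψ : ℝ × ℝ → ℝ, ContDiff ℝ 1 ψ → ∀ e,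
      eLpNorm (fun t => ψ (edgePt e t)) 2 μI ≤ C * normH σ ψ := by
  obtain ⟨C, hC0, hC⟩ := exists_trace_sq_integral_le hσ hσ1
  refine ⟨Real.toNNReal √C, by simpa using hC0, fun ψ hψ e => ?_⟩
  have hu := memLp_of_continuous hψ.continuous
  have h0 : 0 < σ := by linarith
  change _ ≤ ENNReal.ofReal √C * _
  have hpos : ENNReal.ofReal √C ≠ 0 := by simpa using hC0
  by_cases hN : NQ σ ψ = ⊤
  · rw [normH_eq h0 hσ1 hu, hN, ENNReal.top_rpow_of_pos (by norm_num), ENNReal.mul_top hpos]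
    exact le_top
  · refine ennreal_le_of_sq_le ?_
    rw [mul_pow, normH_sq h0 hσ1 hu,
      eLpNorm_two_sq_eq_integral (memLp_comp_edgePt hψ.continuous e),
      ← ENNReal.ofReal_pow (Real.sqrt_nonneg _), Real.sq_sqrt hC0.le]
    refine (ENNReal.ofReal_le_ofReal (hC ψ hψ hN e)).trans ?_
    rw [ENNReal.ofReal_mul hC0.le, nQ, Real.sq_sqrt ENNReal.toReal_nonneg, ENNReal.ofReal_toReal hN]

end

/-! ### Continuity of dilations in L². -/

section

section Dilation

variable {E : Type*} [NormedAddCommGroup E] [NormedSpace ℝ E] [FiniteDimensional ℝ E]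
  [MeasurableSpace E] [BorelSpace E] (μ : Measure E) [μ.IsAddHaarMeasure]

lemma map_dilation (w : E) {r : ℝ} (hr : 0 < r) :
    μ.map (fun x => r • x + w) = ENNReal.ofReal ((r ^ Module.finrank ℝ E)⁻¹) • μ := by
  have h := Measure.map_addHaar_smul μ hr.ne'
  rw [abs_of_pos (by positivity)] at h
  have : (fun x : E => r • x + w) = (fun x => x + w) ∘ (fun x => r • x) := rfl
  rw [this, ← Measure.map_map (measurable_add_const w) (measurable_const_smul r), h,
    Measure.map_smul, map_add_right_eq_self]

/-- For r ≥ 1/2 the Jacobian factor r^(-dim) is at most 2^dim, uniformly as r tends to 1. -/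
lemma eLpNorm_comp_dilation_le {G : E → ℝ} (hG : AEStronglyMeasurable G μ) (w : E) {r : ℝ}
    (hr : 1 / 2 ≤ r) : eLpNorm (fun x => G (r • x + w)) 2 μ ≤
      ENNReal.ofReal (2 ^ Module.finrank ℝ E) ^ (1 / 2 : ℝ) * eLpNorm G 2 μ := by
  have hr0 : 0 < r := by linarith
  have hm : Measurable (fun x : E => r • x + w) := by fun_prop
  have hG' : AEStronglyMeasurable G (μ.map (fun x => r • x + w)) := by
    rw [map_dilation μ w hr0]
    exact hG.smul_measure _
  have h := eLpNorm_map_measure (p := 2) hG' hm.aemeasurable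
  have e : eLpNorm (fun x => G (r • x + w)) 2 μ = eLpNorm G 2 (μ.map (fun x => r • x + w)) := h.symm
  rw [e, map_dilation μ w hr0, eLpNorm_smul_measure_of_ne_top (by simp)]
  have e2 : (1 / (2 : ℝ≥0∞)).toReal = 1 / 2 := by simp
  rw [smul_eq_mul, e2]
  refine mul_le_mul' (ENNReal.rpow_le_rpow (ENNReal.ofReal_le_ofReal ?_) (by norm_num)) le_rfl
  rw [← inv_pow]
  gcongr
  rw [inv_le_comm₀ hr0 (by norm_num)]
  linarith

/-- Functions in `L²` depend continuously on dilations. -/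
lemma exists_dilation_close {G : E → ℝ} (hG : MemLp G 2 μ) (R : ℝ) {δ : ℝ≥0∞} (hδ : δ ≠ 0) :
    ∃ r₀ : ℝ, r₀ < 1 ∧ ∀ r, r₀ < r → r < 1 → ∀ w : E, ‖w‖ ≤ R →
      eLpNorm (fun x => G (r • x + (1 - r) • w) - G x) 2 (μ.restrict (Metric.closedBall 0 R)) ≤
        δ := by
  set M : ℝ≥0∞ := ENNReal.ofReal (2 ^ Module.finrank ℝ E) ^ (1 / 2 : ℝ) with hM
  have hMt : M ≠ ⊤ := by finiteness
  -- The approximation error appears twice: once dilated, with factor M, and once as it stands.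
  -- Together they may use half of the budget.
  obtain ⟨δ', hδ', hsum⟩ : ∃ δ' : ℝ≥0∞, δ' ≠ 0 ∧ M * δ' + δ' ≤ δ / 2 := by
    refine ⟨δ / 2 / (M + 1), ?_, ?_⟩
    · refine (ENNReal.div_pos ?_ (by finiteness)).ne'
      exact (ENNReal.div_pos hδ (by finiteness)).ne'
    · have : M * (δ / 2 / (M + 1)) + δ / 2 / (M + 1) = (M + 1) * (δ / 2 / (M + 1)) := by ring
      rw [this]
      exact ENNReal.mul_div_le
  obtain ⟨g, hgc, hgG, hgcont, hgm⟩ := hG.exists_hasCompactSupport_eLpNorm_sub_le (by simp) hδ'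
  set B := Metric.closedBall (0 : E) R with hB
  have hBfin : μ B ≠ ⊤ := (isCompact_closedBall (0 : E) R).measure_lt_top.ne
  obtain ⟨κ, hκ0, hκ⟩ : ∃ κ : ℝ, 0 < κ ∧
      (μ.restrict B) univ ^ (2 : ℝ≥0∞).toReal⁻¹ * ENNReal.ofReal κ ≤ δ / 2 := by
    set b := (μ.restrict B) univ ^ (2 : ℝ≥0∞).toReal⁻¹ with hb
    have hbt : b ≠ ⊤ := by
      rw [hb, Measure.restrict_apply_univ]
      exact ENNReal.rpow_ne_top_of_nonneg (by simp) hBfin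
    have hpos : 0 < min 1 (δ / 2 / (b + 1)) := by
      refine lt_min one_pos (ENNReal.div_pos ?_ (by finiteness))
      exact (ENNReal.div_pos hδ (by finiteness)).ne'
    have hlt : min 1 (δ / 2 / (b + 1)) ≠ ⊤ := ((min_le_left _ _).trans_lt ENNReal.one_lt_top).ne
    refine ⟨(min 1 (δ / 2 / (b + 1))).toReal, ENNReal.toReal_pos hpos.ne' hlt, ?_⟩
    rw [ENNReal.ofReal_toReal hlt]
    calc _ ≤ (b + 1) * (δ / 2 / (b + 1)) := by
          gcongr
          · exact le_self_add
          · exact min_le_right _ _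
      _ ≤ _ := ENNReal.mul_div_le
  have huc : UniformContinuous g := hgc.uniformContinuous_of_continuous hgcont
  obtain ⟨ρ, hρ0, hρ⟩ := Metric.uniformContinuous_iff.1 huc κ hκ0
  -- The dilation moves x by (1 - r)(w - x), of norm at most 2R(1 - r), which this threshold puts
  -- below the modulus of continuity ρ of g.
  refine ⟨max (1 / 2) (1 - ρ / (2 * |R| + 1)), max_lt (by norm_num) ?_, ?_⟩
  · have : 0 < ρ / (2 * |R| + 1) := by positivity
    linarith
  intro r hr hr1 w hw
  have hr2 : 1 / 2 ≤ r := (le_max_left _ _).trans hr.le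
  have hr3 : (1 - r) * (2 * |R| + 1) < ρ := by
    have := (le_max_right _ _).trans_lt hr
    rw [← lt_div_iff₀ (by positivity)]
    linarith
  have hm : Measurable (fun x : E => r • x + (1 - r) • w) := by fun_prop
  have hac : AEStronglyMeasurable (fun x => (G - g) (r • x + (1 - r) • w)) μ := by
    refine (hG.1.sub hgm.1).comp_quasiMeasurePreserving (f := fun x => r • x + (1 - r) • w) ⟨hm, ?_⟩
    rw [map_dilation μ _ (by linarith)]
    exact Measure.smul_absolutelyContinuous
  have e : (fun x => G (r • x + (1 - r) • w) - G x) =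
      (fun x => (G - g) (r • x + (1 - r) • w)) +
        ((fun x => g (r • x + (1 - r) • w) - g x) + (g - G)) := by
    ext x; simp
  have hgd : Continuous (fun x : E => g (r • x + (1 - r) • w) - g x) := by fun_prop
  rw [e]
  refine (eLpNorm_add_le hac.restrict (hgd.aestronglyMeasurable.add (hgm.1.sub hG.1)).restrict
    (by norm_num)).trans ?_
  have h3 := eLpNorm_add_le (μ := μ.restrict B) (p := 2)
    (f := fun x : E => g (r • x + (1 - r) • w) - g x) (g := g - G)
    hgd.aestronglyMeasurable (hgm.1.sub hG.1).restrict (by norm_num)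
  have k1 : eLpNorm (fun x => (G - g) (r • x + (1 - r) • w)) 2 (μ.restrict B) ≤ M * δ' :=
    (eLpNorm_mono_measure _ Measure.restrict_le_self).trans
      ((eLpNorm_comp_dilation_le μ (hG.1.sub hgm.1) _ hr2).trans (by gcongr))
  have k2 : eLpNorm (g - G) 2 (μ.restrict B) ≤ δ' := by
    rw [← eLpNorm_neg, neg_sub]
    exact (eLpNorm_mono_measure _ Measure.restrict_le_self).trans hgG
  have k3 : eLpNorm (fun x => g (r • x + (1 - r) • w) - g x) 2 (μ.restrict B) ≤ δ / 2 := by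
    refine (eLpNorm_le_of_ae_bound (C := κ) ?_).trans hκ
    filter_upwards [ae_restrict_mem Metric.isClosed_closedBall.measurableSet] with x hx
    refine (hρ ?_).le
    rw [dist_eq_norm]
    have e2 : r • x + (1 - r) • w - x = (1 - r) • (w - x) := by module
    rw [e2, norm_smul, Real.norm_eq_abs, abs_of_pos (by linarith)]
    refine lt_of_le_of_lt ?_ hr3
    have hx' : ‖x‖ ≤ R := mem_closedBall_zero_iff.1 hx
    have := norm_sub_le w x
    have := le_abs_self R
    have h1r : 0 ≤ 1 - r := by linarith
    gcongr
    linarith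
  calc _ ≤ M * δ' + (δ / 2 + δ') := add_le_add k1 (h3.trans (add_le_add k3 k2))
    _ = (M * δ' + δ') + δ / 2 := by ring
    _ ≤ δ / 2 + δ / 2 := by gcongr
    _ = δ := ENNReal.add_halves δ

/-- Averaged dilations converge in `L²`. -/
lemma exists_averaged_dilation_close {W : Type*} [MeasurableSpace W] (θ : Measure W)
    [IsProbabilityMeasure θ] {ι : W → E} (hι : Measurable ι) {R : ℝ} (hR : ∀ᵐ w ∂θ, ‖ι w‖ ≤ R)
    {G : E → ℝ} (hGm : Measurable G) (hG : MemLp G 2 μ) {δ : ℝ≥0∞} (hδ : δ ≠ 0) :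
    ∃ r₀ : ℝ, r₀ < 1 ∧ ∀ r, r₀ < r → r < 1 →
      ∫⁻ x in Metric.closedBall 0 R, ‖(∫ w, G (r • x + (1 - r) • ι w) ∂θ) - G x‖ₑ ^ 2 ∂μ ≤ δ := by
  wlog hδt : δ ≠ ⊤
  · obtain ⟨r₀, h1, h2⟩ := this μ θ hι hR hGm hG (δ := 1) one_ne_zero ENNReal.one_ne_top
    push Not at hδt
    exact ⟨r₀, h1, fun r h3 h4 => by rw [hδt]; exact le_top⟩
  obtain ⟨r₀, h1, h2⟩ := exists_dilation_close μ hG R (δ := δ ^ (1 / 2 : ℝ))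
    (by simp [hδ])
  refine ⟨r₀, h1, fun r hr hr1 => ?_⟩
  set B := Metric.closedBall (0 : E) R
  have hmeas : Measurable (fun z : E × W => ‖G (r • z.1 + (1 - r) • ι z.2) - G z.1‖ₑ ^ 2) := by
    fun_prop
  have hbd : ∫⁻ x in B, ∫⁻ w, ‖G (r • x + (1 - r) • ι w) - G x‖ₑ ^ 2 ∂θ ∂μ ≤ δ := by
    rw [lintegral_lintegral_swap hmeas.aemeasurable]
    calc _ ≤ ∫⁻ w, δ ∂θ := by
          refine lintegral_mono_ae ?_
          filter_upwards [hR] with w hw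
          rw [← eLpNorm_two_sq]
          refine (pow_le_pow_left' (h2 r hr hr1 (ι w) hw) 2).trans (le_of_eq ?_)
          rw [← ENNReal.rpow_natCast, ← ENNReal.rpow_mul]
          norm_num
      _ = δ := by simp
  refine le_trans (lintegral_mono_ae ?_) hbd
  -- Finiteness of the double integral makes the dilated function of w integrable for almost every
  -- x, so that the constant G x may be moved under the averaging integral.
  have hfin := ae_lt_top (hmeas.lintegral_prod_right') (lt_of_le_of_lt hbd hδt.lt_top).ne
  filter_upwards [hfin] with x hx
  have hmx : Measurable (fun w => G (r • x + (1 - r) • ι w) - G x) := by fun_prop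
  have hL2 : MemLp (fun w => G (r • x + (1 - r) • ι w) - G x) 2 θ := by
    refine ⟨hmx.aestronglyMeasurable, ?_⟩
    rw [← eLpNorm_two_sq] at hx
    by_contra hcon
    rw [not_lt, top_le_iff] at hcon
    rw [hcon] at hx
    simp at hx
  have hint : Integrable (fun w => G (r • x + (1 - r) • ι w) - G x) θ :=
    hL2.integrable (by norm_num)
  have hint2 : Integrable (fun w => G (r • x + (1 - r) • ι w)) θ :=
    (hint.add (integrable_const (G x))).congr (ae_of_all _ fun w => by simp)
  have e : (∫ w, G (r • x + (1 - r) • ι w) ∂θ) - G x =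
      ∫ w, (G (r • x + (1 - r) • ι w) - G x) ∂θ := by
    rw [integral_sub hint2 (integrable_const _)]; simp
  rw [e]
  calc _ ≤ (∫⁻ w, ‖G (r • x + (1 - r) • ι w) - G x‖ₑ ∂θ) ^ 2 := by
        gcongr
        exact enorm_integral_le_lintegral_enorm _
    _ ≤ _ := by
        refine (lintegral_sq_le _ hmx.enorm.aemeasurable).trans ?_
        simp

end Dilation

end

/-! ### The smoothing operator: regularity and commutation with derivatives. -/

section

/-- A bump function in the middle of `Q`. -/
noncomputable def bmp : ContDiffBump ((1 / 2, 1 / 2) : ℝ × ℝ) := ⟨1 / 8, 1 / 4, by norm_num, by norm_num⟩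

/-- The normalized bump function. -/
noncomputable def bmpN : ℝ × ℝ → ℝ := bmp.normed volume

lemma contDiff_bmpN : ContDiff ℝ ∞ bmpN := bmp.contDiff_normed

lemma bmpN_nonneg (x : ℝ × ℝ) : 0 ≤ bmpN x := bmp.nonneg_normed x

lemma integral_bmpN : ∫ x, bmpN x = 1 := bmp.integral_normed

lemma tsupport_bmpN : tsupport bmpN ⊆ Q := by
  rw [bmpN, bmp.tsupport_normed_eq]
  intro x hx
  rw [Metric.mem_closedBall, Prod.dist_eq, max_le_iff, Real.dist_eq, Real.dist_eq, abs_le,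
    abs_le] at hx
  simp only [bmp] at hx
  exact ⟨⟨by linarith, by linarith⟩, ⟨by linarith, by linarith⟩⟩

lemma hasCompactSupport_bmpN : HasCompactSupport bmpN := bmp.hasCompactSupport_normed

/-- The probability measure with density `bmpN`. -/
noncomputable def θ : Measure (ℝ × ℝ) := volume.withDensity fun x => ENNReal.ofReal (bmpN x)

lemma measurable_ofReal_bmpN : Measurable fun x => ENNReal.ofReal (bmpN x) :=
  contDiff_bmpN.continuous.measurable.ennreal_ofReal

instance : IsProbabilityMeasure θ := by
  constructor
  rw [θ, withDensity_apply _ MeasurableSet.univ, Measure.restrict_univ,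
    ← ofReal_integral_eq_lintegral_ofReal (f := bmpN) bmp.integrable_normed (ae_of_all _ bmpN_nonneg)]
  rw [integral_bmpN, ENNReal.ofReal_one]

lemma measurableSet_Q : MeasurableSet Q := measurableSet_Ioo.prod measurableSet_Ioo

lemma ae_θ_mem : ∀ᵐ w ∂θ, w ∈ Q := by
  rw [θ, ae_withDensity_iff measurable_ofReal_bmpN]
  refine ae_of_all _ fun w hw => tsupport_bmpN (subset_tsupport _ ?_)
  rw [Function.mem_support]
  intro h
  simp [h] at hw

lemma integral_θ (f : ℝ × ℝ → ℝ) : ∫ w, f w ∂θ = ∫ w, bmpN w * f w := by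
  rw [θ, integral_withDensity_eq_integral_toReal_smul measurable_ofReal_bmpN
    (ae_of_all _ fun _ => ENNReal.ofReal_lt_top)]
  simp only [ENNReal.toReal_ofReal (bmpN_nonneg _), smul_eq_mul]

lemma integrable_θ {f : ℝ × ℝ → ℝ} (hf : Integrable f) : Integrable f θ := by
  rw [θ, integrable_withDensity_iff_integrable_smul' measurable_ofReal_bmpN
    (ae_of_all _ fun _ => ENNReal.ofReal_lt_top)]
  simp only [ENNReal.toReal_ofReal (bmpN_nonneg _), smul_eq_mul]
  obtain ⟨C, hC⟩ := hasCompactSupport_bmpN.exists_bound_of_continuous contDiff_bmpN.continuous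
  exact hf.bdd_mul contDiff_bmpN.continuous.aestronglyMeasurable (ae_of_all _ hC)

/-- The mollifier at scale `1 - r`. -/
noncomputable def moll (r : ℝ) (z : ℝ × ℝ) : ℝ := ((1 - r) ^ 2)⁻¹ * bmpN (-(1 - r)⁻¹ • z)

/-- Smoothing of `v` on `Q`: the average of `v (r • x + (1 - r) • w)` over `w ∈ Q`. -/
noncomputable def Sm (r : ℝ) (v : ℝ × ℝ → ℝ) (x : ℝ × ℝ) : ℝ :=
  convolution (Q.indicator v) (moll r) (ContinuousLinearMap.mul ℝ ℝ) volume (r • x)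

variable {r : ℝ} {v : ℝ × ℝ → ℝ}

lemma contDiff_moll (r : ℝ) : ContDiff ℝ ∞ (moll r) := by
  unfold moll
  have := contDiff_bmpN
  fun_prop

lemma hasCompactSupport_moll (hr1 : r < 1) : HasCompactSupport (moll r) := by
  have h : HasCompactSupport (fun z : ℝ × ℝ => bmpN (-(1 - r)⁻¹ • z)) :=
    hasCompactSupport_bmpN.comp_smul (by
      have : 0 < (1 - r)⁻¹ := inv_pos.2 (by linarith)
      linarith)
  exact h.mul_left

lemma integrable_indicator_Q (hv : MemLp v 2 μQ) : Integrable (Q.indicator v) :=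
  (integrable_indicator_iff measurableSet_Q).2 (hv.integrable (by norm_num))

lemma contDiff_Sm (hr1 : r < 1) (hv : MemLp v 2 μQ) : ContDiff ℝ ∞ (Sm r v) := by
  have h := (hasCompactSupport_moll hr1).contDiff_convolution_right (n := ⊤)
    (ContinuousLinearMap.mul ℝ ℝ)
    (integrable_indicator_Q hv).locallyIntegrable (contDiff_moll r)
  exact h.comp (contDiff_const_smul r)

/-- The derivative falls on the mollifier, and the chain rule for x ↦ r x contributes the factor r.
-/
lemma pd_Sm (hr1 : r < 1) (hv : MemLp v 2 μQ) (i : Fin 2) (x : ℝ × ℝ) :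
    pd i (Sm r v) x = r * ∫ y, v y * pd i (moll r) (r • x - y) ∂μQ := by
  have hm := contDiff_moll r
  have hm1 : ContDiff ℝ 1 (moll r) := hm.of_le (by norm_cast)
  have hl := (integrable_indicator_Q hv).locallyIntegrable
  have h := (hasCompactSupport_moll hr1).hasFDerivAt_convolution_right (μ := volume)
    (ContinuousLinearMap.mul ℝ ℝ) hl hm1 (r • x)
  have h2 : HasFDerivAt (fun x : ℝ × ℝ => r • x) (r • ContinuousLinearMap.id ℝ (ℝ × ℝ)) x :=
    (hasFDerivAt_id x).const_smul r
  have h3 := (h.comp x h2).fderiv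
  unfold pd
  change fderiv ℝ (Sm r v) x _ = _
  have e : Sm r v = convolution (Q.indicator v) (moll r) (ContinuousLinearMap.mul ℝ ℝ) volume ∘
    fun x : ℝ × ℝ => r • x := rfl
  rw [e, h3]
  simp only [ContinuousLinearMap.comp_smul, ContinuousLinearMap.comp_id,
    _root_.smul_apply, smul_eq_mul]
  rw [convolution_precompR_apply _ hl ((hasCompactSupport_moll hr1).fderiv ℝ)
    (hm1.continuous_fderiv one_ne_zero)]
  congr 1
  rw [convolution, μQ, ← integral_indicator measurableSet_Q]
  congr 1 with y
  by_cases hy : y ∈ Q <;> simp [hy]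

/-- The kernel only charges points r x + (1 - r) w with w in the support of the bump, and these lie
in Q by convexity. It is thus admissible in the definition of weak derivatives for every x in Q,
with no boundary layer left out. -/
lemma isTest_moll (hr0 : 0 < r) (hr1 : r < 1) {x : ℝ × ℝ} (hx : x ∈ Q) :
    IsTest (fun y => moll r (r • x - y)) := by
  have hc : Continuous fun y : ℝ × ℝ => r • x - y := by fun_prop
  have hcs : HasCompactSupport (fun y => moll r (r • x - y)) :=
    (hasCompactSupport_moll hr1).comp_homeomorph (Homeomorph.subLeft (r • x))
  refine ⟨(contDiff_moll r).comp (by fun_prop), hcs, ?_⟩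
  have h1 : 0 < 1 - r := by linarith
  have hsub : tsupport (fun y => moll r (r • x - y)) ⊆
      (fun y => -(1 - r)⁻¹ • (r • x - y)) ⁻¹' tsupport bmpN := by
    refine closure_minimal ?_ ((isClosed_tsupport _).preimage (by fun_prop))
    intro y hy
    refine subset_tsupport _ ?_
    rw [Function.mem_support] at hy ⊢
    intro h0
    have h0' : bmpN (-(1 - r)⁻¹ • (r • x - y)) = 0 := h0
    exact hy (by rw [moll, h0', mul_zero])
  intro y hy
  have hw := tsupport_bmpN (hsub hy)
  set w := -(1 - r)⁻¹ • (r • x - y) with hw'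
  have e : y = r • x + (1 - r) • w := by
    rw [hw', smul_smul]
    have : (1 - r) * -(1 - r)⁻¹ = -1 := by field_simp
    rw [this]; module
  have hconv : Convex ℝ Q := (convex_Ioo 0 1).prod (convex_Ioo 0 1)
  rw [e]
  exact hconv hx hw hr0.le h1.le (by ring)

lemma pd_moll_comp (i : Fin 2) (x y : ℝ × ℝ) :
    pd i (fun y => moll r (x - y)) y = - pd i (moll r) (x - y) := by
  have hm := ((contDiff_moll r).differentiable (by simp)) (x - y)
  have h2 : HasFDerivAt (fun y : ℝ × ℝ => x - y) (-ContinuousLinearMap.id ℝ (ℝ × ℝ)) y :=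
    (hasFDerivAt_id y).const_sub x
  have h3 := (hm.hasFDerivAt.comp y h2).fderiv
  unfold pd
  have e : (fun y => moll r (x - y)) = moll r ∘ fun y => x - y := rfl
  rw [e, h3]
  simp

lemma Sm_eq_integral_moll (x : ℝ × ℝ) : Sm r v x = ∫ y, v y * moll r (r • x - y) ∂μQ := by
  rw [Sm, convolution, μQ, ← integral_indicator measurableSet_Q]
  congr 1 with y
  by_cases hy : y ∈ Q <;> simp [hy]

/-- Smoothing commutes with the divergence, up to the factor `r`. -/
lemma sum_pd_Sm (hr0 : 0 < r) (hr1 : r < 1) {u : Fin 2 → ℝ × ℝ → ℝ} {d : ℝ × ℝ → ℝ}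
    (hu : ∀ i, MemLp (u i) 2 μQ) (hd : HasWeakDiv u d) {x : ℝ × ℝ} (hx : x ∈ Q) :
    pd 0 (Sm r (u 0)) x + pd 1 (Sm r (u 1)) x = r * Sm r d x := by
  have h := hd.weak _ (isTest_moll hr0 hr1 hx)
  have hi : ∀ i, Integrable (fun y => u i y * pd i (moll r) (r • x - y)) μQ := by
    intro i
    have hm1 : ContDiff ℝ 1 (moll r) := (contDiff_moll r).of_le (by norm_cast)
    have hc : Continuous (fun y => pd i (moll r) (r • x - y)) := by
      have := continuous_pd hm1 i
      fun_prop
    exact (hu i).integrable_mul (memLp_of_continuous hc)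
  simp only [pd_moll_comp] at h
  rw [pd_Sm hr1 (hu 0), pd_Sm hr1 (hu 1), ← mul_add, ← integral_add (hi 0) (hi 1),
    Sm_eq_integral_moll]
  congr 1
  have e : ∀ y, u 0 y * -pd 0 (moll r) (r • x - y) + u 1 y * -pd 1 (moll r) (r • x - y) =
    -(u 0 y * pd 0 (moll r) (r • x - y) + u 1 y * pd 1 (moll r) (r • x - y)) := fun y => by ring
  simp only [e, integral_neg, neg_inj] at h
  exact h

lemma Sm_congr_ae {w : ℝ × ℝ → ℝ} (h : v =ᵐ[μQ] w) : Sm r v = Sm r w := by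
  ext x
  rw [Sm_eq_integral_moll, Sm_eq_integral_moll]
  refine integral_congr_ae ?_
  filter_upwards [h] with y hy
  rw [hy]

lemma finrank_plane : Module.finrank ℝ (ℝ × ℝ) = 2 := by simp

/-- The substitution y = r x + (1 - r) w links the two faces of the operator: the convolution gives
smoothness and derivatives, the average gives convergence in L². -/
lemma Sm_eq_average (hr1 : r < 1) (x : ℝ × ℝ) :
    Sm r v x = ∫ w, Q.indicator v (r • x + (1 - r) • w) ∂θ := by
  have h1 : 0 < 1 - r := by linarith
  rw [integral_θ]
  set h : ℝ × ℝ → ℝ := fun z => bmpN ((1 - r)⁻¹ • z) * Q.indicator v (r • x + z) with hh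
  have e1 : ∀ w, bmpN w * Q.indicator v (r • x + (1 - r) • w) = h ((1 - r) • w) := by
    intro w
    simp only [hh]
    rw [smul_smul, inv_mul_cancel₀ h1.ne', one_smul]
  simp only [e1]
  rw [Measure.integral_comp_smul, finrank_plane, abs_of_pos (by positivity), smul_eq_mul,
    ← integral_sub_right_eq_self h (r • x), ← integral_const_mul]
  unfold Sm convolution
  congr 1 with y
  simp only [ContinuousLinearMap.mul_apply', moll, hh]
  have e2 : -(1 - r)⁻¹ • (r • x - y) = (1 - r)⁻¹ • (y - r • x) := by module
  rw [e2, add_sub_cancel]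
  ring

lemma integrable_θ_dilation (hr1 : r < 1) (hv : MemLp v 2 μQ) (x : ℝ × ℝ) :
    Integrable (fun w => Q.indicator v (r • x + (1 - r) • w)) θ :=
  integrable_θ (((integrable_indicator_Q hv).comp_add_left (r • x)).comp_smul
    (sub_ne_zero.2 hr1.ne'))

end

/-! ### Convergence of the smoothing in fractional Sobolev spaces. -/

section

variable {r : ℝ} {v : ℝ × ℝ → ℝ}

lemma norm_le_one_of_mem_Q {x : ℝ × ℝ} (hx : x ∈ Q) : ‖x‖ ≤ 1 := by
  obtain ⟨⟨h1, h2⟩, h3, h4⟩ := hx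
  rw [Prod.norm_def]
  refine max_le ?_ ?_ <;> rw [Real.norm_eq_abs, abs_le] <;> constructor <;> linarith

lemma Q_subset_closedBall : Q ⊆ Metric.closedBall 0 1 := fun _ hx => by
  rw [mem_closedBall_zero_iff]
  exact norm_le_one_of_mem_Q hx

lemma dilation_mem_Q (hr0 : 0 < r) (hr1 : r < 1) {x w : ℝ × ℝ} (hx : x ∈ Q) (hw : w ∈ Q) :
    r • x + (1 - r) • w ∈ Q :=
  ((convex_Ioo (0 : ℝ) 1).prod (convex_Ioo (0 : ℝ) 1)) hx hw hr0.le (by linarith) (by ring)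

lemma memLp_indicator_Q (hv : MemLp v 2 μQ) : MemLp (Q.indicator v) 2 volume :=
  (memLp_indicator_iff_restrict measurableSet_Q).2 hv

lemma exists_normL2_Sm_sub_le (hv : MemLp v 2 μQ) {δ : ℝ≥0∞} (hδ : δ ≠ 0) :
    ∃ r₀ : ℝ, r₀ < 1 ∧ ∀ r, r₀ < r → r < 1 → normL2 (fun x => Sm r v x - v x) ^ 2 ≤ δ := by
  -- The smoothing depends only on the almost everywhere class of v, while averaging over dilations
  -- needs a Borel representative for joint measurability.
  wlog hm : Measurable v
  · have hv' : MemLp (hv.1.mk v) 2 μQ := (memLp_congr_ae hv.1.ae_eq_mk).1 hv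
    obtain ⟨r₀, h1, h2⟩ := this hv' hδ hv.1.stronglyMeasurable_mk.measurable
    refine ⟨r₀, h1, fun r h3 h4 => le_of_eq_of_le ?_ (h2 r h3 h4)⟩
    congr 1
    refine eLpNorm_congr_ae ?_
    filter_upwards [hv.1.ae_eq_mk] with x hx
    rw [hx, Sm_congr_ae hv.1.ae_eq_mk]
  obtain ⟨r₀, h1, h2⟩ := exists_averaged_dilation_close volume θ (ι := fun w : ℝ × ℝ => w)
    measurable_id (R := 1) (ae_θ_mem.mono fun w hw => norm_le_one_of_mem_Q hw)
    (hm.indicator measurableSet_Q) (memLp_indicator_Q hv) hδ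
  refine ⟨r₀, h1, fun r hr hr1 => le_trans ?_ (h2 r hr hr1)⟩
  rw [normL2, eLpNorm_two_sq]
  refine le_trans (le_of_eq ?_) (lintegral_mono_set Q_subset_closedBall)
  refine setLIntegral_congr_fun measurableSet_Q fun x hx => ?_
  rw [Sm_eq_average hr1, indicator_of_mem hx]

/-- The difference quotient of `v`, set to zero outside `Q × Q`. -/
noncomputable def diffQuot (σ : ℝ) (v : ℝ × ℝ → ℝ) (z : (ℝ × ℝ) × (ℝ × ℝ)) : ℝ :=
  (Q ×ˢ Q).indicator (fun z => (v z.1 - v z.2) / euclDist z.1 z.2 ^ (1 + σ)) z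

lemma measurable_diffQuot (σ : ℝ) (hv : Measurable v) : Measurable (diffQuot σ v) := by
  have h1 : Measurable fun z : (ℝ × ℝ) × (ℝ × ℝ) => euclDist z.1 z.2 := continuous_euclDist.measurable
  refine Measurable.indicator ?_ (measurableSet_Q.prod measurableSet_Q)
  exact ((hv.comp measurable_fst).sub (hv.comp measurable_snd)).div (h1.pow_const _)

lemma kerQ_eq_sq (σ : ℝ) (x y : ℝ × ℝ) : kerQ σ x y = (euclDist x y ^ (1 + σ)) ^ 2 := by
  rw [kerQ, ← Real.rpow_natCast, ← Real.rpow_mul (euclDist_nonneg _ _)]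
  push_cast; ring_nf

lemma energy_integrand_eq (σ : ℝ) (f : ℝ × ℝ → ℝ) (x y : ℝ × ℝ) :
    ENNReal.ofReal (|f x - f y| ^ 2 / kerQ σ x y) =
      ‖(f x - f y) / euclDist x y ^ (1 + σ)‖ₑ ^ 2 := by
  rw [Real.enorm_eq_ofReal_abs, ← ENNReal.ofReal_pow (abs_nonneg _), abs_div, div_pow, kerQ_eq_sq,
    sq_abs (euclDist x y ^ (1 + σ))]

lemma gagliardoSq_eq_lintegral {σ : ℝ} {f : ℝ × ℝ → ℝ} (hf : AEMeasurable f μQ) :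
    gagliardoSq σ f = ∫⁻ z in Q ×ˢ Q, ‖(f z.1 - f z.2) / euclDist z.1 z.2 ^ (1 + σ)‖ₑ ^ 2 := by
  rw [gagliardoSq_eq, energy_eq_prod hf (measurable_kerQ σ)]
  simp only [energy_integrand_eq]
  rw [μQ, Measure.prod_restrict]
  rfl

lemma euclDist_dilation (hr0 : 0 < r) (w x y : ℝ × ℝ) :
    euclDist (r • x + w) (r • y + w) = r * euclDist x y := by
  simp only [euclDist, Prod.fst_add, Prod.smul_fst, Prod.snd_add, Prod.smul_snd, smul_eq_mul]
  rw [show (r * x.1 + w.1 - (r * y.1 + w.1)) ^ 2 + (r * x.2 + w.2 - (r * y.2 + w.2)) ^ 2 =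
    r ^ 2 * ((x.1 - y.1) ^ 2 + (x.2 - y.2) ^ 2) by ring, Real.sqrt_mul (by positivity),
    Real.sqrt_sq hr0.le]

lemma memLp_diffQuot {σ : ℝ} (hm : Measurable v) (hE : gagliardoSq σ v ≠ ⊤) :
    MemLp (diffQuot σ v) 2 volume := by
  refine ⟨(measurable_diffQuot σ hm).aestronglyMeasurable, ?_⟩
  have e : eLpNorm (diffQuot σ v) 2 volume ^ 2 = gagliardoSq σ v := by
    rw [eLpNorm_two_sq, gagliardoSq_eq_lintegral hm.aemeasurable,
      ← lintegral_indicator (measurableSet_Q.prod measurableSet_Q)]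
    refine lintegral_congr fun z => ?_
    unfold diffQuot
    by_cases hz : z ∈ Q ×ˢ Q <;> simp [hz]
  by_contra hcon
  rw [not_lt, top_le_iff] at hcon
  rw [hcon] at e
  simp at e
  exact hE e.symm

/-- Both points are dilated towards the same centre w, so their distance is multiplied exactly by r.
Hence the difference quotient of the smoothing is r^(1+σ) times an average of dilates of `diffQuot`
in ℝ⁴, with centres (w, w). -/
lemma Sm_sub_quotient {σ : ℝ} (hr0 : 0 < r) (hr1 : r < 1) (hv : MemLp v 2 μQ) {x y : ℝ × ℝ}
    (hx : x ∈ Q) (hy : y ∈ Q) :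
    ((Sm r v x - v x) - (Sm r v y - v y)) / euclDist x y ^ (1 + σ) =
      r ^ (1 + σ) * ((∫ w, diffQuot σ v (r • (x, y) + (1 - r) • (w, w)) ∂θ) - diffQuot σ v (x, y)) +
        (r ^ (1 + σ) - 1) * diffQuot σ v (x, y) := by
  have hxy : (x, y) ∈ Q ×ˢ Q := ⟨hx, hy⟩
  have e : (Sm r v x - Sm r v y) / euclDist x y ^ (1 + σ) =
      r ^ (1 + σ) * ∫ w, diffQuot σ v (r • (x, y) + (1 - r) • (w, w)) ∂θ := by
    rw [Sm_eq_average hr1, Sm_eq_average hr1,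
      ← integral_sub (integrable_θ_dilation hr1 hv x) (integrable_θ_dilation hr1 hv y),
      ← integral_div, ← integral_const_mul]
    refine integral_congr_ae ?_
    filter_upwards [ae_θ_mem] with w hw
    have h1 := dilation_mem_Q hr0 hr1 hx hw
    have h2 := dilation_mem_Q hr0 hr1 hy hw
    have h3 : r • (x, y) + (1 - r) • (w, w) = (r • x + (1 - r) • w, r • y + (1 - r) • w) := rfl
    have hrp : r ^ (1 + σ) ≠ 0 := (Real.rpow_pos_of_pos hr0 _).ne'
    rw [h3, diffQuot, indicator_of_mem (show _ ∈ Q ×ˢ Q from ⟨h1, h2⟩), indicator_of_mem h1,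
      indicator_of_mem h2, euclDist_dilation hr0, Real.mul_rpow hr0.le (euclDist_nonneg _ _)]
    field_simp
  have e2 : diffQuot σ v (x, y) = (v x - v y) / euclDist x y ^ (1 + σ) := by
    rw [diffQuot, indicator_of_mem hxy]
  rw [mul_sub, ← e, e2]
  ring

instance : (volume : Measure ((ℝ × ℝ) × (ℝ × ℝ))).IsAddHaarMeasure :=
  inferInstanceAs ((volume : Measure (ℝ × ℝ)).prod (volume : Measure (ℝ × ℝ))).IsAddHaarMeasure

/-- A finite energy means that `diffQuot` lies in L²(ℝ⁴), so the claim reduces to L² convergence of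
averaged dilations there, plus the scalar error r^(1+σ) - 1. -/
lemma exists_gagliardoSq_Sm_sub_le {σ : ℝ} (hσ : 0 < σ) (hv : MemLp v 2 μQ)
    (hE : gagliardoSq σ v ≠ ⊤) {δ : ℝ≥0∞} (hδ : δ ≠ 0) :
    ∃ r₀ : ℝ, r₀ < 1 ∧ ∀ r, r₀ < r → r < 1 →
      gagliardoSq σ (fun x => Sm r v x - v x) ≤ δ := by
  wlog hm : Measurable v
  · have hv' : MemLp (hv.1.mk v) 2 μQ := (memLp_congr_ae hv.1.ae_eq_mk).1 hv
    have hE' : gagliardoSq σ (hv.1.mk v) ≠ ⊤ := by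
      rwa [gagliardoSq_eq, ← energy_congr_ae hv.1.ae_eq_mk]
    obtain ⟨r₀, h1, h2⟩ := this hσ hv' hE' hδ hv.1.stronglyMeasurable_mk.measurable
    refine ⟨r₀, h1, fun r h3 h4 => le_of_eq_of_le ?_ (h2 r h3 h4)⟩
    refine energy_congr_ae ?_
    filter_upwards [hv.1.ae_eq_mk] with x hx
    rw [hx, Sm_congr_ae hv.1.ae_eq_mk]
  have hF := memLp_diffQuot hm hE
  have hδ4 : δ / 4 ≠ 0 := (ENNReal.div_pos hδ (by simp)).ne'
  obtain ⟨r₀, h1, h2⟩ := exists_averaged_dilation_close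
    (volume : Measure ((ℝ × ℝ) × (ℝ × ℝ))) θ
    (ι := fun w : ℝ × ℝ => (w, w)) (by fun_prop) (R := 1)
    (ae_θ_mem.mono fun w hw => by
      rw [Prod.norm_def]; exact max_le (norm_le_one_of_mem_Q hw) (norm_le_one_of_mem_Q hw))
    (measurable_diffQuot σ hm) hF hδ4
  -- This disposes of the error left by the scaling factor r^(1+σ).
  have hlim : Tendsto (fun r : ℝ => ‖r ^ (1 + σ) - 1‖ₑ ^ 2 * eLpNorm (diffQuot σ v) 2 volume ^ 2)
      (𝓝 1) (𝓝 0) := by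
    have hc : ContinuousAt (fun r : ℝ => ‖r ^ (1 + σ) - 1‖ₑ ^ 2) 1 := by
      have : ContinuousAt (fun r : ℝ => r ^ (1 + σ)) 1 :=
        Real.continuousAt_rpow_const _ _ (Or.inl one_ne_zero)
      exact ((ENNReal.continuous_pow 2).comp continuous_enorm).continuousAt.comp
        (this.sub continuousAt_const)
    have := hc.tendsto
    simp only [Real.one_rpow, sub_self, enorm_zero, ne_eq, OfNat.ofNat_ne_zero, not_false_eq_true,
      zero_pow] at this
    simpa using ENNReal.Tendsto.mul_const this
      (Or.inr (ENNReal.pow_ne_top hF.2.ne) : (0 : ℝ≥0∞) ≠ 0 ∨ _ ≠ ⊤)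
  obtain ⟨ρ, hρ0, hρ⟩ := Metric.eventually_nhds_iff.1
    (hlim.eventually (ge_mem_nhds (pos_iff_ne_zero.2 hδ4)))
  refine ⟨max (max r₀ 0) (1 - ρ), max_lt (max_lt h1 one_pos) (by linarith), fun r hr hr1 => ?_⟩
  have hr0 : 0 < r := ((le_max_right _ _).trans (le_max_left _ _)).trans_lt hr
  have hk1 := h2 r (((le_max_left _ _).trans (le_max_left _ _)).trans_lt hr) hr1
  have hk2 := hρ (y := r) (by
    have := (le_max_right _ _).trans_lt hr
    rw [Real.dist_eq, abs_lt]; constructor <;> linarith)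
  have hmS : AEMeasurable (fun x => Sm r v x - v x) μQ :=
    ((contDiff_Sm hr1 hv).continuous.measurable.sub hm).aemeasurable
  rw [gagliardoSq_eq_lintegral hmS]
  have hrle : ‖r ^ (1 + σ)‖ₑ ≤ 1 := by
    rw [Real.enorm_eq_ofReal (by positivity)]
    exact ENNReal.ofReal_le_one.2 (Real.rpow_le_one hr0.le hr1.le (by linarith))
  calc _ ≤ ∫⁻ z in Q ×ˢ Q,
        (2 * ‖(∫ w, diffQuot σ v (r • z + (1 - r) • (w, w)) ∂θ) - diffQuot σ v z‖ₑ ^ 2 +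
          2 * (‖r ^ (1 + σ) - 1‖ₑ ^ 2 * ‖diffQuot σ v z‖ₑ ^ 2)) := by
        refine setLIntegral_mono_ae' (measurableSet_Q.prod measurableSet_Q) (ae_of_all _ ?_)
        rintro ⟨x, y⟩ ⟨hx, hy⟩
        simp only
        rw [Sm_sub_quotient hr0 hr1 hv hx hy]
        refine (pow_le_pow_left' (enorm_add_le _ _) 2).trans ((ennreal_add_sq_le _ _).trans ?_)
        rw [enorm_mul, enorm_mul, mul_pow, mul_pow]
        gcongr
        exact mul_le_of_le_one_left zero_le (pow_le_one' hrle 2)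
    _ = 2 * (∫⁻ z in Q ×ˢ Q,
          ‖(∫ w, diffQuot σ v (r • z + (1 - r) • (w, w)) ∂θ) - diffQuot σ v z‖ₑ ^ 2) +
          2 * (‖r ^ (1 + σ) - 1‖ₑ ^ 2 * ∫⁻ z in Q ×ˢ Q, ‖diffQuot σ v z‖ₑ ^ 2) := by
        have hmd := measurable_diffQuot σ hm
        rw [lintegral_add_right _ (by fun_prop), lintegral_const_mul' _ _ (by simp),
          lintegral_const_mul' _ _ (by simp), lintegral_const_mul' _ _ (by finiteness)]
    _ ≤ 2 * (δ / 4) + 2 * (δ / 4) := by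
        gcongr
        · refine le_trans (lintegral_mono_set ?_) hk1
          rintro ⟨x, y⟩ ⟨hx, hy⟩
          rw [mem_closedBall_zero_iff, Prod.norm_def]
          exact max_le (norm_le_one_of_mem_Q hx) (norm_le_one_of_mem_Q hy)
        · refine le_trans (mul_le_mul_right (setLIntegral_le_lintegral _ _) _) ?_
          rwa [← eLpNorm_two_sq]
    _ = δ := by
        rw [← add_mul, show (2 : ℝ≥0∞) + 2 = 4 by norm_num]
        exact ENNReal.mul_div_cancel (by simp) (by simp)

/-- Parameters of a sequence of smoothings. -/
noncomputable def rs (n : ℕ) : ℝ := 1 - 1 / ((n : ℝ) + 2)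

lemma rs_pos (n : ℕ) : 0 < rs n := by
  unfold rs
  rw [sub_pos, div_lt_one (by positivity)]
  have : (0 : ℝ) ≤ n := Nat.cast_nonneg n
  linarith

lemma rs_lt_one (n : ℕ) : rs n < 1 := by
  unfold rs
  have : (0 : ℝ) < 1 / ((n : ℝ) + 2) := by positivity
  linarith

lemma tendsto_rs : Tendsto rs atTop (𝓝 1) := by
  have h : Tendsto (fun n : ℕ => 1 / ((n : ℝ) + 2)) atTop (𝓝 0) := by
    have := (tendsto_one_div_add_atTop_nhds_zero_nat (𝕜 := ℝ)).comp (tendsto_add_atTop_nat 1)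
    refine this.congr fun n => ?_
    simp only [Function.comp_apply]
    push_cast
    ring_nf
  have h2 := h.const_sub 1
  rwa [sub_zero] at h2

lemma tendsto_of_close {f : ℝ → ℝ≥0∞}
    (h : ∀ δ : ℝ≥0∞, δ ≠ 0 → ∃ r₀ : ℝ, r₀ < 1 ∧ ∀ r, r₀ < r → r < 1 → f r ≤ δ) :
    Tendsto (fun n => f (rs n)) atTop (𝓝 0) := by
  rw [ENNReal.tendsto_nhds_zero]
  intro δ hδ
  obtain ⟨r₀, h1, h2⟩ := h δ hδ.ne'
  filter_upwards [tendsto_rs.eventually (lt_mem_nhds h1)] with n hn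
  exact h2 _ hn (rs_lt_one n)

lemma tendsto_normL2_Sm_sub (hv : MemLp v 2 μQ) :
    Tendsto (fun n => normL2 (fun x => Sm (rs n) v x - v x)) atTop (𝓝 0) := by
  have h := tendsto_of_close fun δ hδ => exists_normL2_Sm_sub_le hv hδ
  have h2 := (ENNReal.continuous_rpow_const (y := 1 / 2)).tendsto 0 |>.comp h
  rw [ENNReal.zero_rpow_of_pos (by norm_num)] at h2
  refine h2.congr fun n => ?_
  rw [Function.comp_apply, ← ENNReal.rpow_natCast, ← ENNReal.rpow_mul]
  norm_num

lemma tendsto_NQ_Sm_sub {σ : ℝ} (hσ : 0 < σ) (hv : MemLp v 2 μQ) (hE : NQ σ v ≠ ⊤) :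
    Tendsto (fun n => NQ σ (fun x => Sm (rs n) v x - v x)) atTop (𝓝 0) := by
  have h1 := tendsto_of_close fun δ hδ => exists_normL2_Sm_sub_le hv hδ
  have h2 := tendsto_of_close fun δ hδ =>
    exists_gagliardoSq_Sm_sub_le hσ hv ((NQ_ne_top_iff hv).1 hE) hδ
  have h3 := h1.add h2
  rwa [add_zero] at h3

end

/-! ### Green's functional. -/

section

lemma abs_integral_mul_le {X : Type*} [MeasurableSpace X] {μ : Measure X} {f g : X → ℝ}
    (hf : MemLp f 2 μ) (hg : MemLp g 2 μ) :
    |∫ x, f x * g x ∂μ| ≤ (eLpNorm f 2 μ).toReal * (eLpNorm g 2 μ).toReal := by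
  have e : ∀ {f : X → ℝ}, MemLp f 2 μ →
      (∫ x, ‖f x‖ ^ (2 : ℝ) ∂μ) ^ (1 / 2 : ℝ) = (eLpNorm f 2 μ).toReal := by
    intro f hf
    have h := eLpNorm_two_sq_eq_integral hf
    have h2 := congrArg ENNReal.toReal h
    rw [ENNReal.toReal_ofReal (integral_nonneg fun _ => sq_nonneg _), ENNReal.toReal_pow] at h2
    simp only [Real.rpow_ofNat, Real.norm_eq_abs, sq_abs]
    rw [← h2, ← Real.sqrt_eq_rpow, Real.sqrt_sq ENNReal.toReal_nonneg]
  have h := integral_mul_norm_le_Lp_mul_Lq (μ := μ) (f := f) (g := g) Real.HolderConjugate.two_two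
    (by simpa using hf) (by simpa using hg)
  rw [e hf, e hg] at h
  refine le_trans ?_ h
  exact abs_integral_le_integral_abs.trans (le_of_eq (by simp [abs_mul]))

/-- The left hand side of Green's formula. -/
noncomputable def Lf (u : Fin 2 → ℝ × ℝ → ℝ) (d ψ : ℝ × ℝ → ℝ) : ℝ :=
  (∫ x, (u 0 x * pd 0 ψ x + u 1 x * pd 1 ψ x) ∂μQ) + ∫ x, d x * ψ x ∂μQ

variable {u w : Fin 2 → ℝ × ℝ → ℝ} {d d' ψ χ : ℝ × ℝ → ℝ} {s σ : ℝ}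

lemma integrable_mul_pd (hu : ∀ i, MemLp (u i) 2 μQ) (hψ : ContDiff ℝ 1 ψ) (i : Fin 2) :
    Integrable (fun x => u i x * pd i ψ x) μQ :=
  (hu i).integrable_mul (memLp_of_continuous (continuous_pd hψ i))

lemma integrable_mul_smooth (hd : MemLp d 2 μQ) (hψ : ContDiff ℝ 1 ψ) :
    Integrable (fun x => d x * ψ x) μQ :=
  hd.integrable_mul (memLp_of_continuous hψ.continuous)

lemma Lf_eq (hu : ∀ i, MemLp (u i) 2 μQ) (hψ : ContDiff ℝ 1 ψ) :
    Lf u d ψ = (∫ x, u 0 x * pd 0 ψ x ∂μQ) + (∫ x, u 1 x * pd 1 ψ x ∂μQ) +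
      ∫ x, d x * ψ x ∂μQ := by
  rw [Lf, integral_add (integrable_mul_pd hu hψ 0) (integrable_mul_pd hu hψ 1)]

lemma pd_sub (hψ : ContDiff ℝ 1 ψ) (hχ : ContDiff ℝ 1 χ) (i : Fin 2) (x : ℝ × ℝ) :
    pd i (fun y => ψ y - χ y) x = pd i ψ x - pd i χ x := by
  unfold pd
  rw [fderiv_fun_sub (hψ.differentiable one_ne_zero x) (hχ.differentiable one_ne_zero x)]
  simp

lemma pd_mul (hψ : ContDiff ℝ 1 ψ) (hχ : ContDiff ℝ 1 χ) (i : Fin 2) (x : ℝ × ℝ) :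
    pd i (fun y => ψ y * χ y) x = ψ x * pd i χ x + pd i ψ x * χ x := by
  unfold pd
  rw [fderiv_fun_mul (hψ.differentiable one_ne_zero x) (hχ.differentiable one_ne_zero x)]
  simp [mul_comm]

lemma Lf_sub_right (hu : ∀ i, MemLp (u i) 2 μQ) (hd : MemLp d 2 μQ) (hψ : ContDiff ℝ 1 ψ)
    (hχ : ContDiff ℝ 1 χ) : Lf u d (fun x => ψ x - χ x) = Lf u d ψ - Lf u d χ := by
  rw [Lf_eq hu (hψ.sub hχ), Lf_eq hu hψ, Lf_eq hu hχ]
  simp only [pd_sub hψ hχ, mul_sub]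
  rw [integral_sub (integrable_mul_pd hu hψ 0) (integrable_mul_pd hu hχ 0),
    integral_sub (integrable_mul_pd hu hψ 1) (integrable_mul_pd hu hχ 1),
    integral_sub (integrable_mul_smooth hd hψ) (integrable_mul_smooth hd hχ)]
  ring

lemma Lf_sub_left (hu : ∀ i, MemLp (u i) 2 μQ) (hd : MemLp d 2 μQ) (hw : ∀ i, MemLp (w i) 2 μQ)
    (hd' : MemLp d' 2 μQ) (hψ : ContDiff ℝ 1 ψ) :
    Lf (fun i x => u i x - w i x) (fun x => d x - d' x) ψ = Lf u d ψ - Lf w d' ψ := by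
  rw [Lf_eq (u := fun i x => u i x - w i x) (fun i => (hu i).sub (hw i)) hψ, Lf_eq hu hψ, Lf_eq hw hψ]
  simp only [sub_mul]
  rw [integral_sub (integrable_mul_pd hu hψ 0) (integrable_mul_pd hw hψ 0),
    integral_sub (integrable_mul_pd hu hψ 1) (integrable_mul_pd hw hψ 1),
    integral_sub (integrable_mul_smooth hd hψ) (integrable_mul_smooth hd' hψ)]
  ring

lemma normL2_toReal_le_nQ {v : ℝ × ℝ → ℝ} (h : NQ σ v ≠ ⊤) : (normL2 v).toReal ≤ nQ σ v := by
  refine Real.le_sqrt_of_sq_le ?_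
  rw [← ENNReal.toReal_pow]
  exact ENNReal.toReal_mono h le_self_add

/-- The two derivative terms are pairings, and the divergence term is Cauchy-Schwarz in L². The
bound is continuity of the functional in the H^σ norm, with explicit dependence on the field. -/
lemma exists_abs_Lf_le (hs0 : 0 < s) (hs1 : s < 1) (hσ : 1 / 2 < σ) (hσ1 : σ < 1)
    (hsσ : 1 < s + σ) : ∃ C : ℝ, 0 < C ∧ ∀ (u : Fin 2 → ℝ × ℝ → ℝ) (d ψ : ℝ × ℝ → ℝ),
      (∀ i, MemLp (u i) 2 μQ) → (∀ i, NQ s (u i) ≠ ⊤) → MemLp d 2 μQ → ContDiff ℝ 1 ψ →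
      NQ σ ψ ≠ ⊤ →
      |Lf u d ψ| ≤ (C * (nQ s (u 0) + nQ s (u 1)) + (normL2 d).toReal) * nQ σ ψ := by
  obtain ⟨C, hC0, hC⟩ := exists_pairing_le hs0 hs1 hσ hσ1 hsσ
  refine ⟨C, hC0, fun u d ψ hu hNu hd hψ hNψ => ?_⟩
  rw [Lf_eq hu hψ]
  have h0 := hC (u 0) ψ (hu 0) (hNu 0) hψ hNψ 0
  have h1 := hC (u 1) ψ (hu 1) (hNu 1) hψ hNψ 1
  have h2 : |∫ x, d x * ψ x ∂μQ| ≤ (normL2 d).toReal * nQ σ ψ :=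
    (abs_integral_mul_le hd (memLp_of_continuous hψ.continuous)).trans
      (mul_le_mul_of_nonneg_left (normL2_toReal_le_nQ hNψ) ENNReal.toReal_nonneg)
  calc _ ≤ |∫ x, u 0 x * pd 0 ψ x ∂μQ| + |∫ x, u 1 x * pd 1 ψ x ∂μQ| + |∫ x, d x * ψ x ∂μQ| :=
        abs_add_three _ _ _
    _ ≤ C * nQ s (u 0) * nQ σ ψ + C * nQ s (u 1) * nQ σ ψ + (normL2 d).toReal * nQ σ ψ := by
        gcongr
    _ = _ := by ring

/-- Green's formula for smooth fields. -/
lemma Lf_smooth (hw : ∀ i, ContDiff ℝ 1 (w i)) (hψ : ContDiff ℝ 1 ψ) :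
    Lf w (fun x => pd 0 (w 0) x + pd 1 (w 1) x) ψ =
      ∑ e : Fin 4, ∫ t, (w 0 (edgePt e t) * (normal e).1 + w 1 (edgePt e t) * (normal e).2) *
        ψ (edgePt e t) ∂μI := by
  have hw0 := hw 0
  have hw1 := hw 1
  have hi : ∀ i, MemLp (w i) 2 μQ := fun i => memLp_of_continuous (hw i).continuous
  have h0 : ContDiff ℝ 1 (fun y => w 0 y * ψ y) := hw0.mul hψ
  have h1 : ContDiff ℝ 1 (fun y => w 1 y * ψ y) := hw1.mul hψ
  have hint : ∀ f : ℝ × ℝ → ℝ, Continuous f → Integrable f μQ := fun f hf =>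
    (memLp_of_continuous hf).integrable (by norm_num)
  have e : Lf w (fun x => pd 0 (w 0) x + pd 1 (w 1) x) ψ =
      (∫ x, pd 0 (fun y => w 0 y * ψ y) x ∂μQ) + ∫ x, pd 1 (fun y => w 1 y * ψ y) x ∂μQ := by
    have c0 := continuous_pd hψ 0
    have c1 := continuous_pd hψ 1
    have c2 := continuous_pd hw0 0
    have c3 := continuous_pd hw1 1
    have c4 := hψ.continuous
    have c5 := hw0.continuous
    have c6 := hw1.continuous
    rw [Lf, ← integral_add (hint _ (by fun_prop)) (hint _ (by fun_prop)),
      ← integral_add (hint _ (continuous_pd h0 0)) (hint _ (continuous_pd h1 1))]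
    congr 1 with x
    rw [pd_mul hw0 hψ, pd_mul hw1 hψ]
    ring
  have hc : ∀ (f : ℝ → ℝ), Continuous f → IntegrableOn f (Ioc 0 1) := fun f hf => hf.integrableOn_Ioc
  have c4 := hψ.continuous
  have c5 := hw0.continuous
  have c6 := hw1.continuous
  rw [e, μQ_eq_μS, integral_pd_zero h0 0 0 zero_le_one, integral_pd_one h1 0 0 zero_le_one,
    Fin.sum_univ_four]
  simp only [zero_add, μI, restrict_Ioo_eq_restrict_Ioc]
  rw [integral_sub (hc _ (by fun_prop)) (hc _ (by fun_prop)),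
    integral_sub (hc _ (by fun_prop)) (hc _ (by fun_prop))]
  simp only [edgePt, normal, Matrix.cons_val, mul_zero, zero_add, mul_one, add_zero, mul_neg,
    neg_mul, integral_neg]
  ring

lemma tendsto_nQ_zero {f : ℕ → ℝ × ℝ → ℝ} (h : Tendsto (fun n => NQ σ (f n)) atTop (𝓝 0)) :
    Tendsto (fun n => nQ σ (f n)) atTop (𝓝 0) := by
  have h2 := (ENNReal.tendsto_toReal ENNReal.zero_ne_top).comp h
  have h3 := (Real.continuous_sqrt.tendsto _).comp h2
  simpa [Function.comp_def, nQ] using h3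

/-- By `sum_pd_Sm` the subtracted function is, on Q, the divergence of the smoothed field when d is
the divergence of the field; this gives convergence of the divergences. -/
lemma tendsto_normL2_sub_div (hd : MemLp d 2 μQ) :
    Tendsto (fun n => (normL2 (fun x => d x - rs n * Sm (rs n) d x)).toReal) atTop (𝓝 0) := by
  have h1 := tendsto_normL2_Sm_sub hd
  have h2 : Tendsto (fun n => ENNReal.ofReal (1 - rs n) * normL2 d +
      normL2 (fun x => Sm (rs n) d x - d x)) atTop (𝓝 0) := by
    have h3 : Tendsto (fun n => ENNReal.ofReal (1 - rs n)) atTop (𝓝 0) := by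
      have := ENNReal.tendsto_ofReal (tendsto_rs.const_sub 1)
      simpa using this
    have h4 := ENNReal.Tendsto.mul_const h3 (Or.inr hd.2.ne : (0 : ℝ≥0∞) ≠ 0 ∨ normL2 d ≠ ⊤)
    have h5 := h4.add h1
    simpa using h5
  have h3 : Tendsto (fun n => normL2 (fun x => d x - rs n * Sm (rs n) d x)) atTop (𝓝 0) := by
    refine tendsto_of_tendsto_of_tendsto_of_le_of_le tendsto_const_nhds h2 (fun _ => zero_le)
      fun n => ?_
    -- The factor r is separated from the smoothing error, and each part tends to 0 in L².
    have e : (fun x => d x - rs n * Sm (rs n) d x) =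
        (1 - rs n) • d + (- rs n) • (fun x => Sm (rs n) d x - d x) := by
      ext x; simp; ring
    have hS : MemLp (Sm (rs n) d) 2 μQ :=
      memLp_of_continuous (contDiff_Sm (rs_lt_one n) hd).continuous
    simp only [e]
    refine (eLpNorm_add_le (hd.1.const_smul _) ((hS.sub hd).1.const_smul _) (by norm_num)).trans ?_
    rw [eLpNorm_const_smul, eLpNorm_const_smul]
    have a1 : ‖1 - rs n‖ₑ = ENNReal.ofReal (1 - rs n) :=
      Real.enorm_eq_ofReal (by linarith [rs_lt_one n])
    have a2 : ‖-rs n‖ₑ ≤ 1 := by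
      rw [enorm_neg, Real.enorm_eq_ofReal (rs_pos n).le]
      exact ENNReal.ofReal_le_one.2 (rs_lt_one n).le
    rw [a1]
    exact add_le_add le_rfl (mul_le_of_le_one_left zero_le a2)
  simpa [Function.comp_def] using (ENNReal.tendsto_toReal ENNReal.zero_ne_top).comp h3

lemma tendsto_integral_edge_mul {f : ℝ → ℝ} (hf : Continuous f) {g : ℕ → ℝ → ℝ}
    (hg : ∀ n, MemLp (g n) 2 μI) (h : Tendsto (fun n => eLpNorm (g n) 2 μI) atTop (𝓝 0)) :
    Tendsto (fun n => ∫ t, f t * g n t ∂μI) atTop (𝓝 0) := by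
  have hfm : MemLp f 2 μI := by
    rw [μI, restrict_Ioo_eq_restrict_Ioc]
    exact (memLp_two_iff_integrable_sq hf.aestronglyMeasurable).2 (hf.pow 2).integrableOn_Ioc
  rw [tendsto_zero_iff_abs_tendsto_zero]
  have h2 := ((ENNReal.tendsto_toReal ENNReal.zero_ne_top).comp h).const_mul
    (eLpNorm f 2 μI).toReal
  simp only [ENNReal.toReal_zero, mul_zero] at h2
  exact tendsto_of_tendsto_of_tendsto_of_le_of_le tendsto_const_nhds h2 (fun _ => abs_nonneg _)
    fun n => abs_integral_mul_le hfm (hg n)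

/-- Green's functional vanishes in the limit on sequences with vanishing traces. -/
lemma tendsto_Lf_zero (hs0 : 0 < s) (hs1 : s < 1) (hσ : 1 / 2 < σ) (hσ1 : σ < 1)
    (hsσ : 1 < s + σ) (hu : ∀ i, MemLp (u i) 2 μQ) (hNu : ∀ i, NQ s (u i) ≠ ⊤)
    (hd : HasWeakDiv u d) {χ : ℕ → ℝ × ℝ → ℝ} (hχ : ∀ n, ContDiff ℝ 1 (χ n)) {M : ℝ≥0∞}
    (hM : M ≠ ⊤) (hb : ∀ᶠ n in atTop, NQ σ (χ n) ≤ M)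
    (ht : ∀ e, Tendsto (fun n => eLpNorm (fun t => χ n (edgePt e t)) 2 μI) atTop (𝓝 0)) :
    Tendsto (fun n => Lf u d (χ n)) atTop (𝓝 0) := by
  obtain ⟨C, hC0, hC⟩ := exists_abs_Lf_le hs0 hs1 hσ hσ1 hsσ
  set w : ℕ → Fin 2 → ℝ × ℝ → ℝ := fun k i => Sm (rs k) (u i) with hw
  have hws : ∀ k i, ContDiff ℝ ∞ (w k i) := fun k i => contDiff_Sm (rs_lt_one k) (hu i)
  have hws1 : ∀ k i, ContDiff ℝ 1 (w k i) := fun k i => (hws k i).of_le (by norm_cast)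
  have hwm : ∀ k i, MemLp (w k i) 2 μQ := fun k i => memLp_of_continuous (hws k i).continuous
  set D : ℕ → ℝ × ℝ → ℝ := fun k x => pd 0 (w k 0) x + pd 1 (w k 1) x with hD
  have hDc : ∀ k, Continuous (D k) := fun k =>
    (continuous_pd (hws1 k 0) 0).add (continuous_pd (hws1 k 1) 1)
  have hDm : ∀ k, MemLp (D k) 2 μQ := fun k => memLp_of_continuous (hDc k)
  have hDd : ∀ k, normL2 (fun x => d x - D k x) = normL2 (fun x => d x - rs k * Sm (rs k) d x) := by
    intro k
    refine eLpNorm_congr_ae ?_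
    filter_upwards [ae_restrict_mem measurableSet_Q] with x hx
    rw [hD]
    simp only
    rw [sum_pd_Sm (rs_pos k) (rs_lt_one k) hu hd hx]
  have hNw : ∀ k i, NQ s (fun x => u i x - w k i x) = NQ s (fun x => Sm (rs k) (u i) x - u i x) :=
    fun k i => NQ_sub_comm _ _
  have hlim : ∀ i, Tendsto (fun k => nQ s (fun x => u i x - w k i x)) atTop (𝓝 0) := by
    intro i
    refine tendsto_nQ_zero ?_
    simp only [hNw]
    exact tendsto_NQ_Sm_sub hs0 (hu i) (hNu i)
  have herr : Tendsto (fun k => (C * (nQ s (fun x => u 0 x - w k 0 x) +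
      nQ s (fun x => u 1 x - w k 1 x)) + (normL2 (fun x => d x - D k x)).toReal) * √M.toReal)
      atTop (𝓝 0) := by
    have h1 := tendsto_normL2_sub_div hd.memLp
    simp only [← hDd] at h1
    simpa using ((((hlim 0).add (hlim 1)).const_mul C).add h1).mul_const √M.toReal
  have hfin : ∀ᶠ k in atTop, ∀ i, NQ s (fun x => u i x - w k i x) ≠ ⊤ := by
    rw [eventually_all]
    intro i
    have := (tendsto_NQ_Sm_sub hs0 (hu i) (hNu i)).eventually (gt_mem_nhds ENNReal.zero_lt_top)
    filter_upwards [this] with k hk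
    rw [hNw]
    exact hk.ne
  rw [Metric.tendsto_atTop']
  intro ε hε
  -- The smoothing index k is fixed first: the error of replacing u by a smooth field is small for
  -- all large n at once, since the test functions are bounded in H^σ. Only then does n tend to
  -- infinity.
  obtain ⟨k, hk1, hk2⟩ := (hfin.and (herr.eventually (gt_mem_nhds (half_pos hε)))).exists
  -- For the fixed smooth field, Green's formula leaves edge integrals of χ n against continuous
  -- weights, which vanish in the limit with the traces.
  have hbd : Tendsto (fun n => Lf (w k) (D k) (χ n)) atTop (𝓝 0) := by
    simp only [hD, Lf_smooth (hws1 k) (hχ _)]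
    have : (0 : ℝ) = ∑ e : Fin 4, 0 := by simp
    rw [this]
    refine tendsto_finsetSum _ fun e _ => ?_
    have c0 := (hws k 0).continuous.comp (continuous_edgePt e)
    have c1 := (hws k 1).continuous.comp (continuous_edgePt e)
    exact tendsto_integral_edge_mul
      ((c0.mul continuous_const).add (c1.mul continuous_const))
      (fun n => memLp_comp_edgePt (hχ n).continuous e) (ht e)
  have hbd2 := (hbd.abs).eventually (gt_mem_nhds (show |(0 : ℝ)| < ε / 2 by simpa using hε))
  obtain ⟨N, hN⟩ := eventually_atTop.1 (hb.and hbd2)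
  refine ⟨N, fun n hn => ?_⟩
  obtain ⟨h1, h2⟩ := hN n hn.le
  have h3 := hC (fun i x => u i x - w k i x) (fun x => d x - D k x) (χ n)
    (fun i => (hu i).sub (hwm k i)) hk1 (hd.memLp.sub (hDm k)) (hχ n)
    (ne_top_of_le_ne_top hM h1)
  rw [Lf_sub_left hu hd.memLp (hwm k) (hDm k) (hχ n)] at h3
  have h4 : nQ σ (χ n) ≤ √M.toReal := Real.sqrt_le_sqrt (ENNReal.toReal_mono hM h1)
  have h5 : |Lf u d (χ n) - Lf (w k) (D k) (χ n)| < ε / 2 := by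
    refine (h3.trans (mul_le_mul_of_nonneg_left h4 ?_)).trans_lt hk2
    have := nQ_nonneg s (fun x => u 0 x - w k 0 x)
    have := nQ_nonneg s (fun x => u 1 x - w k 1 x)
    positivity
  rw [Real.dist_eq, sub_zero]
  have := abs_add_le (Lf u d (χ n) - Lf (w k) (D k) (χ n)) (Lf (w k) (D k) (χ n))
  rw [sub_add_cancel] at this
  linarith

end

/-! ### The trace operator on H^σ for 1/2 < σ < 1. -/

section

lemma cauchySeq_of_edist_le_add {α : Type*} [PseudoEMetricSpace α] {f : ℕ → α} {a : ℕ → ℝ≥0∞}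
    (h : ∀ n m, edist (f n) (f m) ≤ a n + a m) (ha : Tendsto a atTop (𝓝 0)) : CauchySeq f := by
  rw [EMetric.cauchySeq_iff]
  intro ε hε
  have h2 := ha.eventually (gt_mem_nhds (ENNReal.half_pos hε.ne'))
  obtain ⟨N, hN⟩ := eventually_atTop.1 h2
  refine ⟨N, fun m hm n hn => (h m n).trans_lt ?_⟩
  calc _ < ε / 2 + ε / 2 := ENNReal.add_lt_add (hN m hm) (hN n hn)
    _ = ε := ENNReal.add_halves ε

variable {σ σ' : ℝ} {v w : ℝ × ℝ → ℝ} {e : Fin 4} {T T' : ℝ → ℝ}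

lemma normH_neg (h0 : 0 < σ) (h1 : σ < 1) (hv : MemLp v 2 μQ) :
    normH σ (fun x => - v x) = normH σ v := by
  rw [normH_eq h0 h1 hv, normH_eq h0 h1 (v := fun x => - v x) hv.neg, NQ_neg]

/-- The constant 2 is not sharp; it comes for free from the quadratic estimate, and a quasi-triangle
inequality suffices throughout. -/
lemma normH_sub_le (h0 : 0 < σ) (h1 : σ < 1) (hv : MemLp v 2 μQ) (hw : MemLp w 2 μQ) :
    normH σ (fun x => v x - w x) ≤ 2 * (normH σ v + normH σ w) := by
  refine ennreal_le_of_sq_le ?_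
  rw [normH_sq h0 h1 (v := fun x => v x - w x) (hv.sub hw)]
  refine (NQ_sub_le hv hw).trans ?_
  rw [← normH_sq h0 h1 hv, ← normH_sq h0 h1 hw]
  set a := normH σ v
  set b := normH σ w
  calc 2 * a ^ 2 + 2 * b ^ 2 ≤ 2 * a ^ 2 + 2 * b ^ 2 + (2 * a ^ 2 + 2 * b ^ 2 + 8 * a * b) :=
        le_self_add
    _ = _ := by ring

lemma normH_add_le (h0 : 0 < σ) (h1 : σ < 1) (hv : MemLp v 2 μQ) (hw : MemLp w 2 μQ) :
    normH σ (fun x => v x + w x) ≤ 2 * (normH σ v + normH σ w) := by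
  rw [← normH_neg h0 h1 hw]
  simpa using normH_sub_le h0 h1 hv (w := fun x => - w x) hw.neg

lemma normH_anti (h0 : 0 < σ') (h : σ' ≤ σ) (h1 : σ < 1) (v : ℝ × ℝ → ℝ) :
    normH σ' v ≤ 2 * normH σ v := by
  by_cases hv : MemLp v 2 μQ
  · refine ennreal_le_of_sq_le ?_
    rw [mul_pow, normH_sq h0 (h.trans_lt h1) hv, normH_sq (h0.trans_le h) h1 hv]
    refine (NQ_anti h h0.le h1.le v).trans (le_of_eq ?_)
    norm_num
  · have : normH σ v = ⊤ := by
      by_contra hcon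
      exact hv (memLp_of_normH_lt_top (lt_top_iff_ne_top.2 hcon))
    rw [this]
    simp

lemma memLp_of_tendsto_normH {ψ : ℕ → ℝ × ℝ → ℝ} (hψ : ∀ n, Continuous (ψ n))
    (h : Tendsto (fun n => normH σ (fun x => ψ n x - v x)) atTop (𝓝 0)) : MemLp v 2 μQ := by
  obtain ⟨n, hn⟩ := (h.eventually (gt_mem_nhds ENNReal.zero_lt_top)).exists
  have h1 := (memLp_of_continuous (hψ n)).sub (memLp_of_normH_lt_top hn)
  refine (memLp_congr_ae (ae_of_all _ fun x => ?_)).1 h1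
  simp

lemma contDiff_one_of_infty {ψ : ℝ × ℝ → ℝ} (h : ContDiff ℝ ∞ ψ) : ContDiff ℝ 1 ψ :=
  h.of_le (by norm_cast)

/-- Smooth approximations of a function with a trace converge on the edge to the trace. -/
lemma IsTrace.tendsto (hT : IsTrace v e T) (hσ : 1 / 2 < σ) (hσ1 : σ < 1)
    {χ : ℕ → ℝ × ℝ → ℝ} (hχ : ∀ n, ContDiff ℝ ∞ (χ n))
    (h : Tendsto (fun n => normH σ (fun x => χ n x - v x)) atTop (𝓝 0)) :
    Tendsto (fun n => eLpNorm (fun t => χ n (edgePt e t) - T t) 2 μI) atTop (𝓝 0) := by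
  obtain ⟨hTm, τ, hτ, hτ1, ψ, hψ, hψv, hψT⟩ := hT
  have hv := memLp_of_tendsto_normH (fun n => (hχ n).continuous) h
  -- The given sequence converges in H^σ, while the one defining the trace converges in H^τ. They
  -- are compared in the weaker of the two spaces, where the trace inequality still holds.
  set ρ := min σ τ with hρ
  have hρ0 : 1 / 2 < ρ := lt_min hσ hτ
  have hρ1 : ρ < 1 := (min_le_left _ _).trans_lt hσ1
  have hρp : 0 < ρ := by linarith
  obtain ⟨C, -, hC⟩ := exists_trace_le hρ0 hρ1
  have key : ∀ n, eLpNorm (fun t => χ n (edgePt e t) - T t) 2 μI ≤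
      C * (2 * (2 * normH σ (fun x => χ n x - v x) + 2 * normH τ (fun x => ψ n x - v x))) +
        eLpNorm (fun t => ψ n (edgePt e t) - T t) 2 μI := by
    intro n
    have e1 : (fun t => χ n (edgePt e t) - T t) =
        (fun t => χ n (edgePt e t) - ψ n (edgePt e t)) + fun t => ψ n (edgePt e t) - T t := by
      ext t; simp
    have m1 := memLp_comp_edgePt (hχ n).continuous e
    have m2 := memLp_comp_edgePt (hψ n).continuous e
    rw [e1]
    refine (eLpNorm_add_le (f := fun t => χ n (edgePt e t) - ψ n (edgePt e t))
      (g := fun t => ψ n (edgePt e t) - T t) (m1.sub m2).1 (m2.sub hTm).1 (by norm_num)).trans ?_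
    gcongr
    refine (hC (fun x => χ n x - ψ n x)
      ((contDiff_one_of_infty (hχ n)).sub (contDiff_one_of_infty (hψ n))) e).trans ?_
    gcongr
    have e2 : (fun x => χ n x - ψ n x) = fun x => (χ n x - v x) - (ψ n x - v x) := by
      ext x; ring
    rw [e2]
    refine (normH_sub_le hρp hρ1 ((memLp_of_continuous (hχ n).continuous).sub hv)
      ((memLp_of_continuous (hψ n).continuous).sub hv)).trans ?_
    gcongr
    · exact normH_anti hρp (min_le_left _ _) hσ1 _
    · exact normH_anti hρp (min_le_right _ _) hτ1 _
  have h1 := ENNReal.Tendsto.const_mul (a := 2) h (Or.inr (by simp))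
  have h2 := ENNReal.Tendsto.const_mul (a := 2) hψv (Or.inr (by simp))
  have h3 := ENNReal.Tendsto.const_mul (a := 2) (h1.add h2) (Or.inr (by simp))
  have h4 := (ENNReal.Tendsto.const_mul (a := C) h3 (Or.inr (by simp))).add hψT
  simp only [mul_zero, add_zero] at h4
  exact tendsto_of_tendsto_of_tendsto_of_le_of_le tendsto_const_nhds h4 (fun _ => zero_le) key

/-- The sequence that defines one trace also converges on the edge to the other, by
`IsTrace.tendsto`; limits in L² agree almost everywhere. -/
lemma IsTrace.ae_eq (hT : IsTrace v e T) (hT' : IsTrace v e T') : T =ᵐ[μI] T' := by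
  have hTm := hT.1
  obtain ⟨hTm', τ, hτ, hτ1, ψ, hψ, hψv, hψT⟩ := hT'
  have h := hT.tendsto hτ hτ1 hψ hψv
  have h2 := h.add hψT
  rw [add_zero] at h2
  have h3 : eLpNorm (fun t => T t - T' t) 2 μI = 0 := by
    refine le_antisymm (ge_of_tendsto' h2 fun n => ?_) zero_le
    have e1 : (fun t => T t - T' t) =
        (fun t => ψ n (edgePt e t) - T' t) - fun t => ψ n (edgePt e t) - T t := by
      ext t; simp
    have m2 := memLp_comp_edgePt (hψ n).continuous e
    rw [e1, add_comm]
    exact eLpNorm_sub_le (m2.sub hTm').1 (m2.sub hTm).1 (by norm_num)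
  have h4 := (eLpNorm_eq_zero_iff (f := fun t => T t - T' t) (hTm.sub hTm').1 (by norm_num)).1 h3
  filter_upwards [h4] with t ht
  simpa [sub_eq_zero] using ht

lemma tendsto_normH_Sm_sub (h0 : 0 < σ) (h1 : σ < 1) (hv : normH σ v < ⊤) :
    Tendsto (fun n => normH σ (fun x => Sm (rs n) v x - v x)) atTop (𝓝 0) := by
  have hm := memLp_of_normH_lt_top hv
  have h := tendsto_NQ_Sm_sub h0 hm (NQ_lt_top h0 h1 hv).ne
  have h2 := (ENNReal.continuous_rpow_const (y := 1 / 2)).tendsto 0 |>.comp h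
  rw [ENNReal.zero_rpow_of_pos (by norm_num)] at h2
  refine h2.congr fun n => ?_
  have hS : MemLp (Sm (rs n) v) 2 μQ :=
    memLp_of_continuous (contDiff_Sm (rs_lt_one n) hm).continuous
  rw [Function.comp_apply, normH_eq h0 h1 (v := fun x => Sm (rs n) v x - v x) (hS.sub hm)]

/-- By the trace inequality, the restrictions of the smoothings to the edge form a Cauchy sequence
in L². -/
lemma exists_isTrace (hσ : 1 / 2 < σ) (hσ1 : σ < 1) (hv : normH σ v < ⊤) (e : Fin 4) :
    ∃ T, IsTrace v e T := by
  have h0 : 0 < σ := by linarith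
  have hm := memLp_of_normH_lt_top hv
  set ψ : ℕ → ℝ × ℝ → ℝ := fun n => Sm (rs n) v with hψdef
  have hψ : ∀ n, ContDiff ℝ ∞ (ψ n) := fun n => contDiff_Sm (rs_lt_one n) hm
  have hψv : Tendsto (fun n => normH σ (fun x => ψ n x - v x)) atTop (𝓝 0) :=
    tendsto_normH_Sm_sub h0 hσ1 hv
  obtain ⟨C, -, hC⟩ := exists_trace_le hσ hσ1
  have hfm := fun n => memLp_comp_edgePt (hψ n).continuous e
  set f : ℕ → Lp ℝ 2 μI := fun n => (hfm n).toLp _ with hf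
  have hcau : CauchySeq f := by
    refine cauchySeq_of_edist_le_add (a := fun n => C * (2 * normH σ (fun x => ψ n x - v x)))
      (fun n m => ?_) ?_
    · rw [hf, Lp.edist_toLp_toLp]
      refine (hC (fun x => ψ n x - ψ m x)
        ((contDiff_one_of_infty (hψ n)).sub (contDiff_one_of_infty (hψ m))) e).trans ?_
      rw [← mul_add, ← mul_add]
      gcongr
      have e2 : (fun x => ψ n x - ψ m x) = fun x => (ψ n x - v x) - (ψ m x - v x) := by
        ext x; ring
      rw [e2]
      exact normH_sub_le h0 hσ1 ((memLp_of_continuous (hψ n).continuous).sub hm)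
        ((memLp_of_continuous (hψ m).continuous).sub hm)
    · have h1 := ENNReal.Tendsto.const_mul (a := 2) hψv (Or.inr (by simp))
      simpa using ENNReal.Tendsto.const_mul (a := C) h1 (Or.inr (by simp))
  obtain ⟨T, hT⟩ := cauchySeq_tendsto_of_complete hcau
  refine ⟨T, Lp.memLp T, σ, hσ, hσ1, ψ, hψ, hψv, ?_⟩
  rw [Lp.tendsto_Lp_iff_tendsto_eLpNorm'] at hT
  refine hT.congr fun n => eLpNorm_congr_ae ?_
  filter_upwards [(hfm n).coeFn_toLp] with t ht
  rw [Pi.sub_apply, hf, ht]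

/-- The trace operator is bounded on `H^σ(Q)`, `1/2 < σ < 1`. -/
lemma exists_isTrace_le (hσ : 1 / 2 < σ) (hσ1 : σ < 1) :
    ∃ C : ℝ≥0, 0 < C ∧ ∀ v e T, IsTrace v e T → eLpNorm T 2 μI ≤ C * normH σ v := by
  have h0 : 0 < σ := by linarith
  obtain ⟨C, hC0, hC⟩ := exists_trace_le hσ hσ1
  refine ⟨C * 2, by positivity, fun v e T hT => ?_⟩
  by_cases hv : normH σ v = ⊤
  · rw [hv, ENNReal.mul_top (by simpa using hC0.ne')]
    exact le_top
  have hv' := lt_top_iff_ne_top.2 hv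
  have hm := memLp_of_normH_lt_top hv'
  set ψ : ℕ → ℝ × ℝ → ℝ := fun n => Sm (rs n) v with hψdef
  have hψ : ∀ n, ContDiff ℝ ∞ (ψ n) := fun n => contDiff_Sm (rs_lt_one n) hm
  have hψv : Tendsto (fun n => normH σ (fun x => ψ n x - v x)) atTop (𝓝 0) :=
    tendsto_normH_Sm_sub h0 hσ1 hv'
  have h1 := hT.tendsto hσ hσ1 hψ hψv
  have h2 := (ENNReal.Tendsto.const_mul (a := C * 2) (hψv.add_const (normH σ v))
    (Or.inr (by finiteness))).add h1
  rw [zero_add, add_zero] at h2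
  push_cast
  refine ge_of_tendsto' h2 fun n => ?_
  have m2 := memLp_comp_edgePt (hψ n).continuous e
  have e1 : T = (fun t => ψ n (edgePt e t)) - fun t => ψ n (edgePt e t) - T t := by
    ext t; simp
  calc eLpNorm T 2 μI ≤ eLpNorm (fun t => ψ n (edgePt e t)) 2 μI +
        eLpNorm (fun t => ψ n (edgePt e t) - T t) 2 μI := by
        nth_rewrite 1 [e1]
        exact eLpNorm_sub_le m2.1 (m2.sub hT.1).1 (by norm_num)
    _ ≤ C * normH σ (ψ n) + eLpNorm (fun t => ψ n (edgePt e t) - T t) 2 μI := by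
        gcongr
        exact hC _ (contDiff_one_of_infty (hψ n)) e
    _ ≤ _ := by
        rw [mul_assoc]
        gcongr
        have e2 : ψ n = fun x => (ψ n x - v x) + v x := by ext x; simp
        nth_rewrite 1 [e2]
        exact normH_add_le h0 hσ1 ((memLp_of_continuous (hψ n).continuous).sub hm) hm

end

/-! ### Riesz kernels, and fractional energies bounded by gradients. -/

section

/-- Euclidean norm in the plane. -/
noncomputable def eNorm2 (z : ℝ × ℝ) : ℝ := √(z.1 ^ 2 + z.2 ^ 2)

lemma euclDist_eq (x y : ℝ × ℝ) : euclDist x y = eNorm2 (y - x) := by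
  simp only [euclDist, eNorm2, Prod.fst_sub, Prod.snd_sub]
  congr 1
  ring

lemma measurable_eNorm2 : Measurable eNorm2 := by
  have : Continuous eNorm2 := by unfold eNorm2; fun_prop
  exact this.measurable

lemma eNorm2_nonneg (z : ℝ × ℝ) : 0 ≤ eNorm2 z := Real.sqrt_nonneg _

/-- The square `[-1,1]²` of differences. -/
def Dsq : Set (ℝ × ℝ) := Icc (-1) 1 ×ˢ Icc (-1) 1

lemma lintegral_rpow_lt_top {b : ℝ} (hb : b < 1) :
    ∫⁻ t in Ioc (0 : ℝ) 1, ENNReal.ofReal (t ^ (-b)) < ⊤ := by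
  have h : IntervalIntegrable (fun t : ℝ => t ^ (-b)) volume 0 1 :=
    intervalIntegral.intervalIntegrable_rpow' (by linarith)
  rw [intervalIntegrable_iff_integrableOn_Ioc_of_le zero_le_one] at h
  have h2 := h.2
  refine lt_of_le_of_lt (lintegral_mono fun t => ?_) h2
  exact Real.ofReal_le_enorm _

lemma lintegral_abs_rpow_lt_top {b : ℝ} (hb : b < 1) :
    ∫⁻ t in Icc (-1 : ℝ) 1, ENNReal.ofReal (|t| ^ (-b)) < ⊤ := by
  have h := lintegral_rpow_lt_top hb
  have hpos : ∫⁻ t in Ioc (0 : ℝ) 1, ENNReal.ofReal (|t| ^ (-b)) =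
      ∫⁻ t in Ioc (0 : ℝ) 1, ENNReal.ofReal (t ^ (-b)) :=
    setLIntegral_congr_fun measurableSet_Ioc fun t ht => by rw [abs_of_pos ht.1]
  have hneg : ∫⁻ t in Ico (-1 : ℝ) 0, ENNReal.ofReal (|t| ^ (-b)) =
      ∫⁻ t in Ioc (0 : ℝ) 1, ENNReal.ofReal (|t| ^ (-b)) := by
    have hm := Measure.measurePreserving_neg (volume : Measure ℝ)
    have := hm.setLIntegral_comp_preimage_emb (MeasurableEquiv.neg ℝ).measurableEmbedding
      (fun t => ENNReal.ofReal (|t| ^ (-b))) (Ioc 0 1)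
    simpa using this
  have hsub : Icc (-1 : ℝ) 1 ⊆ Ico (-1) 0 ∪ {0} ∪ Ioc 0 1 := by
    intro t ht
    rcases lt_trichotomy t 0 with h0 | h0 | h0
    · exact Or.inl (Or.inl ⟨ht.1, h0⟩)
    · exact Or.inl (Or.inr h0)
    · exact Or.inr ⟨h0, ht.2⟩
  refine (lintegral_mono_set hsub).trans_lt ((lintegral_union_le _ _ _).trans_lt ?_)
  refine ENNReal.add_lt_top.2 ⟨(lintegral_union_le _ _ _).trans_lt ?_, by rwa [hpos]⟩
  refine ENNReal.add_lt_top.2 ⟨by rwa [hneg, hpos], ?_⟩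
  simp

lemma ae_fst_ne_zero : ∀ᵐ z : ℝ × ℝ, z.1 ≠ 0 := by
  have h : ∀ᵐ t : ℝ, t ≠ 0 := by simp [ae_iff]
  exact Measure.quasiMeasurePreserving_fst.ae h

lemma ae_snd_ne_zero : ∀ᵐ z : ℝ × ℝ, z.2 ≠ 0 := by
  have h : ∀ᵐ t : ℝ, t ≠ 0 := by simp [ae_iff]
  exact Measure.quasiMeasurePreserving_snd.ae h

/-- Since |z₁||z₂| ≤ |z|², the singular kernel is dominated by a product of one-variable powers of
exponent -a/2. This yields integrability for a < 2 without polar coordinates. -/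
lemma inv_eNorm2_rpow_le {a : ℝ} (ha : 0 ≤ a) {z : ℝ × ℝ} (h1 : z.1 ≠ 0) (h2 : z.2 ≠ 0) :
    (eNorm2 z ^ a)⁻¹ ≤ |z.1| ^ (-(a / 2)) * |z.2| ^ (-(a / 2)) := by
  have p1 := abs_pos.2 h1
  have p2 := abs_pos.2 h2
  rw [Real.rpow_neg p1.le, Real.rpow_neg p2.le, ← mul_inv,
    ← Real.mul_rpow p1.le p2.le]
  have hle : |z.1| * |z.2| ≤ eNorm2 z ^ (2 : ℝ) := by
    rw [Real.rpow_two, eNorm2, Real.sq_sqrt (by positivity)]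
    nlinarith [sq_nonneg (|z.1| - |z.2|), sq_abs z.1, sq_abs z.2]
  have e : eNorm2 z ^ a = (eNorm2 z ^ (2 : ℝ)) ^ (a / 2) := by
    rw [← Real.rpow_mul (eNorm2_nonneg z)]; ring_nf
  rw [e]
  exact inv_anti₀ (by positivity) (Real.rpow_le_rpow (by positivity) hle (by positivity))

/-- The integral of `|z|^{-a}` over `[-1,1]²`. -/
noncomputable def rieszInt (a : ℝ) : ℝ≥0∞ := ∫⁻ z in Dsq, ENNReal.ofReal ((eNorm2 z ^ a)⁻¹)

lemma rieszInt_lt_top {a : ℝ} (h0 : 0 ≤ a) (ha : a < 2) : rieszInt a < ⊤ := by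
  have h := lintegral_abs_rpow_lt_top (b := a / 2) (by linarith)
  have h2 : rieszInt a ≤ ∫⁻ z in Dsq,
      ENNReal.ofReal (|z.1| ^ (-(a / 2))) * ENNReal.ofReal (|z.2| ^ (-(a / 2))) := by
    refine lintegral_mono_ae (ae_restrict_of_ae ?_)
    filter_upwards [ae_fst_ne_zero, ae_snd_ne_zero] with z h1 h2
    rw [← ENNReal.ofReal_mul (by positivity)]
    exact ENNReal.ofReal_le_ofReal (inv_eNorm2_rpow_le h0 h1 h2)
  refine h2.trans_lt ?_
  have e : (volume.restrict Dsq : Measure (ℝ × ℝ)) =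
      (volume.restrict (Icc (-1) 1)).prod (volume.restrict (Icc (-1) 1)) := by
    rw [Measure.prod_restrict]; rfl
  have hm : Measurable fun t : ℝ => ENNReal.ofReal (|t| ^ (-(a / 2))) := by fun_prop
  rw [e, lintegral_prod_mul hm.aemeasurable hm.aemeasurable]
  exact ENNReal.mul_lt_top h h

lemma setLIntegral_Q_sub_le {x : ℝ × ℝ} (hx : x ∈ Q) (G : ℝ × ℝ → ℝ≥0∞) :
    ∫⁻ y, G (y - x) ∂μQ ≤ ∫⁻ z in Dsq, G z := by
  have hD : MeasurableSet Dsq := measurableSet_Icc.prod measurableSet_Icc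
  rw [μQ, ← lintegral_indicator measurableSet_Q, ← lintegral_indicator hD,
    ← lintegral_sub_right_eq_self (Dsq.indicator G) x]
  refine lintegral_mono fun y => ?_
  by_cases hy : y ∈ Q
  · have : y - x ∈ Dsq := by
      obtain ⟨⟨a1, a2⟩, a3, a4⟩ := hx
      obtain ⟨⟨b1, b2⟩, b3, b4⟩ := hy
      exact ⟨⟨by simp; linarith, by simp; linarith⟩, ⟨by simp; linarith, by simp; linarith⟩⟩
    rw [indicator_of_mem hy, indicator_of_mem this]
  · rw [indicator_of_notMem hy]
    exact zero_le

variable {σ : ℝ} {ψ : ℝ × ℝ → ℝ}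

/-- The squared norm of the gradient, set to zero outside `Q`. -/
noncomputable def gradSq (ψ : ℝ × ℝ → ℝ) : ℝ × ℝ → ℝ≥0∞ :=
  Q.indicator fun x => ENNReal.ofReal (pd 0 ψ x ^ 2 + pd 1 ψ x ^ 2)

lemma measurable_gradSq (hψ : ContDiff ℝ 1 ψ) : Measurable (gradSq ψ) := by
  refine Measurable.indicator ?_ measurableSet_Q
  exact (((continuous_pd hψ 0).pow 2).add ((continuous_pd hψ 1).pow 2)).measurable.ennreal_ofReal

lemma fderiv_apply_eq (ψ : ℝ × ℝ → ℝ) (x z : ℝ × ℝ) :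
    fderiv ℝ ψ x z = z.1 * pd 0 ψ x + z.2 * pd 1 ψ x := by
  have : z = z.1 • ((1 : ℝ), (0 : ℝ)) + z.2 • ((0 : ℝ), (1 : ℝ)) := by ext <;> simp
  conv_lhs => rw [this]
  rw [map_add, map_smul, map_smul]
  rfl

/-- The fundamental theorem of calculus along the segment from x to y, with Cauchy-Schwarz; cutting
the gradient off outside Q costs nothing because the segment stays in Q. -/
lemma enorm_sub_sq_le (hψ : ContDiff ℝ 1 ψ) {x y : ℝ × ℝ} (hx : x ∈ Q) (hy : y ∈ Q) :
    ‖ψ x - ψ y‖ₑ ^ 2 ≤ ENNReal.ofReal (eNorm2 (y - x) ^ 2) *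
      ∫⁻ t in Ioc (0 : ℝ) 1, gradSq ψ (x + t • (y - x)) := by
  set z := y - x with hz
  have hd : ∀ t : ℝ, HasDerivAt (fun t : ℝ => ψ (x + t • z)) (fderiv ℝ ψ (x + t • z) z) t := by
    intro t
    have h1 : HasDerivAt (fun t : ℝ => x + t • z) z t := by
      simpa using ((hasDerivAt_id t).smul_const z).const_add x
    exact ((hψ.differentiable one_ne_zero) _).hasFDerivAt.comp_hasDerivAt t h1
  have hc : Continuous (fun t : ℝ => fderiv ℝ ψ (x + t • z) z) := by
    have := hψ.continuous_fderiv one_ne_zero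
    fun_prop
  have h := intervalIntegral.integral_eq_sub_of_hasDerivAt (fun t _ => hd t)
    (hc.intervalIntegrable 0 1)
  simp only [one_smul, zero_smul, add_zero] at h
  rw [intervalIntegral.integral_of_le zero_le_one] at h
  have e : ψ y - ψ x = ∫ t in Ioc (0 : ℝ) 1, fderiv ℝ ψ (x + t • z) z := by
    rw [h, hz, add_sub_cancel]
  have hconv : Convex ℝ Q := (convex_Ioo 0 1).prod (convex_Ioo 0 1)
  rw [← enorm_neg, neg_sub, e, ← lintegral_const_mul' _ _ ENNReal.ofReal_ne_top]
  refine (pow_le_pow_left' (enorm_integral_le_lintegral_enorm _) 2).trans ?_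
  refine (lintegral_sq_le _ hc.enorm.aemeasurable).trans ?_
  simp only [Measure.restrict_apply_univ, Real.volume_Ioc, sub_zero, ENNReal.ofReal_one, one_mul]
  refine setLIntegral_mono' measurableSet_Ioc fun t ht => ?_
  have hmem : x + t • z ∈ Q := by
    have := hconv hx hy (sub_nonneg.2 ht.2) ht.1.le (by ring)
    have e2 : x + t • z = (1 - t) • x + t • y := by rw [hz]; module
    rwa [e2]
  rw [gradSq, indicator_of_mem hmem, ← ENNReal.ofReal_mul (by positivity),
    Real.enorm_eq_ofReal_abs, ← ENNReal.ofReal_pow (abs_nonneg _), sq_abs]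
  refine ENNReal.ofReal_le_ofReal ?_
  rw [fderiv_apply_eq, eNorm2, Real.sq_sqrt (by positivity)]
  nlinarith [sq_nonneg (z.1 * pd 1 ψ (x + t • z) - z.2 * pd 0 ψ (x + t • z))]

/-- In the variable z = y - x, the factor |z|² gained from the gradient reduces the kernel to
|z|^(-2σ). Each translate of the cut-off gradient has the same integral over the plane, so the two
integrations separate. -/
lemma gagliardoSq_le_gradSq (hψ : ContDiff ℝ 1 ψ) :
    gagliardoSq σ ψ ≤ rieszInt (2 * σ) * ∫⁻ x, gradSq ψ x := by
  have hm := measurable_gradSq hψ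
  set wt : ℝ × ℝ → ℝ≥0∞ := fun z => ENNReal.ofReal ((eNorm2 z ^ (2 * σ))⁻¹) with hwt
  have hwm : Measurable wt := (measurable_eNorm2.pow_const _).inv.ennreal_ofReal
  have h1 : gagliardoSq σ ψ ≤ ∫⁻ x, ∫⁻ y,
      wt (y - x) * (∫⁻ t in Ioc (0 : ℝ) 1, gradSq ψ (x + t • (y - x))) ∂μQ ∂μQ := by
    refine lintegral_mono_ae ?_
    filter_upwards [ae_restrict_mem measurableSet_Q] with x hx
    refine lintegral_mono_ae ?_
    filter_upwards [ae_restrict_mem measurableSet_Q] with y hy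
    rw [euclDist_eq]
    rcases (eNorm2_nonneg (y - x)).eq_or_lt with h0 | h0
    · have : x = y := euclDist_eq_zero (by rw [euclDist_eq, ← h0])
      simp [this]
    have e : ENNReal.ofReal (|ψ x - ψ y| ^ 2 / eNorm2 (y - x) ^ (2 + 2 * σ)) =
        ENNReal.ofReal ((eNorm2 (y - x) ^ (2 + 2 * σ))⁻¹) * ‖ψ x - ψ y‖ₑ ^ 2 := by
      rw [Real.enorm_eq_ofReal_abs, ← ENNReal.ofReal_pow (abs_nonneg _),
        ← ENNReal.ofReal_mul (by positivity), div_eq_inv_mul]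
    have e2 : wt (y - x) = ENNReal.ofReal ((eNorm2 (y - x) ^ (2 + 2 * σ))⁻¹) *
        ENNReal.ofReal (eNorm2 (y - x) ^ 2) := by
      rw [← ENNReal.ofReal_mul (by positivity), hwt, Real.rpow_add h0, Real.rpow_two]
      field_simp
    rw [e, e2, mul_assoc]
    gcongr
    exact enorm_sub_sq_le hψ hx hy
  have hmx : Measurable fun p : (ℝ × ℝ) × (ℝ × ℝ) =>
      wt p.2 * ∫⁻ t in Ioc (0 : ℝ) 1, gradSq ψ (p.1 + t • p.2) := by
    refine (hwm.comp measurable_snd).mul ?_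
    refine Measurable.lintegral_prod_right' (f := fun q : ((ℝ × ℝ) × (ℝ × ℝ)) × ℝ =>
      gradSq ψ (q.1.1 + q.2 • q.1.2)) ?_
    fun_prop
  calc gagliardoSq σ ψ ≤ _ := h1
    _ ≤ ∫⁻ x, (∫⁻ z in Dsq, wt z * ∫⁻ t in Ioc (0 : ℝ) 1, gradSq ψ (x + t • z)) ∂μQ := by
        refine lintegral_mono_ae ?_
        filter_upwards [ae_restrict_mem measurableSet_Q] with x hx
        exact setLIntegral_Q_sub_le hx
          (fun z => wt z * ∫⁻ t in Ioc (0 : ℝ) 1, gradSq ψ (x + t • z))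
    _ = ∫⁻ z in Dsq, (∫⁻ x, (wt z * ∫⁻ t in Ioc (0 : ℝ) 1, gradSq ψ (x + t • z)) ∂μQ) :=
        lintegral_lintegral_swap hmx.aemeasurable
    _ ≤ ∫⁻ z in Dsq, wt z * ∫⁻ x, gradSq ψ x := by
        refine lintegral_mono fun z => ?_
        rw [lintegral_const_mul' _ _ (by simp [hwt])]
        refine mul_le_mul' le_rfl ?_
        have hmt : Measurable fun p : (ℝ × ℝ) × ℝ => gradSq ψ (p.1 + p.2 • z) := by fun_prop
        rw [lintegral_lintegral_swap hmt.aemeasurable]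
        calc _ ≤ ∫⁻ t in Ioc (0 : ℝ) 1, ∫⁻ x, gradSq ψ x := by
              refine lintegral_mono fun t => ?_
              rw [← lintegral_add_right_eq_self (gradSq ψ) (t • z)]
              exact setLIntegral_le_lintegral _ _
          _ = _ := by simp
    _ = _ := lintegral_mul_const _ hwm

end

/-! ### Embedding of H^s into H^σ with 1/2 < σ < 1. -/

section

variable {σ : ℝ} {v : ℝ × ℝ → ℝ}

/-- Fatou's lemma, applied once in each variable. -/
lemma gagliardoSq_le_of_tendsto_ae {ψ : ℕ → ℝ × ℝ → ℝ} (hψ : ∀ n, Continuous (ψ n))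
    (h : ∀ᵐ x ∂μQ, Tendsto (fun n => ψ n x) atTop (𝓝 (v x))) :
    gagliardoSq σ v ≤ liminf (fun n => gagliardoSq σ (ψ n)) atTop := by
  have hm : ∀ n, Measurable fun p : (ℝ × ℝ) × (ℝ × ℝ) =>
      ENNReal.ofReal (|ψ n p.1 - ψ n p.2| ^ 2 / euclDist p.1 p.2 ^ (2 + 2 * σ)) := by
    intro n
    have h1 : Measurable (ψ n) := (hψ n).measurable
    have h2 : Measurable fun p : (ℝ × ℝ) × (ℝ × ℝ) => euclDist p.1 p.2 := by
      simp only [euclDist_eq]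
      exact measurable_eNorm2.comp (measurable_snd.sub measurable_fst)
    refine Measurable.ennreal_ofReal (Measurable.div ?_ (h2.pow_const _))
    simp only [sq_abs]
    fun_prop
  have e : gagliardoSq σ v = ∫⁻ x, ∫⁻ y, liminf (fun n => ENNReal.ofReal
      (|ψ n x - ψ n y| ^ 2 / euclDist x y ^ (2 + 2 * σ))) atTop ∂μQ ∂μQ := by
    refine lintegral_congr_ae ?_
    filter_upwards [h] with x hx
    refine lintegral_congr_ae ?_
    filter_upwards [h] with y hy
    refine (Tendsto.liminf_eq ?_).symm
    exact ENNReal.tendsto_ofReal ((((hx.sub hy).abs).pow 2).div_const _)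
  rw [e]
  calc _ ≤ ∫⁻ x, liminf (fun n => ∫⁻ y, ENNReal.ofReal
      (|ψ n x - ψ n y| ^ 2 / euclDist x y ^ (2 + 2 * σ)) ∂μQ) atTop ∂μQ :=
        lintegral_mono fun x => lintegral_liminf_le fun n =>
          (hm n).comp (measurable_const.prodMk measurable_id)
    _ ≤ _ := lintegral_liminf_le fun n => (hm n).lintegral_prod_right'

lemma Sm_zero (r : ℝ) (x : ℝ × ℝ) : Sm r 0 x = 0 := by
  simp [Sm]

/-- A weak partial derivative of v is the weak divergence of the field (v, 0) or (0, v), so the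
commutation rule for divergences applies. -/
lemma pd_Sm_of_isWeakDeriv {g : Fin 2 → ℝ × ℝ → ℝ} (hv : MemLp v 2 μQ)
    (hg : ∀ i, MemLp (g i) 2 μQ) (h0 : IsWeakDeriv (1, 0) v (g 0)) (h1 : IsWeakDeriv (0, 1) v (g 1))
    (i : Fin 2) {r : ℝ} (hr0 : 0 < r) (hr1 : r < 1) {x : ℝ × ℝ} (hx : x ∈ Q) :
    pd i (Sm r v) x = r * Sm r (g i) x := by
  have hz : MemLp (0 : ℝ × ℝ → ℝ) 2 μQ := MemLp.zero
  have hp : ∀ i x, pd i (Sm r 0) x = 0 := by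
    intro i x
    have : Sm r 0 = fun _ => 0 := funext (Sm_zero r)
    simp [pd, this]
  fin_cases i
  · have hd : HasWeakDiv ![v, 0] (g 0) := by
      refine ⟨hg 0, fun φ hφ => ?_⟩
      simpa [pdPow] using h0 φ hφ
    have := sum_pd_Sm hr0 hr1 (u := ![v, 0]) (by intro i; fin_cases i <;> assumption) hd hx
    simpa [hp] using this
  · have hd : HasWeakDiv ![0, v] (g 1) := by
      refine ⟨hg 1, fun φ hφ => ?_⟩
      simpa [pdPow] using h1 φ hφ
    have := sum_pd_Sm hr0 hr1 (u := ![0, v]) (by intro i; fin_cases i <;> assumption) hd hx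
    simpa [hp] using this

lemma tendsto_normL2_Sm (hv : MemLp v 2 μQ) :
    Tendsto (fun n => normL2 (Sm (rs n) v)) atTop (𝓝 (normL2 v)) := by
  have h := tendsto_normL2_Sm_sub hv
  have hmS : ∀ n, MemLp (Sm (rs n) v) 2 μQ := fun n =>
    memLp_of_continuous (contDiff_Sm (rs_lt_one n) hv).continuous
  have hup : ∀ n, normL2 (Sm (rs n) v) ≤ normL2 v + normL2 (fun x => Sm (rs n) v x - v x) := by
    intro n
    have := eLpNorm_add_le (μ := μQ) (p := 2) hv.1 ((hmS n).sub hv).1 one_le_two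
    have e : v + (Sm (rs n) v - v) = Sm (rs n) v := by abel
    rw [e] at this
    exact this
  have hlo : ∀ n, normL2 v - normL2 (fun x => Sm (rs n) v x - v x) ≤ normL2 (Sm (rs n) v) := by
    intro n
    rw [tsub_le_iff_right]
    have := eLpNorm_sub_le (μ := μQ) (p := 2) (hmS n).1 ((hmS n).sub hv).1 one_le_two
    have e : Sm (rs n) v - (Sm (rs n) v - v) = v := by abel
    rw [e] at this
    exact this
  refine tendsto_of_tendsto_of_tendsto_of_le_of_le ?_ ?_ hlo hup
  · simpa [normL2] using ENNReal.Tendsto.sub tendsto_const_nhds h (Or.inl hv.2.ne)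
  · simpa using tendsto_const_nhds.add h

/-- The gradient bound holds for the smoothings, whose derivatives are r times smoothed weak
derivatives with r < 1. A subsequence converges almost everywhere, and lower semicontinuity passes
the bound to v. -/
lemma gagliardoSq_le_of_isWeakDeriv {g : Fin 2 → ℝ × ℝ → ℝ} (hv : MemLp v 2 μQ)
    (hg : ∀ i, MemLp (g i) 2 μQ) (h0 : IsWeakDeriv (1, 0) v (g 0))
    (h1 : IsWeakDeriv (0, 1) v (g 1)) (hσ0 : 0 ≤ σ) (hσ1 : σ < 1) :
    gagliardoSq σ v ≤ rieszInt (2 * σ) * (normL2 (g 0) ^ 2 + normL2 (g 1) ^ 2) := by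
  have hR : rieszInt (2 * σ) ≠ ⊤ := (rieszInt_lt_top (by linarith) (by linarith)).ne
  have hc : ∀ n, ContDiff ℝ ∞ (Sm (rs n) v) := fun n => contDiff_Sm (rs_lt_one n) hv
  have hmeas : TendstoInMeasure μQ (fun n => Sm (rs n) v) atTop v :=
    tendstoInMeasure_of_tendsto_eLpNorm two_ne_zero (fun n => (hc n).continuous.aestronglyMeasurable)
      hv.1 (tendsto_normL2_Sm_sub hv)
  obtain ⟨ns, hns, hae⟩ := hmeas.exists_seq_tendsto_ae
  refine (gagliardoSq_le_of_tendsto_ae (fun n => (hc (ns n)).continuous) hae).trans ?_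
  have hb : ∀ n, gagliardoSq σ (Sm (rs (ns n)) v) ≤ rieszInt (2 * σ) *
      (normL2 (Sm (rs (ns n)) (g 0)) ^ 2 + normL2 (Sm (rs (ns n)) (g 1)) ^ 2) := by
    intro n
    refine (gagliardoSq_le_gradSq (contDiff_one_of_infty (hc _))).trans ?_
    refine mul_le_mul' le_rfl ?_
    have hS : ∀ i, Measurable fun x => ‖Sm (rs (ns n)) (g i) x‖ₑ ^ 2 := fun i =>
      ((contDiff_Sm (rs_lt_one _) (hg i)).continuous.measurable.enorm).pow_const 2
    rw [normL2, normL2, eLpNorm_two_sq, eLpNorm_two_sq, ← lintegral_add_left (hS 0), gradSq,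
      lintegral_indicator measurableSet_Q]
    refine setLIntegral_mono' measurableSet_Q fun x hx => ?_
    have hr0 := rs_pos (ns n)
    have hr1 := rs_lt_one (ns n)
    rw [pd_Sm_of_isWeakDeriv hv hg h0 h1 0 hr0 hr1 hx, pd_Sm_of_isWeakDeriv hv hg h0 h1 1 hr0 hr1 hx,
      ENNReal.ofReal_add (sq_nonneg _) (sq_nonneg _)]
    have key : ∀ a : ℝ, ENNReal.ofReal ((rs (ns n) * a) ^ 2) ≤ ‖a‖ₑ ^ 2 := by
      intro a
      rw [Real.enorm_eq_ofReal_abs, ← ENNReal.ofReal_pow (abs_nonneg _), sq_abs, mul_pow]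
      refine ENNReal.ofReal_le_ofReal ?_
      exact mul_le_of_le_one_left (sq_nonneg _) (pow_le_one₀ hr0.le hr1.le)
    exact add_le_add (key _) (key _)
  refine (liminf_le_liminf (Eventually.of_forall hb)).trans (le_of_eq (Tendsto.liminf_eq ?_))
  have ht : ∀ i, Tendsto (fun n => normL2 (Sm (rs (ns n)) (g i)) ^ 2) atTop (𝓝 (normL2 (g i) ^ 2)) :=
    fun i => ((ENNReal.continuous_pow 2).tendsto _).comp
      ((tendsto_normL2_Sm (hg i)).comp hns.tendsto_atTop)
  exact ENNReal.Tendsto.const_mul ((ht 0).add (ht 1)) (Or.inr hR)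

/-- For `s > 1/2` the space `H^s(Q)` embeds into some `H^σ(Q)` with `1/2 < σ < 1`. -/
lemma exists_normH_le {s : ℝ} (hs : 1 / 2 < s) : ∃ σ : ℝ, 1 / 2 < σ ∧ σ < 1 ∧
    ∃ C : ℝ≥0, ∀ v, normH s v < ⊤ → normH σ v ≤ C * normH s v := by
  rcases lt_or_ge s 1 with h1 | h1
  · exact ⟨s, hs, h1, 1, fun v _ => by simp⟩
  have hR : rieszInt (2 * (3 / 4)) < ⊤ := rieszInt_lt_top (by norm_num) (by norm_num)
  obtain ⟨K, hK⟩ : ∃ K : ℝ≥0, (K : ℝ≥0∞) = rieszInt (2 * (3 / 4)) :=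
    ⟨_, ENNReal.coe_toNNReal hR.ne⟩
  -- When s ≥ 1 any exponent strictly between 1/2 and 1 would do.
  refine ⟨3 / 4, by norm_num, by norm_num, (1 + K) ^ (1 / 2 : ℝ), fun v hv => ?_⟩
  have hm := memLp_of_normH_lt_top hv
  have hfl : 1 ≤ ⌊s⌋₊ := Nat.one_le_floor_iff s |>.2 h1
  have hC0 : (((1 + K) ^ (1 / 2 : ℝ) : ℝ≥0) : ℝ≥0∞) ≠ 0 := by
    simp
  -- The constant is moved to the left so that the right-hand side is the bare infimum, and the
  -- bound can be checked for each family of weak derivatives.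
  rw [← ENNReal.div_le_iff' hC0 ENNReal.coe_ne_top]
  refine le_iInf₂ fun g hg => ?_
  rw [ENNReal.div_le_iff' hC0 ENNReal.coe_ne_top, normH_eq (by norm_num) (by norm_num) hm,
    ENNReal.coe_rpow_of_nonneg _ (by norm_num), ← ENNReal.mul_rpow_of_nonneg _ _ (by norm_num)]
  refine ENNReal.rpow_le_rpow ?_ (by norm_num)
  have hgag := gagliardoSq_le_of_isWeakDeriv (σ := 3 / 4) (g := ![g (1, 0), g (0, 1)]) hm
    (by intro i; fin_cases i <;> exact hg.memLp _ (by simpa using hfl))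
    (hg.weak (1, 0) (by simpa using hfl)) (hg.weak (0, 1) (by simpa using hfl))
    (by norm_num) (by norm_num)
  rw [← hK] at hgag
  set S := ∑ k ∈ Finset.range (⌊s⌋₊ + 1),
        ∑ α ∈ Finset.HasAntidiagonal.antidiagonal k, normL2 (g α) ^ 2 with hS
  have hsum : normL2 v ^ 2 + (normL2 (g (1, 0)) ^ 2 + normL2 (g (0, 1)) ^ 2) ≤ S := by
    have : S ≥ ∑ k ∈ Finset.range 2,
        ∑ α ∈ Finset.HasAntidiagonal.antidiagonal k, normL2 (g α) ^ 2 :=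
      Finset.sum_le_sum_of_subset (Finset.range_mono (by omega))
    refine le_trans (le_of_eq ?_) this
    simp [Finset.sum_range_succ, Finset.Nat.antidiagonal_succ, hg.zero]
    ring
  have e1 : normL2 v ^ 2 ≤ S := le_self_add.trans hsum
  have e2 : gagliardoSq (3 / 4) v ≤ K * S := hgag.trans (mul_le_mul' le_rfl (le_add_self.trans hsum))
  calc NQ (3 / 4) v ≤ S + K * S := add_le_add e1 e2
    _ = (1 + K : ℝ≥0) * S := by push_cast; ring
    _ ≤ _ := mul_le_mul' le_rfl le_self_add

end

/-! ### Raviart-Thomas fields and part (i). -/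

section

/-- The two edges whose normal is parallel to the coordinate direction `l`. -/
def normalEdge (l : Fin 2) (k : Fin 2) : Fin 4 := (![![3, 1], ![0, 2]] : Fin 2 → Fin 2 → Fin 4) l k

lemma edgeFlux_RT0 (a b c d : ℝ) (e : Fin 4) :
    edgeFlux ![fun x => a + c * x.1, fun x => b + d * x.2] e = ![-b, a + c, b + d, -a] e := by
  fin_cases e <;> simp [edgeFlux, edgePt, normal]

lemma exists_mem_RT0 (F : Fin 4 → ℝ) : ∃ P ∈ RT0, ∀ e, edgeFlux P e = F e := by
  -- The coefficients solve -b = F 0, a + c = F 1, b + d = F 2, -a = F 3.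
  refine ⟨_, ⟨-F 3, -F 0, F 1 + F 3, F 2 + F 0, rfl⟩, fun e => ?_⟩
  rw [edgeFlux_RT0]
  fin_cases e <;> simp

lemma eq_of_edgeFlux_eq {P P' : Fin 2 → ℝ × ℝ → ℝ} (h : P ∈ RT0) (h' : P' ∈ RT0)
    (he : ∀ e, edgeFlux P e = edgeFlux P' e) : P = P' := by
  obtain ⟨a, b, c, d, rfl⟩ := h
  obtain ⟨a', b', c', d', rfl⟩ := h'
  simp only [edgeFlux_RT0] at he
  have h0 := he 0
  have h1 := he 1
  have h2 := he 2
  have h3 := he 3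
  simp at h0 h1 h2 h3
  subst h0 h3
  obtain rfl : c = c' := by linarith
  obtain rfl : d = d' := by linarith
  rfl

/-- The l-th component depends on x_l alone and is a convex combination of its values on the two
edges normal to l. This decoupling is why the estimate for component l never involves the fluxes
through the other two edges. -/
lemma abs_RT0_le {P : Fin 2 → ℝ × ℝ → ℝ} (h : P ∈ RT0) (l : Fin 2) {x : ℝ × ℝ} (hx : x ∈ Q) :
    |P l x| ≤ |edgeFlux P (normalEdge l 0)| + |edgeFlux P (normalEdge l 1)| := by
  obtain ⟨a, b, c, d, rfl⟩ := h
  have key : ∀ a c t : ℝ, t ∈ Ioo (0 : ℝ) 1 → |a + c * t| ≤ |-a| + |a + c| := by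
    intro a c t ht
    have e : a + c * t = (1 - t) * a + t * (a + c) := by ring
    rw [e, abs_neg]
    refine (abs_add_le _ _).trans ?_
    rw [abs_mul, abs_mul, abs_of_pos ht.1, abs_of_pos (sub_pos.2 ht.2)]
    nlinarith [ht.1, ht.2, abs_nonneg a, abs_nonneg (a + c)]
  simp only [edgeFlux_RT0]
  fin_cases l
  · simpa [normalEdge] using key a c x.1 hx.1
  · simpa [normalEdge] using key b d x.2 hx.2

lemma normL2_RT0_le {P : Fin 2 → ℝ × ℝ → ℝ} (h : P ∈ RT0) (l : Fin 2) :
    normL2 (P l) ≤ ‖edgeFlux P (normalEdge l 0)‖ₑ + ‖edgeFlux P (normalEdge l 1)‖ₑ := by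
  have h1 : normL2 (P l) ≤ eLpNorm
      (fun _ : ℝ × ℝ => |edgeFlux P (normalEdge l 0)| + |edgeFlux P (normalEdge l 1)|) 2 μQ := by
    refine eLpNorm_mono_ae ?_
    filter_upwards [ae_restrict_mem measurableSet_Q] with x hx
    rw [Real.norm_eq_abs, Real.norm_eq_abs]
    exact (abs_RT0_le h l hx).trans (le_abs_self _)
  refine h1.trans (le_of_eq ?_)
  rw [eLpNorm_const _ two_ne_zero (IsProbabilityMeasure.ne_zero μQ)]
  simp only [measure_univ, ENNReal.one_rpow, mul_one]
  rw [Real.enorm_eq_ofReal_abs, abs_of_nonneg (by positivity),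
    ENNReal.ofReal_add (abs_nonneg _) (abs_nonneg _), Real.enorm_eq_ofReal_abs,
    Real.enorm_eq_ofReal_abs]

/-- Existence, uniqueness and stability of the interpolant, for given functionals on the edges. -/
lemma existsUnique_RT0 {R : Fin 4 → ℝ → Prop} (hR : ∀ e, ∃ F, R e F)
    (hu : ∀ e F F', R e F → R e F' → F = F') :
    ∃! P, P ∈ RT0 ∧ ∀ e, R e (edgeFlux P e) := by
  choose F hF using hR
  obtain ⟨P, hP, he⟩ := exists_mem_RT0 F
  refine ⟨P, ⟨hP, fun e => by rw [he]; exact hF e⟩, fun P' hP' => ?_⟩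
  refine eq_of_edgeFlux_eq hP'.1 hP fun e => ?_
  rw [he]
  exact hu e _ _ (hP'.2 e) (hF e)

lemma normL2_RT0_le_of_forall {P : Fin 2 → ℝ × ℝ → ℝ} (h : P ∈ RT0) (l : Fin 2) {B : ℝ≥0∞}
    (hB : ∀ k, ‖edgeFlux P (normalEdge l k)‖ₑ ≤ B) : normL2 (P l) ≤ 2 * B := by
  refine (normL2_RT0_le h l).trans ?_
  rw [two_mul]
  exact add_le_add (hB 0) (hB 1)

/-- On an edge normal to direction l the other component is multiplied by 0, and the edge has unit
length, so the L¹ norm is at most the L² norm. -/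
lemma enorm_traceFlux_le {T : Fin 2 → ℝ → ℝ} (l k : Fin 2) (hT : ∀ i, MemLp (T i) 2 μI) :
    ‖∫ t, (T 0 t * (normal (normalEdge l k)).1 + T 1 t * (normal (normalEdge l k)).2) ∂μI‖ₑ ≤
      eLpNorm (T l) 2 μI := by
  refine (enorm_integral_le_lintegral_enorm _).trans ?_
  have e : ∀ t, ‖T 0 t * (normal (normalEdge l k)).1 + T 1 t * (normal (normalEdge l k)).2‖ₑ =
      ‖T l t‖ₑ := by
    intro t
    fin_cases l <;> fin_cases k <;> simp [normal, normalEdge]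
  simp only [e]
  rw [← eLpNorm_one_eq_lintegral_enorm]
  exact eLpNorm_le_eLpNorm_of_exponent_le one_le_two (hT l).1

/-- Existence and almost everywhere uniqueness of traces make each flux well defined; boundedness of
the trace operator on H^σ, composed with the embedding of H^s, gives the estimate. -/
lemma existsUnique_isRTInterpolant {s : ℝ} (hs : 1 / 2 < s) : ∃ C : ℝ≥0,
    ∀ u : Fin 2 → ℝ × ℝ → ℝ, (∀ i, MemH s (u i)) →
      (∃! P, IsRTInterpolant u P) ∧
      ∀ P, IsRTInterpolant u P → ∀ l : Fin 2, normL2 (P l) ≤ C * normH s (u l) := by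
  obtain ⟨σ, hσ, hσ1, C₁, h₁⟩ := exists_normH_le hs
  obtain ⟨C₂, -, h₂⟩ := exists_isTrace_le hσ hσ1
  refine ⟨2 * (C₂ * C₁), fun u hu => ⟨?_, fun P hP l => ?_⟩⟩
  · refine existsUnique_RT0 (R := IsTraceFlux u) (fun e => ?_) fun e F F' => ?_
    · have : ∀ i, ∃ T, IsTrace (u i) e T := fun i =>
        exists_isTrace hσ hσ1 ((h₁ _ (hu i)).trans_lt (ENNReal.mul_lt_top ENNReal.coe_lt_top (hu i))) e
      choose T hT using this
      exact ⟨_, T, hT, rfl⟩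
    · rintro ⟨T, hT, rfl⟩ ⟨T', hT', rfl⟩
      refine integral_congr_ae ?_
      filter_upwards [(hT 0).ae_eq (hT' 0), (hT 1).ae_eq (hT' 1)] with t h0 h1
      rw [h0, h1]
  · have : ∀ k, ‖edgeFlux P (normalEdge l k)‖ₑ ≤ C₂ * (C₁ * normH s (u l)) := by
      intro k
      obtain ⟨T, hT, e⟩ := hP.2 (normalEdge l k)
      rw [e]
      refine (enorm_traceFlux_le l k fun i => (hT i).1).trans ?_
      exact (h₂ _ _ _ (hT l)).trans (mul_le_mul' le_rfl (h₁ _ (hu l)))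
    refine (normL2_RT0_le_of_forall hP.1 l this).trans (le_of_eq ?_)
    push_cast
    ring

end

/-! ### The corner cutoff and its fractional regularity. -/

section

variable {σ η : ℝ} {x y : ℝ × ℝ}

lemma abs_fst_sub_le_euclDist (x y : ℝ × ℝ) : |x.1 - y.1| ≤ euclDist x y :=
  Real.abs_le_sqrt (by nlinarith [sq_nonneg (x.2 - y.2)])

lemma abs_snd_sub_le_euclDist (x y : ℝ × ℝ) : |x.2 - y.2| ≤ euclDist x y :=
  Real.abs_le_sqrt (by nlinarith [sq_nonneg (x.1 - y.1)])

lemma eNorm2_sq (x : ℝ × ℝ) : eNorm2 x ^ 2 = x.1 ^ 2 + x.2 ^ 2 := Real.sq_sqrt (by positivity)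

lemma eNorm2_pos (hx : x ∈ Q) : 0 < eNorm2 x :=
  Real.sqrt_pos.2 (by have := hx.1.1; positivity)

/-- The (regularized, if `η > 0`) cutoff with trace `1 - t` on the left edge, and `0` on the other
edges. -/
noncomputable def cornerCut (η : ℝ) (x : ℝ × ℝ) : ℝ :=
  (1 - x.1) * (1 - x.2) * (x.2 ^ 2 / (x.1 ^ 2 + x.2 ^ 2 + η))

lemma cornerFrac_mem (hη : 0 ≤ η) (hx : x ∈ Q) :
    x.2 ^ 2 / (x.1 ^ 2 + x.2 ^ 2 + η) ∈ Icc (0 : ℝ) 1 := by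
  have h1 := hx.1.1
  exact ⟨by positivity, (div_le_one (by positivity)).2 (by nlinarith)⟩

lemma cornerCut_mem (hη : 0 ≤ η) (hx : x ∈ Q) : cornerCut η x ∈ Icc (0 : ℝ) 1 := by
  obtain ⟨h0, h1⟩ := cornerFrac_mem hη hx
  obtain ⟨⟨a0, a1⟩, b0, b1⟩ := hx
  refine ⟨mul_nonneg (mul_nonneg (by linarith) (by linarith)) h0, ?_⟩
  exact mul_le_one₀ (mul_le_one₀ (by linarith) (by linarith) (by linarith)) h0 h1

/-- The quotient has gradient of size 1/|y|, uniformly in η. It contributes 9, and the polynomial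
prefactor, whose increment is at most 2|x - y|, contributes 4 because |y| ≤ 2. -/
lemma abs_cornerCut_sub_le_of_le (hη : 0 ≤ η) (hx : x ∈ Q) (hy : y ∈ Q)
    (h : euclDist x y ≤ eNorm2 y) :
    |cornerCut η x - cornerCut η y| ≤ 13 * (euclDist x y / eNorm2 y) := by
  set δ := euclDist x y with hδ
  set ρ := eNorm2 y with hρ
  have hρ0 : 0 < ρ := eNorm2_pos hy
  have hδ0 : 0 ≤ δ := euclDist_nonneg x y
  have h1 : |x.1 - y.1| ≤ δ := abs_fst_sub_le_euclDist x y
  have h2 : |x.2 - y.2| ≤ δ := abs_snd_sub_le_euclDist x y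
  have hρ2 : ρ ^ 2 = y.1 ^ 2 + y.2 ^ 2 := eNorm2_sq y
  obtain ⟨f0, f1⟩ := cornerFrac_mem hη hx
  have hDx : 0 < x.1 ^ 2 + x.2 ^ 2 + η := by have := hx.1.1; positivity
  have hDy : 0 < y.1 ^ 2 + y.2 ^ 2 + η := by have := hy.1.1; positivity
  obtain ⟨⟨x0, x1⟩, x2, x3⟩ := hx
  obtain ⟨⟨y0, y1⟩, y2, y3⟩ := hy
  have hρle : ρ ≤ 2 := by nlinarith
  have hy1 : y.1 ≤ ρ := by nlinarith
  have hy2 : y.2 ≤ ρ := by nlinarith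
  have hsq : ∀ p q : ℝ, 0 < p → 0 < q → |p - q| ≤ δ → q ≤ ρ → |p ^ 2 - q ^ 2| ≤ 3 * ρ * δ := by
    intro p q hp hq hpq hqρ
    have e : p ^ 2 - q ^ 2 = (p - q) * (p + q) := by ring
    rw [e, abs_mul, abs_of_pos (a := p + q) (by positivity), mul_comm]
    have : p ≤ 2 * ρ := by linarith [(abs_le.1 hpq).2]
    exact mul_le_mul (by linarith) hpq (abs_nonneg _) (by positivity)
  set f := x.2 ^ 2 / (x.1 ^ 2 + x.2 ^ 2 + η) with hf
  set f' := y.2 ^ 2 / (y.1 ^ 2 + y.2 ^ 2 + η) with hf'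
  -- Replacing x₂² by f times its own denominator leaves only the denominator at y, so no lower
  -- bound for |x| is needed.
  have ef : f - f' = (f * ((y.1 ^ 2 - x.1 ^ 2) + (y.2 ^ 2 - x.2 ^ 2)) + (x.2 ^ 2 - y.2 ^ 2)) /
      (y.1 ^ 2 + y.2 ^ 2 + η) := by
    rw [hf, hf']
    field_simp
    ring
  have hff : |f - f'| ≤ 9 * (δ / ρ) := by
    rw [ef, abs_div, abs_of_pos hDy, div_le_iff₀ hDy]
    have s1 := hsq x.1 y.1 x0 y0 h1 hy1
    have s2 := hsq x.2 y.2 x2 y2 h2 hy2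
    have t1 : |f * ((y.1 ^ 2 - x.1 ^ 2) + (y.2 ^ 2 - x.2 ^ 2)) + (x.2 ^ 2 - y.2 ^ 2)| ≤
        9 * ρ * δ := by
      refine (abs_add_le _ _).trans ?_
      rw [abs_mul, abs_of_nonneg f0]
      have t2 : |(y.1 ^ 2 - x.1 ^ 2) + (y.2 ^ 2 - x.2 ^ 2)| ≤ 6 * ρ * δ := by
        refine (abs_add_le _ _).trans ?_
        rw [abs_sub_comm (y.1 ^ 2), abs_sub_comm (y.2 ^ 2)]
        linarith
      have t3 := mul_le_of_le_one_left (abs_nonneg ((y.1 ^ 2 - x.1 ^ 2) + (y.2 ^ 2 - x.2 ^ 2))) f1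
      linarith
    refine t1.trans ?_
    have e3 : 9 * ρ * δ = 9 * (δ / ρ) * ρ ^ 2 := by field_simp
    rw [e3]
    exact mul_le_mul_of_nonneg_left (by rw [hρ2]; linarith) (by positivity)
  have eA : cornerCut η x - cornerCut η y = -((x.1 - y.1) * (1 - x.2) + (1 - y.1) * (x.2 - y.2)) * f
      + (1 - y.1) * (1 - y.2) * (f - f') := by
    rw [cornerCut, cornerCut, ← hf, ← hf']
    ring
  have hg : |(x.1 - y.1) * (1 - x.2) + (1 - y.1) * (x.2 - y.2)| ≤ 2 * δ := by
    refine (abs_add_le _ _).trans ?_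
    rw [abs_mul, abs_mul, abs_of_pos (sub_pos.2 x3), abs_of_pos (sub_pos.2 y1)]
    have := mul_le_of_le_one_right (abs_nonneg (x.1 - y.1)) (by linarith : 1 - x.2 ≤ 1)
    have := mul_le_of_le_one_left (abs_nonneg (x.2 - y.2)) (by linarith : 1 - y.1 ≤ 1)
    linarith
  have hδρ : 2 * δ ≤ 4 * (δ / ρ) := by
    rw [← mul_div_assoc, le_div_iff₀ hρ0]
    nlinarith
  rw [eA]
  refine (abs_add_le _ _).trans ?_
  rw [abs_mul, abs_neg, abs_mul, abs_of_nonneg f0,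
    abs_of_nonneg (mul_nonneg (sub_nonneg.2 y1.le) (sub_nonneg.2 y3.le))]
  have q1 := mul_le_of_le_one_right (abs_nonneg ((x.1 - y.1) * (1 - x.2) + (1 - y.1) * (x.2 - y.2))) f1
  have q2 := mul_le_of_le_one_left (abs_nonneg (f - f'))
    (mul_le_one₀ (by linarith : 1 - y.1 ≤ 1) (by linarith) (by linarith : 1 - y.2 ≤ 1))
  linarith

/-- `v` is Hölder continuous with a weight that is singular at the corner `0`. -/
def CornerHolder (K θ : ℝ) (v : ℝ × ℝ → ℝ) : Prop :=
  ∀ x ∈ Q, ∀ y ∈ Q, |v x - v y| ≤ K * (euclDist x y / eNorm2 x) ^ θ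

/-- Near x, relative to the distance from the corner, the Lipschitz bound is weakened by t ≤ t^θ for
t ≤ 1; far away, the values in [0, 1] give the bound trivially. -/
lemma cornerHolder_cornerCut (hη : 0 ≤ η) {θ : ℝ} (h0 : 0 ≤ θ) (h1 : θ ≤ 1) :
    CornerHolder 13 θ (cornerCut η) := by
  intro x hx y hy
  have hc : euclDist x y = euclDist y x := by simp only [euclDist]; congr 1; ring
  have hρ := eNorm2_pos hx
  rw [abs_sub_comm, hc]
  rcases le_or_gt (euclDist y x) (eNorm2 x) with h | h
  · refine (abs_cornerCut_sub_le_of_le hη hy hx h).trans ?_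
    have p0 : 0 ≤ euclDist y x / eNorm2 x := div_nonneg (euclDist_nonneg _ _) hρ.le
    have p1 : euclDist y x / eNorm2 x ≤ 1 := (div_le_one hρ).2 h
    refine mul_le_mul_of_nonneg_left ?_ (by norm_num)
    calc _ = (euclDist y x / eNorm2 x) ^ (1 : ℝ) := (Real.rpow_one _).symm
      _ ≤ _ := Real.rpow_le_rpow_of_exponent_ge_of_imp p0 p1 h1 (by intros; linarith)
  · have p1 : 1 ≤ euclDist y x / eNorm2 x := (one_le_div hρ).2 h.le
    have p2 := Real.one_le_rpow p1 h0
    have m1 := cornerCut_mem hη hx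
    have m2 := cornerCut_mem hη hy
    have : |cornerCut η y - cornerCut η x| ≤ 1 := abs_le.2 ⟨by linarith [m1.2, m2.1], by linarith [m1.1, m2.2]⟩
    linarith

lemma CornerHolder.sub {K K' θ : ℝ} {v w : ℝ × ℝ → ℝ} (hv : CornerHolder K θ v)
    (hw : CornerHolder K' θ w) : CornerHolder (K + K') θ fun x => v x - w x := by
  intro x hx y hy
  have e : v x - w x - (v y - w y) = (v x - v y) - (w x - w y) := by ring
  rw [e, add_mul]
  exact (abs_sub _ _).trans (add_le_add (hv x hx y hy) (hw x hx y hy))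

/-- The majorant for the difference quotients of a `CornerHolder` function. -/
noncomputable def cornerDom (σ θ : ℝ) (p : (ℝ × ℝ) × (ℝ × ℝ)) : ℝ≥0∞ :=
  ENNReal.ofReal ((eNorm2 p.1 ^ (2 * θ))⁻¹) *
    ENNReal.ofReal ((eNorm2 (p.2 - p.1) ^ (2 + 2 * σ - 2 * θ))⁻¹)

lemma measurable_cornerDom (σ θ : ℝ) : Measurable (cornerDom σ θ) := by
  have h1 : Measurable fun p : (ℝ × ℝ) × (ℝ × ℝ) => eNorm2 p.1 := measurable_eNorm2.comp measurable_fst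
  have h2 : Measurable fun p : (ℝ × ℝ) × (ℝ × ℝ) => eNorm2 (p.2 - p.1) :=
    measurable_eNorm2.comp (measurable_snd.sub measurable_fst)
  unfold cornerDom
  fun_prop

lemma lintegral_eNorm2_le (a : ℝ) :
    ∫⁻ x, ENNReal.ofReal ((eNorm2 x ^ a)⁻¹) ∂μQ ≤ rieszInt a := by
  refine lintegral_mono_set ?_
  rintro x ⟨⟨h1, h2⟩, h3, h4⟩
  exact ⟨⟨by linarith, by linarith⟩, ⟨by linarith, by linarith⟩⟩

/-- The majorant splits into |x|^(-2θ) and |y - x|^(-(2+2σ-2θ)), both integrable in the plane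
exactly when σ < θ < 1. The Lipschitz exponent θ = 1 would fail logarithmically at the corner. -/
lemma lintegral_cornerDom_lt_top {θ : ℝ} (h1 : θ < 1) (hσ : σ < θ) (hσ1 : 0 ≤ σ) :
    ∫⁻ p, cornerDom σ θ p ∂(μQ.prod μQ) < ⊤ := by
  rw [lintegral_prod _ (measurable_cornerDom σ θ).aemeasurable]
  calc _ ≤ ∫⁻ x, ENNReal.ofReal ((eNorm2 x ^ (2 * θ))⁻¹) * rieszInt (2 + 2 * σ - 2 * θ) ∂μQ := by
        refine lintegral_mono_ae ?_
        filter_upwards [ae_restrict_mem measurableSet_Q] with x hx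
        simp only [cornerDom]
        rw [lintegral_const_mul' _ _ ENNReal.ofReal_ne_top]
        exact mul_le_mul' le_rfl (setLIntegral_Q_sub_le hx
          fun z => ENNReal.ofReal ((eNorm2 z ^ (2 + 2 * σ - 2 * θ))⁻¹))
    _ ≤ rieszInt (2 * θ) * rieszInt (2 + 2 * σ - 2 * θ) := by
        have hm := measurable_eNorm2
        rw [lintegral_mul_const _ (by fun_prop)]
        exact mul_le_mul' (lintegral_eNorm2_le _) le_rfl
    _ < ⊤ := ENNReal.mul_lt_top (rieszInt_lt_top (by linarith) (by linarith))
        (rieszInt_lt_top (by linarith) (by linarith))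

lemma CornerHolder.quotient_le {K θ : ℝ} {v : ℝ × ℝ → ℝ} (hv : CornerHolder K θ v)
    (hx : x ∈ Q) (hy : y ∈ Q) :
    ENNReal.ofReal (|v x - v y| ^ 2 / euclDist x y ^ (2 + 2 * σ)) ≤
      ENNReal.ofReal (K ^ 2) * cornerDom σ θ (x, y) := by
  rcases (euclDist_nonneg x y).eq_or_lt with h0 | h0
  · rw [euclDist_eq_zero h0.symm]
    simp
  have hρ := eNorm2_pos hx
  rw [cornerDom, ← ENNReal.ofReal_mul (by positivity), ← ENNReal.ofReal_mul (by positivity)]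
  refine ENNReal.ofReal_le_ofReal ?_
  rw [← euclDist_eq, div_le_iff₀ (by positivity)]
  have h := pow_le_pow_left₀ (abs_nonneg _) (hv x hx y hy) 2
  refine h.trans (le_of_eq ?_)
  rw [Real.div_rpow h0.le hρ.le, Real.rpow_sub h0, show 2 * θ = θ + θ by ring, Real.rpow_add hρ,
    Real.rpow_add h0 θ θ]
  have : euclDist x y ^ (2 + 2 * σ) ≠ 0 := by positivity
  generalize euclDist x y ^ θ = d at *
  field_simp

lemma gagliardoSq_eq_prod {v : ℝ × ℝ → ℝ} (hv : Measurable v) :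
    gagliardoSq σ v = ∫⁻ p, ENNReal.ofReal
      (|v p.1 - v p.2| ^ 2 / euclDist p.1 p.2 ^ (2 + 2 * σ)) ∂(μQ.prod μQ) := by
  rw [gagliardoSq_eq, energy_eq_prod hv.aemeasurable (measurable_kerQ σ)]
  rfl

lemma ae_mem_Q_prod : ∀ᵐ p ∂(μQ.prod μQ), p.1 ∈ Q ∧ p.2 ∈ Q := by
  have h : ∀ᵐ x ∂μQ, x ∈ Q := ae_restrict_mem measurableSet_Q
  exact (Measure.quasiMeasurePreserving_fst.ae h).and (Measure.quasiMeasurePreserving_snd.ae h)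

lemma CornerHolder.gagliardoSq_lt_top {K θ : ℝ} {v : ℝ × ℝ → ℝ} (hv : CornerHolder K θ v)
    (hm : Measurable v) (h1 : θ < 1) (hσ : σ < θ) (hσ1 : 0 ≤ σ) :
    gagliardoSq σ v < ⊤ := by
  rw [gagliardoSq_eq_prod hm]
  calc _ ≤ ∫⁻ p, ENNReal.ofReal (K ^ 2) * cornerDom σ θ p ∂(μQ.prod μQ) := by
        refine lintegral_mono_ae ?_
        filter_upwards [ae_mem_Q_prod] with p hp
        exact hv.quotient_le hp.1 hp.2
    _ < ⊤ := by
        rw [lintegral_const_mul' _ _ ENNReal.ofReal_ne_top]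
        exact ENNReal.mul_lt_top ENNReal.ofReal_lt_top (lintegral_cornerDom_lt_top h1 hσ hσ1)

/-- Dominated convergence: the majorant does not depend on n. -/
lemma CornerHolder.tendsto_gagliardoSq {K θ : ℝ} {v : ℕ → ℝ × ℝ → ℝ}
    (hv : ∀ n, CornerHolder K θ (v n)) (hm : ∀ n, Measurable (v n)) (h1 : θ < 1)
    (hσ : σ < θ) (hσ1 : 0 ≤ σ) (hlim : ∀ x ∈ Q, Tendsto (fun n => v n x) atTop (𝓝 0)) :
    Tendsto (fun n => gagliardoSq σ (v n)) atTop (𝓝 0) := by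
  have h2 : Measurable fun p : (ℝ × ℝ) × (ℝ × ℝ) => euclDist p.1 p.2 := by
    simp only [euclDist_eq]
    exact measurable_eNorm2.comp (measurable_snd.sub measurable_fst)
  simp only [gagliardoSq_eq_prod (hm _)]
  have := tendsto_lintegral_of_dominated_convergence (μ := μQ.prod μQ)
    (F := fun n p => ENNReal.ofReal
      (|v n p.1 - v n p.2| ^ 2 / euclDist p.1 p.2 ^ (2 + 2 * σ))) (f := fun _ => 0)
    (fun p => ENNReal.ofReal (K ^ 2) * cornerDom σ θ p) (fun n => ?_) (fun n => ?_) ?_ ?_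
  · simpa using this
  · have := hm n
    refine (Measurable.ennreal_ofReal (Measurable.div ?_ (h2.pow_const _)))
    simp only [sq_abs]
    fun_prop
  · filter_upwards [ae_mem_Q_prod] with p hp
    exact (hv n).quotient_le hp.1 hp.2
  · rw [lintegral_const_mul' _ _ ENNReal.ofReal_ne_top]
    exact (ENNReal.mul_lt_top ENNReal.ofReal_lt_top (lintegral_cornerDom_lt_top h1 hσ hσ1)).ne
  · filter_upwards [ae_mem_Q_prod] with p hp
    have h := (((hlim _ hp.1).sub (hlim _ hp.2)).abs.pow 2).div_const
      (euclDist p.1 p.2 ^ (2 + 2 * σ))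
    simpa using ENNReal.tendsto_ofReal h

lemma measurable_cornerCut (η : ℝ) : Measurable (cornerCut η) := by
  unfold cornerCut
  fun_prop

lemma contDiff_cornerCut (hη : 0 < η) : ContDiff ℝ ∞ (cornerCut η) := by
  unfold cornerCut
  have : ∀ x : ℝ × ℝ, x.1 ^ 2 + x.2 ^ 2 + η ≠ 0 := fun x => by positivity
  fun_prop (disch := assumption)

lemma memLp_of_mem_Icc {v : ℝ × ℝ → ℝ} (hm : Measurable v) (h : ∀ x ∈ Q, v x ∈ Icc (0 : ℝ) 1) :
    MemLp v 2 μQ := by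
  refine MemLp.of_bound hm.aestronglyMeasurable 1 ?_
  filter_upwards [ae_restrict_mem measurableSet_Q] with x hx
  rw [Real.norm_eq_abs, abs_le]
  exact ⟨by linarith [(h x hx).1], (h x hx).2⟩

lemma tendsto_normL2_of_tendsto {v : ℕ → ℝ × ℝ → ℝ} (hm : ∀ n, Measurable (v n)) {M : ℝ}
    (hb : ∀ n, ∀ x ∈ Q, |v n x| ≤ M) (hlim : ∀ x ∈ Q, Tendsto (fun n => v n x) atTop (𝓝 0)) :
    Tendsto (fun n => normL2 (v n) ^ 2) atTop (𝓝 0) := by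
  simp only [normL2, eLpNorm_two_sq]
  have := tendsto_lintegral_of_dominated_convergence (μ := μQ)
    (F := fun n x => ‖v n x‖ₑ ^ 2) (f := fun _ => 0)
    (fun _ => ENNReal.ofReal M ^ 2) (fun n => (hm n).enorm.pow_const 2) (fun n => ?_) ?_ ?_
  · simpa using this
  · filter_upwards [ae_restrict_mem measurableSet_Q] with x hx
    rw [Real.enorm_eq_ofReal_abs]
    exact pow_le_pow_left' (ENNReal.ofReal_le_ofReal (hb n x hx)) 2
  · simp
  · filter_upwards [ae_restrict_mem measurableSet_Q] with x hx
    have := ((ENNReal.continuous_pow 2).tendsto _).comp (hlim x hx).enorm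
    simpa [Function.comp_def] using this

lemma NQ_cornerCut_zero_ne_top (h0 : 0 ≤ σ) (h1 : σ < 1) : NQ σ (cornerCut 0) ≠ ⊤ := by
  have hm := memLp_of_mem_Icc (measurable_cornerCut 0) fun x hx => cornerCut_mem le_rfl hx
  rw [NQ_ne_top_iff hm]
  -- The midpoint of the admissible range σ < θ < 1.
  exact ((cornerHolder_cornerCut le_rfl (θ := (1 + σ) / 2) (by linarith)
    (by linarith)).gagliardoSq_lt_top (measurable_cornerCut 0) (by linarith)
      (by linarith) h0).ne

lemma tendsto_NQ_cornerCut_sub (h0 : 0 ≤ σ) (h1 : σ < 1) {η : ℕ → ℝ} (hη : ∀ n, 0 ≤ η n)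
    (hlim : Tendsto η atTop (𝓝 0)) :
    Tendsto (fun n => NQ σ fun x => cornerCut (η n) x - cornerCut 0 x) atTop (𝓝 0) := by
  have hm : ∀ n, Measurable fun x => cornerCut (η n) x - cornerCut 0 x := fun n =>
    (measurable_cornerCut _).sub (measurable_cornerCut _)
  have hpt : ∀ x ∈ Q, Tendsto (fun n => cornerCut (η n) x - cornerCut 0 x) atTop (𝓝 0) := by
    intro x hx
    have hD : x.1 ^ 2 + x.2 ^ 2 + 0 ≠ 0 := by have := hx.1.1; positivity
    have : Tendsto (fun n => cornerCut (η n) x) atTop (𝓝 (cornerCut 0 x)) :=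
      (Tendsto.div tendsto_const_nhds (tendsto_const_nhds.add hlim) hD).const_mul _
    simpa using this.sub_const (cornerCut 0 x)
  have h2 : Tendsto (fun n => normL2 (fun x => cornerCut (η n) x - cornerCut 0 x) ^ 2) atTop (𝓝 0) := by
    refine tendsto_normL2_of_tendsto hm (M := 1) (fun n x hx => ?_) hpt
    have m1 := cornerCut_mem (hη n) hx
    have m2 := cornerCut_mem le_rfl hx
    exact abs_le.2 ⟨by linarith [m1.1, m2.2], by linarith [m1.2, m2.1]⟩
  have h3 := CornerHolder.tendsto_gagliardoSq (σ := σ) (θ := (1 + σ) / 2)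
    (fun n => (cornerHolder_cornerCut (hη n) (by linarith) (by linarith)).sub
      (cornerHolder_cornerCut le_rfl (by linarith) (by linarith))) hm (by linarith)
    (by linarith) h0 hpt
  simpa [NQ] using h2.add h3

end

/-! ### The tangential pairing and the anisotropic seminorm. -/

section

variable {s η : ℝ}

lemma lintegral_mul_le_sqrt_mul_sqrt {X : Type*} [MeasurableSpace X] {μ : Measure X}
    {f g : X → ℝ≥0∞} (hf : AEMeasurable f μ) (hg : AEMeasurable g μ) :
    ∫⁻ x, f x * g x ∂μ ≤ (∫⁻ x, f x ^ 2 ∂μ) ^ (1 / 2 : ℝ) * (∫⁻ x, g x ^ 2 ∂μ) ^ (1 / 2 : ℝ) := by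
  have := ENNReal.lintegral_mul_le_Lp_mul_Lq μ Real.HolderConjugate.two_two hf hg
  simpa using this

lemma setIntegral_Iio_μI {N N' : ℝ → ℝ} (hN : ∀ x, HasDerivAt N (N' x) x) (hc : Continuous N')
    {y : ℝ} (hy : y ∈ Ioo (0 : ℝ) 1) : ∫ x in Ioi y, N' x ∂μI = N 1 - N y := by
  rw [μI, Measure.restrict_restrict measurableSet_Ioi]
  have e : Ioi y ∩ Ioo 0 1 = Ioo y 1 := by
    ext t
    constructor
    · rintro ⟨h1, -, h2⟩
      exact ⟨h1, h2⟩
    · rintro ⟨h1, h2⟩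
      exact ⟨h1, hy.1.trans h1, h2⟩
  rw [e, ← integral_Ioc_eq_integral_Ioo, ← intervalIntegral.integral_of_le hy.2.le]
  exact intervalIntegral.integral_eq_sub_of_hasDerivAt (fun t _ => hN t) (hc.intervalIntegrable _ _)

lemma integrable_μI {g : ℝ → ℝ} (hg : Continuous g) : Integrable g μI :=
  (hg.integrableOn_Icc (a := 0) (b := 1)).mono_set Ioo_subset_Icc_self

lemma real_Iio_μI {x : ℝ} (hx : x ∈ Ioo (0 : ℝ) 1) : μI (Iio x) = ENNReal.ofReal x := by
  rw [μI, Measure.restrict_apply measurableSet_Iio]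
  have e : Iio x ∩ Ioo 0 1 = Ioo 0 x := by
    ext t
    constructor
    · rintro ⟨h1, h2, -⟩
      exact ⟨h2, h1⟩
    · rintro ⟨h1, h2⟩
      exact ⟨h2, h1, h2.trans hx.2⟩
  rw [e, Real.volume_Ioo, sub_zero]

/-- Integrals against the derivative of `x N(x)` only see differences. -/
lemma integral_mul_deriv_eq {f N N' : ℝ → ℝ} (hf : Integrable f μI)
    (hN : ∀ x, HasDerivAt N (N' x) x) (hc : Continuous N') (h1 : N 1 = 0) :
    ∫ x, f x * (N x + x * N' x) ∂μI =
      ∫ z in {z : ℝ × ℝ | z.2 < z.1}, (f z.1 - f z.2) * N' z.1 ∂(μI.prod μI) := by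
  have hS : MeasurableSet {z : ℝ × ℝ | z.2 < z.1} := measurableSet_lt measurable_snd measurable_fst
  have hNc : Continuous N := continuous_iff_continuousAt.2 fun x => (hN x).continuousAt
  obtain ⟨M, hM⟩ := isCompact_Icc.exists_bound_of_continuousOn (s := Icc (0 : ℝ) 1) hc.continuousOn
  have hMI : ∀ᵐ x ∂μI, ‖N' x‖ ≤ M := by
    filter_upwards [ae_restrict_mem measurableSet_Ioo] with x hx
    exact hM x (Ioo_subset_Icc_self hx)
  have hfN : Integrable (fun x => f x * N' x) μI :=
    hf.mul_bdd hc.aestronglyMeasurable hMI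
  have i1 : Integrable (fun z : ℝ × ℝ => f z.1 * N' z.1) (μI.prod μI) := hfN.comp_fst μI
  have i2 : Integrable (fun z : ℝ × ℝ => N' z.1 * f z.2) (μI.prod μI) :=
    (integrable_μI hc).mul_prod hf
  -- The integrand does not depend on y, and y ranges over (0, x), which produces the factor x.
  have e1 : ∫ z in {z : ℝ × ℝ | z.2 < z.1}, f z.1 * N' z.1 ∂(μI.prod μI) =
      ∫ x, f x * (x * N' x) ∂μI := by
    rw [← integral_indicator hS, integral_prod _ (i1.indicator hS)]
    refine integral_congr_ae ?_
    filter_upwards [ae_restrict_mem measurableSet_Ioo] with x hx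
    have e : (fun y => {z : ℝ × ℝ | z.2 < z.1}.indicator (fun z => f z.1 * N' z.1) (x, y)) =
        (Iio x).indicator fun _ => f x * N' x := by
      ext y
      simp [indicator]
    rw [e, integral_indicator measurableSet_Iio, setIntegral_const, measureReal_def, real_Iio_μI hx,
      ENNReal.toReal_ofReal hx.1.le, smul_eq_mul]
    ring
  -- Integrating N' over (y, 1) gives N(1) - N(y); the boundary term disappears because N(1) = 0.
  have e2 : ∫ z in {z : ℝ × ℝ | z.2 < z.1}, N' z.1 * f z.2 ∂(μI.prod μI) =
      - ∫ x, f x * N x ∂μI := by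
    rw [← integral_indicator hS, integral_prod_symm _ (i2.indicator hS), ← integral_neg]
    refine integral_congr_ae ?_
    filter_upwards [ae_restrict_mem measurableSet_Ioo] with y hy
    have e : (fun x => {z : ℝ × ℝ | z.2 < z.1}.indicator (fun z => N' z.1 * f z.2) (x, y)) =
        (Ioi y).indicator fun x => N' x * f y := by
      ext x
      simp [indicator]
    rw [e, integral_indicator measurableSet_Ioi, integral_mul_const, setIntegral_Iio_μI hN hc hy, h1]
    ring
  have e3 : ∀ z : ℝ × ℝ, (f z.1 - f z.2) * N' z.1 = f z.1 * N' z.1 - N' z.1 * f z.2 := fun z => by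
    ring
  simp only [e3]
  rw [integral_sub i1.restrict i2.restrict, e1, e2, sub_neg_eq_add, ← integral_add]
  · refine integral_congr_ae (ae_of_all _ fun x => ?_)
    ring
  · exact hf.mul_bdd (continuous_id.mul hc).aestronglyMeasurable (c := M) (by
      filter_upwards [hMI, ae_restrict_mem measurableSet_Ioo] with x h2 hx
      rw [norm_mul]
      refine (mul_le_of_le_one_left (norm_nonneg _) ?_).trans h2
      change ‖x‖ ≤ 1
      rw [Real.norm_eq_abs, abs_of_pos hx.1]
      exact hx.2.le)
  · obtain ⟨M', hM'⟩ := isCompact_Icc.exists_bound_of_continuousOn (s := Icc (0 : ℝ) 1)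
      hNc.continuousOn
    refine hf.mul_bdd hNc.aestronglyMeasurable (c := M') ?_
    filter_upwards [ae_restrict_mem measurableSet_Ioo] with x hx
    exact hM' x (Ioo_subset_Icc_self hx)

/-- Cauchy-Schwarz on the triangle y < x with weight |x - y|^((1+2s)/2): one factor is at most the
Gagliardo seminorm, and in the other |x - y| ≤ x over an interval of length x gives x^(2+2s). -/
lemma enorm_integral_mul_deriv_le {f N N' : ℝ → ℝ} (hf : Integrable f μI)
    (hN : ∀ x, HasDerivAt N (N' x) x) (hc : Continuous N') (h1 : N 1 = 0) (hs : 0 < s) :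
    ‖∫ x, f x * (N x + x * N' x) ∂μI‖ₑ ≤ gagliardoSqI s f ^ (1 / 2 : ℝ) *
      (∫⁻ x, ENNReal.ofReal (N' x ^ 2 * x ^ (2 + 2 * s)) ∂μI) ^ (1 / 2 : ℝ) := by
  have hS : MeasurableSet {z : ℝ × ℝ | z.2 < z.1} := measurableSet_lt measurable_snd measurable_fst
  have hfst : AEMeasurable (fun z : ℝ × ℝ => f z.1) (μI.prod μI) := hf.1.aemeasurable.comp_fst
  have hsnd : AEMeasurable (fun z : ℝ × ℝ => f z.2) (μI.prod μI) := hf.1.aemeasurable.comp_snd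
  have hN'm := hc.measurable
  set g₁ : ℝ × ℝ → ℝ≥0∞ := fun z =>
    ENNReal.ofReal (|f z.1 - f z.2| / |z.1 - z.2| ^ ((1 + 2 * s) / 2)) with hg₁
  set g₂ : ℝ × ℝ → ℝ≥0∞ := {z : ℝ × ℝ | z.2 < z.1}.indicator fun z =>
    ENNReal.ofReal (|N' z.1| * |z.1 - z.2| ^ ((1 + 2 * s) / 2)) with hg₂
  have m₁ : AEMeasurable g₁ (μI.prod μI) := by fun_prop
  have m₂ : Measurable g₂ := Measurable.indicator (by fun_prop) hS
  have hsq : ∀ t : ℝ, 0 ≤ t → (t ^ ((1 + 2 * s) / 2)) ^ 2 = t ^ (1 + 2 * s) := by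
    intro t ht
    rw [← Real.rpow_natCast, ← Real.rpow_mul ht]
    norm_num
  rw [integral_mul_deriv_eq hf hN hc h1]
  calc _ ≤ ∫⁻ z in {z : ℝ × ℝ | z.2 < z.1}, ‖(f z.1 - f z.2) * N' z.1‖ₑ ∂(μI.prod μI) :=
        enorm_integral_le_lintegral_enorm _
    _ = ∫⁻ z, g₁ z * g₂ z ∂(μI.prod μI) := by
        rw [← lintegral_indicator hS]
        refine lintegral_congr fun z => ?_
        by_cases hz : z ∈ {z : ℝ × ℝ | z.2 < z.1}
        · have hp : 0 < |z.1 - z.2| := abs_pos.2 (sub_pos.2 hz).ne'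
          rw [hg₁, hg₂]
          simp only [indicator_of_mem hz]
          rw [← ENNReal.ofReal_mul (by positivity), Real.enorm_eq_ofReal_abs, abs_mul]
          congr 1
          field_simp
        · simp only [hg₂, indicator_of_notMem hz, mul_zero]
    _ ≤ _ := lintegral_mul_le_sqrt_mul_sqrt m₁ m₂.aemeasurable
    _ ≤ _ := by
        refine mul_le_mul' (le_of_eq ?_) (ENNReal.rpow_le_rpow ?_ (by norm_num))
        · congr 1
          rw [lintegral_prod _ (m₁.pow_const 2), gagliardoSqI]
          refine lintegral_congr fun x => lintegral_congr fun y => ?_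
          rw [hg₁]
          simp only
          rw [← ENNReal.ofReal_pow (by positivity), div_pow, hsq _ (abs_nonneg _)]
        · rw [lintegral_prod _ (m₂.pow_const 2).aemeasurable]
          refine lintegral_mono_ae ?_
          filter_upwards [ae_restrict_mem measurableSet_Ioo] with x hx
          calc _ ≤ ∫⁻ y, (Iio x).indicator
                (fun _ => ENNReal.ofReal (N' x ^ 2 * x ^ (1 + 2 * s))) y ∂μI := by
                refine lintegral_mono_ae ?_
                filter_upwards [ae_restrict_mem measurableSet_Ioo] with y hy
                by_cases h : y < x
                · have hz : (x, y) ∈ {z : ℝ × ℝ | z.2 < z.1} := h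
                  rw [hg₂, indicator_of_mem hz, indicator_of_mem (show y ∈ Iio x from h),
                    ← ENNReal.ofReal_pow (by positivity), mul_pow, hsq _ (abs_nonneg _), sq_abs]
                  refine ENNReal.ofReal_le_ofReal (mul_le_mul_of_nonneg_left ?_ (sq_nonneg _))
                  refine Real.rpow_le_rpow (abs_nonneg _) ?_ (by linarith)
                  rw [abs_of_pos (sub_pos.2 h)]
                  linarith [hy.1]
                · have hz : (x, y) ∉ {z : ℝ × ℝ | z.2 < z.1} := h
                  rw [hg₂, indicator_of_notMem hz]
                  simp
            _ = _ := by
                rw [lintegral_indicator measurableSet_Iio, setLIntegral_const, real_Iio_μI hx,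
                  ← ENNReal.ofReal_mul (by have := hx.1; positivity), mul_assoc]
                congr 2
                nth_rewrite 2 [← Real.rpow_one x]
                rw [← Real.rpow_add hx.1]
                ring_nf

/-- The quotient of `cornerCut η` and the second coordinate. -/
noncomputable def cornerQuot (η a b : ℝ) : ℝ := (1 - a) * ((b - b ^ 2) / (a ^ 2 + b ^ 2 + η))

/-- The derivative of `cornerQuot η a`. -/
noncomputable def cornerQuotDeriv (η a b : ℝ) : ℝ :=
  (1 - a) * (((1 - 2 * b) * (a ^ 2 + b ^ 2 + η) - (b - b ^ 2) * (2 * b)) / (a ^ 2 + b ^ 2 + η) ^ 2)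

lemma hasDerivAt_cornerQuot (hη : 0 < η) (a b : ℝ) :
    HasDerivAt (cornerQuot η a) (cornerQuotDeriv η a b) b := by
  have h1 : HasDerivAt (fun b : ℝ => b - b ^ 2) (1 - 2 * b) b := by
    simpa using (hasDerivAt_id' b).fun_sub (hasDerivAt_pow 2 b)
  have h2 : HasDerivAt (fun b : ℝ => a ^ 2 + b ^ 2 + η) (2 * b) b := by
    simpa using ((hasDerivAt_pow 2 b).const_add (a ^ 2)).add_const η
  exact (h1.div h2 (by positivity)).const_mul (1 - a)

lemma pd_one_cornerCut (hη : 0 < η) (x : ℝ × ℝ) :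
    pd 1 (cornerCut η) x = cornerQuot η x.1 x.2 + x.2 * cornerQuotDeriv η x.1 x.2 := by
  have h1 := hasDerivAt_slice_snd (contDiff_one_of_infty (contDiff_cornerCut hη)) x.1 x.2
  have h2 := (hasDerivAt_id x.2).mul (hasDerivAt_cornerQuot hη x.1 x.2)
  have e : (fun t => cornerCut η (x.1, t)) = id * cornerQuot η x.1 := by
    ext t
    simp only [cornerCut, cornerQuot, Pi.mul_apply, id]
    ring
  rw [← e] at h2
  simpa using h1.unique h2

/-- Since |N'| ≤ 3/|x|² and x₂ ≤ |x|, the product is at most 9|x|^(2s-2), which is integrable in the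
plane for every s > 0. The bound does not involve η. -/
lemma sq_cornerQuotDeriv_mul_le (hη : 0 ≤ η) {x : ℝ × ℝ} (hx : x ∈ Q) (hs : 0 < s) :
    cornerQuotDeriv η x.1 x.2 ^ 2 * x.2 ^ (2 + 2 * s) ≤ 9 * (eNorm2 x ^ (2 - 2 * s))⁻¹ := by
  have hρ := eNorm2_pos hx
  have hρ2 := eNorm2_sq x
  obtain ⟨⟨a0, a1⟩, b0, b1⟩ := hx
  set D := x.1 ^ 2 + x.2 ^ 2 + η with hD
  have hD0 : 0 < D := by positivity
  have h1 : |cornerQuotDeriv η x.1 x.2| ≤ 3 / eNorm2 x ^ 2 := by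
    rw [cornerQuotDeriv, ← hD, abs_mul, abs_of_pos (sub_pos.2 a1)]
    refine (mul_le_of_le_one_left (abs_nonneg _) (by linarith)).trans ?_
    have hb : 2 * x.2 ^ 2 ≤ 2 * D := by nlinarith
    have hn : |(1 - 2 * x.2) * D - (x.2 - x.2 ^ 2) * (2 * x.2)| ≤ 3 * D := by
      rw [abs_le]
      constructor <;> nlinarith [mul_pos b0 hD0, mul_pos (sub_pos.2 b1) hD0, pow_pos b0 2,
        pow_pos b0 3, mul_pos (pow_pos b0 2) (sub_pos.2 b1)]
    rw [abs_div, abs_of_pos (a := D ^ 2) (by positivity), div_le_div_iff₀ (by positivity)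
      (by positivity)]
    have : eNorm2 x ^ 2 ≤ D := by rw [hρ2, hD]; linarith
    calc _ ≤ 3 * D * D := mul_le_mul hn this (by positivity) (by positivity)
      _ = _ := by ring
  have h2 : x.2 ≤ eNorm2 x := by nlinarith
  have h3 : x.2 ^ (2 + 2 * s) ≤ eNorm2 x ^ (2 + 2 * s) :=
    Real.rpow_le_rpow b0.le h2 (by linarith)
  have h4 := pow_le_pow_left₀ (abs_nonneg _) h1 2
  rw [sq_abs] at h4
  refine (mul_le_mul h4 h3 (by positivity) (by positivity)).trans (le_of_eq ?_)
  have e : eNorm2 x ^ (2 + 2 * s) * eNorm2 x ^ (2 - 2 * s) = eNorm2 x ^ 4 := by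
    rw [← Real.rpow_add hρ, ← Real.rpow_natCast]
    congr 1
    push_cast
    ring
  have : eNorm2 x ^ (2 - 2 * s) ≠ 0 := by positivity
  rw [eq_mul_inv_iff_mul_eq₀ this, mul_assoc, e]
  field_simp
  norm_num

lemma gagliardoSqI_congr_ae {f g : ℝ → ℝ} (h : f =ᵐ[μI] g) : gagliardoSqI s f = gagliardoSqI s g :=
  energy_congr_ae (k := fun x y => |x - y| ^ (1 + 2 * s)) h

/-- The one-dimensional estimate is applied on each line parallel to the edge, followed by
Cauchy-Schwarz across the lines. A Borel representative makes the sliced seminorm a measurable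
function of the line. -/
lemma enorm_integral_mul_pd_cornerCut_le_of_measurable (hs : 0 < s) (hη : 0 < η)
    {w : ℝ × ℝ → ℝ} (hm : Measurable w) (hw : MemLp w 2 μQ) :
    ‖∫ x, w x * pd 1 (cornerCut η) x ∂μQ‖ₑ ≤ (9 * rieszInt (2 - 2 * s)) ^ (1 / 2 : ℝ) *
      (∫⁻ a, gagliardoSqI s (fun b => w (a, b)) ∂μI) ^ (1 / 2 : ℝ) := by
  have hc := contDiff_one_of_infty (contDiff_cornerCut hη)
  have hint : Integrable (fun x => w x * pd 1 (cornerCut η) x) (μI.prod μI) := by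
    rw [← μQ_eq_prod]
    exact hw.integrable_mul (memLp_of_continuous (continuous_pd hc 1))
  have hwi : Integrable w (μI.prod μI) := by
    rw [← μQ_eq_prod]
    exact hw.integrable one_le_two
  have mE : Measurable fun a => gagliardoSqI s (fun b => w (a, b)) := by
    have h3 : Measurable fun q : (ℝ × ℝ) × ℝ => ENNReal.ofReal
        (|w (q.1.1, q.1.2) - w (q.1.1, q.2)| ^ 2 / |q.1.2 - q.2| ^ (1 + 2 * s)) := by
      simp only [sq_abs]
      fun_prop
    exact (h3.lintegral_prod_right' (ν := μI)).lintegral_prod_right' (ν := μI)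
  have mq : Measurable fun x : ℝ × ℝ =>
      ENNReal.ofReal (cornerQuotDeriv η x.1 x.2 ^ 2 * x.2 ^ (2 + 2 * s)) := by
    unfold cornerQuotDeriv
    fun_prop
  rw [μQ_eq_prod, integral_prod _ hint]
  calc _ ≤ ∫⁻ a, ‖∫ b, w (a, b) * pd 1 (cornerCut η) (a, b) ∂μI‖ₑ ∂μI :=
        enorm_integral_le_lintegral_enorm _
    _ ≤ ∫⁻ a, gagliardoSqI s (fun b => w (a, b)) ^ (1 / 2 : ℝ) * (∫⁻ b, ENNReal.ofReal
          (cornerQuotDeriv η a b ^ 2 * b ^ (2 + 2 * s)) ∂μI) ^ (1 / 2 : ℝ) ∂μI := by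
        refine lintegral_mono_ae ?_
        filter_upwards [hwi.prod_right_ae] with a ha
        simp only [pd_one_cornerCut hη]
        refine enorm_integral_mul_deriv_le ha (hasDerivAt_cornerQuot hη a) ?_ (by simp [cornerQuot]) hs
        have : ∀ b : ℝ, (a ^ 2 + b ^ 2 + η) ^ 2 ≠ 0 := fun b => by positivity
        unfold cornerQuotDeriv
        fun_prop (disch := assumption)
    _ ≤ _ := lintegral_mul_le_sqrt_mul_sqrt (mE.pow_const _).aemeasurable
          ((mq.lintegral_prod_right' (ν := μI)).pow_const _).aemeasurable
    _ ≤ _ := by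
        have e : ∀ t : ℝ≥0∞, (t ^ (1 / 2 : ℝ)) ^ 2 = t := by
          intro t
          rw [← ENNReal.rpow_natCast, ← ENNReal.rpow_mul]
          norm_num
        simp only [e]
        rw [mul_comm]
        refine mul_le_mul' (ENNReal.rpow_le_rpow ?_ (by norm_num)) le_rfl
        rw [← lintegral_prod _ mq.aemeasurable, ← μQ_eq_prod]
        calc _ ≤ ∫⁻ x, 9 * ENNReal.ofReal ((eNorm2 x ^ (2 - 2 * s))⁻¹) ∂μQ := by
              refine lintegral_mono_ae ?_
              filter_upwards [ae_restrict_mem measurableSet_Q] with x hx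
              rw [← ENNReal.ofReal_ofNat, ← ENNReal.ofReal_mul (by norm_num)]
              exact ENNReal.ofReal_le_ofReal (sq_cornerQuotDeriv_mul_le hη.le hx hs)
          _ ≤ _ := by
              rw [lintegral_const_mul' _ _ (by simp)]
              exact mul_le_mul' le_rfl (lintegral_eNorm2_le _)

/-- The pairing of the tangential component with the gradient of the cutoff function is controlled
by the anisotropic seminorm. -/
lemma enorm_integral_mul_pd_cornerCut_le (hs : 0 < s) (hη : 0 < η) {w : ℝ × ℝ → ℝ}
    (hw : MemLp w 2 μQ) :
    ‖∫ x, w x * pd 1 (cornerCut η) x ∂μQ‖ₑ ≤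
      (9 * rieszInt (2 - 2 * s)) ^ (1 / 2 : ℝ) * seminormAH 1 s w := by
  obtain ⟨w', hm, hww'⟩ := hw.1.aemeasurable
  have h := enorm_integral_mul_pd_cornerCut_le_of_measurable hs hη hm (hw.ae_eq hww')
  have e1 : ∫ x, w x * pd 1 (cornerCut η) x ∂μQ = ∫ x, w' x * pd 1 (cornerCut η) x ∂μQ := by
    refine integral_congr_ae ?_
    filter_upwards [hww'] with x hx
    rw [hx]
  have e2 : ∫⁻ a, gagliardoSqI s (fun b => w (a, b)) ∂μI =
      ∫⁻ a, gagliardoSqI s (fun b => w' (a, b)) ∂μI := by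
    rw [μQ_eq_prod] at hww'
    refine lintegral_congr_ae ?_
    filter_upwards [Measure.ae_ae_of_ae_prod hww'] with a ha
    exact gagliardoSqI_congr_ae ha
  rw [e1, seminormAH]
  simpa [e2] using h

end

/-! ### Symmetries of the square and cutoffs for the four edges. -/

section

variable {σ s : ℝ} {ψ χ : ℕ → ℝ × ℝ → ℝ} {φ ξ : ℝ × ℝ → ℝ} {i j : Fin 2}

/-- The reflection of the unit interval. -/
def reflI : ℝ ≃ᵐ ℝ := MeasurableEquiv.subLeft 1

lemma reflI_apply (t : ℝ) : reflI t = 1 - t := rfl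

lemma measurePreserving_reflI : MeasurePreserving reflI μI μI := by
  have h : MeasurePreserving reflI volume volume := Measure.measurePreserving_sub_left volume 1
  have h2 := h.restrict_preimage_emb reflI.measurableEmbedding (Ioo 0 1)
  have e : reflI ⁻¹' Ioo (0 : ℝ) 1 = Ioo 0 1 := by
    ext t
    simp only [mem_preimage, mem_Ioo, reflI_apply]
    constructor <;> rintro ⟨h1, h2⟩ <;> constructor <;> linarith
  rwa [e] at h2

/-- The reflection of the square in the first coordinate. -/
def reflFst : ℝ × ℝ ≃ᵐ ℝ × ℝ := MeasurableEquiv.prodCongr reflI (MeasurableEquiv.refl ℝ)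

/-- The reflection of the square in the second coordinate. -/
def reflSnd : ℝ × ℝ ≃ᵐ ℝ × ℝ := MeasurableEquiv.prodCongr (MeasurableEquiv.refl ℝ) reflI

lemma reflFst_apply (x : ℝ × ℝ) : reflFst x = (1 - x.1, x.2) := rfl

lemma reflSnd_apply (x : ℝ × ℝ) : reflSnd x = (x.1, 1 - x.2) := rfl

lemma measurePreserving_reflFst : MeasurePreserving reflFst μQ μQ := by
  rw [μQ_eq_prod]
  exact measurePreserving_reflI.prod (MeasurePreserving.id μI)

lemma measurePreserving_reflSnd : MeasurePreserving reflSnd μQ μQ := by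
  rw [μQ_eq_prod]
  exact (MeasurePreserving.id μI).prod measurePreserving_reflI

lemma euclDist_reflFst (x y : ℝ × ℝ) : euclDist (reflFst x) (reflFst y) = euclDist x y := by
  simp only [euclDist, reflFst_apply]
  congr 1
  ring

lemma euclDist_reflSnd (x y : ℝ × ℝ) : euclDist (reflSnd x) (reflSnd y) = euclDist x y := by
  simp only [euclDist, reflSnd_apply]
  congr 1
  ring

lemma contDiff_comp_swp {n : WithTop ℕ∞} (h : ContDiff ℝ n φ) : ContDiff ℝ n fun x => φ (swp x) := by
  simp only [swp_apply]
  fun_prop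

lemma contDiff_comp_reflFst {n : WithTop ℕ∞} (h : ContDiff ℝ n φ) :
    ContDiff ℝ n fun x => φ (reflFst x) := by
  simp only [reflFst_apply]
  fun_prop

lemma contDiff_comp_reflSnd {n : WithTop ℕ∞} (h : ContDiff ℝ n φ) :
    ContDiff ℝ n fun x => φ (reflSnd x) := by
  simp only [reflSnd_apply]
  fun_prop

lemma pd_one_comp_reflFst (h : ContDiff ℝ 1 φ) (x : ℝ × ℝ) :
    pd 1 (fun y => φ (reflFst y)) x = pd 1 φ (reflFst x) :=
  (hasDerivAt_slice_snd (contDiff_comp_reflFst h) x.1 x.2).unique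
    (hasDerivAt_slice_snd h (1 - x.1) x.2)

lemma pd_one_comp_reflSnd (h : ContDiff ℝ 1 φ) (x : ℝ × ℝ) :
    pd 1 (fun y => φ (reflSnd y)) x = - pd 1 φ (reflSnd x) := by
  have h1 := (hasDerivAt_slice_snd h x.1 (1 - x.2)).scomp x.2 ((hasDerivAt_id x.2).const_sub 1)
  have h2 := (hasDerivAt_slice_snd (contDiff_comp_reflSnd h) x.1 x.2).unique h1
  simpa [reflSnd_apply] using h2

/-- `ψ n → φ` with smooth `ψ n`, in all the spaces `H^σ(Q)`, `0 < σ < 1`. -/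
structure IsSmoothApprox (ψ : ℕ → ℝ × ℝ → ℝ) (φ : ℝ × ℝ → ℝ) : Prop where
  smooth : ∀ n, ContDiff ℝ ∞ (ψ n)
  memLp : MemLp φ 2 μQ
  ne_top : ∀ σ, 0 < σ → σ < 1 → NQ σ φ ≠ ⊤
  tendsto : ∀ σ, 0 < σ → σ < 1 → Tendsto (fun n => NQ σ fun x => ψ n x - φ x) atTop (𝓝 0)

lemma IsSmoothApprox.memLp_sub (h : IsSmoothApprox ψ φ) (n : ℕ) :
    MemLp (fun x => ψ n x - φ x) 2 μQ :=
  (memLp_of_continuous (h.smooth n).continuous).sub h.memLp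

lemma IsSmoothApprox.comp (h : IsSmoothApprox ψ φ) {κ : ℝ × ℝ ≃ᵐ ℝ × ℝ}
    (hκ : MeasurePreserving κ μQ μQ) (hd : ∀ x y, euclDist (κ x) (κ y) = euclDist x y)
    (hs : ∀ n, ContDiff ℝ ∞ fun x => ψ n (κ x)) :
    IsSmoothApprox (fun n x => ψ n (κ x)) fun x => φ (κ x) where
  smooth := hs
  memLp := h.memLp.comp_measurePreserving hκ
  ne_top σ h0 h1 := by
    rw [NQ_comp hκ hd h.memLp.1]
    exact h.ne_top σ h0 h1
  tendsto σ h0 h1 := by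
    refine (h.tendsto σ h0 h1).congr fun n => ?_
    exact (NQ_comp hκ hd (h.memLp_sub n).1).symm

lemma IsSmoothApprox.add (h : IsSmoothApprox ψ φ) (h' : IsSmoothApprox χ ξ) :
    IsSmoothApprox (fun n x => ψ n x + χ n x) fun x => φ x + ξ x where
  smooth n := (h.smooth n).add (h'.smooth n)
  memLp := h.memLp.add h'.memLp
  ne_top σ h0 h1 := by
    refine ((NQ_add_le h.memLp h'.memLp).trans_lt ?_).ne
    have := (h.ne_top σ h0 h1).lt_top
    have := (h'.ne_top σ h0 h1).lt_top
    finiteness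
  tendsto σ h0 h1 := by
    have h2 := (ENNReal.Tendsto.const_mul (a := 2) (h.tendsto σ h0 h1) (Or.inr (by simp))).add
      (ENNReal.Tendsto.const_mul (a := 2) (h'.tendsto σ h0 h1) (Or.inr (by simp)))
    simp only [mul_zero, add_zero] at h2
    refine tendsto_of_tendsto_of_tendsto_of_le_of_le tendsto_const_nhds h2 (fun _ => zero_le)
      fun n => ?_
    have e : (fun x => ψ n x + χ n x - (φ x + ξ x)) =
        fun x => (ψ n x - φ x) + (χ n x - ξ x) := by
      ext x
      ring
    rw [e]
    exact NQ_add_le (h.memLp_sub n) (h'.memLp_sub n)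

/-- The pairings with `∂ⱼ ψ n` are uniformly bounded by the anisotropic seminorm. -/
def PairingBound (j : Fin 2) (ψ : ℕ → ℝ × ℝ → ℝ) : Prop :=
  ∀ s : ℝ, 0 < s → s < 1 → ∃ C : ℝ≥0, ∀ n u, MemLp u 2 μQ →
    ‖∫ x, u x * pd j (ψ n) x ∂μQ‖ₑ ≤ C * seminormAH j s u

/-- Change of variables by an isometric involution of the kind used here: the derivative changes at
most its direction and sign, and the composition is moved onto u, where the seminorm is transported
with it. -/
lemma PairingBound.comp (h : PairingBound i ψ) {κ : ℝ × ℝ ≃ᵐ ℝ × ℝ}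
    (hκ : MeasurePreserving κ μQ μQ) (hinv : ∀ x, κ (κ x) = x) {c : ℝ} (hc : |c| = 1)
    (hpd : ∀ n x, pd j (fun y => ψ n (κ y)) x = c * pd i (ψ n) (κ x))
    (hAH : ∀ s u, seminormAH i s (fun x => u (κ x)) = seminormAH j s u) :
    PairingBound j fun n x => ψ n (κ x) := by
  intro s h0 h1
  obtain ⟨C, hC⟩ := h s h0 h1
  refine ⟨C, fun n u hu => ?_⟩
  have e : ∫ x, u x * pd j (fun y => ψ n (κ y)) x ∂μQ =
      c * ∫ x, u (κ x) * pd i (ψ n) x ∂μQ := by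
    rw [← integral_const_mul, ← hκ.integral_comp κ.measurableEmbedding]
    refine integral_congr_ae (ae_of_all _ fun x => ?_)
    simp only [hpd, hinv]
    ring
  have hc' : ‖c‖ₑ = 1 := by rw [Real.enorm_eq_ofReal_abs, hc, ENNReal.ofReal_one]
  rw [e, enorm_mul, hc', one_mul, ← hAH]
  exact hC n _ (hu.comp_measurePreserving hκ)

lemma pd_add (hψ : ContDiff ℝ 1 φ) (hχ : ContDiff ℝ 1 ξ) (i : Fin 2) (x : ℝ × ℝ) :
    pd i (fun y => φ y + ξ y) x = pd i φ x + pd i ξ x := by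
  unfold pd
  rw [fderiv_fun_add (hψ.differentiable one_ne_zero x) (hχ.differentiable one_ne_zero x)]
  simp

lemma PairingBound.add (h : PairingBound j ψ) (h' : PairingBound j χ)
    (hψ : ∀ n, ContDiff ℝ 1 (ψ n)) (hχ : ∀ n, ContDiff ℝ 1 (χ n)) :
    PairingBound j fun n x => ψ n x + χ n x := by
  intro s h0 h1
  obtain ⟨C, hC⟩ := h s h0 h1
  obtain ⟨C', hC'⟩ := h' s h0 h1
  refine ⟨C + C', fun n u hu => ?_⟩
  have hi : ∀ {f : ℝ × ℝ → ℝ}, ContDiff ℝ 1 f → Integrable (fun x => u x * pd j f x) μQ := fun hf =>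
    hu.integrable_mul (memLp_of_continuous (continuous_pd hf j))
  simp only [pd_add (hψ n) (hχ n), mul_add]
  rw [integral_add (hi (hψ n)) (hi (hχ n))]
  refine (enorm_add_le _ _).trans ?_
  push_cast
  rw [add_mul]
  exact add_le_add (hC n u hu) (hC' n u hu)

lemma gagliardoSqI_comp_reflI (s : ℝ) (f : ℝ → ℝ) :
    gagliardoSqI s (fun t => f (reflI t)) = gagliardoSqI s f :=
  energy_comp (k := fun x y => |x - y| ^ (1 + 2 * s)) (k' := fun x y => |x - y| ^ (1 + 2 * s))
    measurePreserving_reflI (fun x y => by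
      simp only [reflI_apply]
      rw [← abs_neg]
      congr 2
      ring) f

lemma seminormAH_one_comp_reflSnd (s : ℝ) (u : ℝ × ℝ → ℝ) :
    seminormAH 1 s (fun x => u (reflSnd x)) = seminormAH 1 s u := by
  have : ∀ a, gagliardoSqI s (fun b => u (reflSnd (a, b))) = gagliardoSqI s (fun b => u (a, b)) :=
    fun a => gagliardoSqI_comp_reflI s fun b => u (a, b)
  simp [seminormAH, this]

lemma seminormAH_one_comp_reflFst (s : ℝ) (u : ℝ × ℝ → ℝ) :
    seminormAH 1 s (fun x => u (reflFst x)) = seminormAH 1 s u := by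
  have := measurePreserving_reflI.lintegral_comp_emb reflI.measurableEmbedding
    fun a => gagliardoSqI s (fun b => u (a, b))
  simp [seminormAH, ← this, reflFst_apply, reflI_apply]

lemma seminormAH_one_comp_swp (s : ℝ) (u : ℝ × ℝ → ℝ) :
    seminormAH 1 s (fun x => u (swp x)) = seminormAH 0 s u := by
  simp [seminormAH, swp_apply]

/-- Regularization parameters tending to zero. -/
noncomputable def ηs (n : ℕ) : ℝ := 1 / ((n : ℝ) + 1)

lemma ηs_pos (n : ℕ) : 0 < ηs n := Nat.one_div_pos_of_nat

lemma tendsto_ηs : Tendsto ηs atTop (𝓝 0) := tendsto_one_div_add_atTop_nhds_zero_nat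

/-- Cutoff functions with trace close to `1` on the left edge, and `0` on the other ones. -/
noncomputable def leftCut (η : ℝ) (x : ℝ × ℝ) : ℝ := cornerCut η x + cornerCut η (reflSnd x)

/-- Cutoff functions with trace close to `1` on the edge `e`, and `0` on the other ones. -/
noncomputable def edgeCut (η : ℝ) (e : Fin 4) : ℝ × ℝ → ℝ :=
  (![fun x => leftCut η (swp x), fun x => leftCut η (reflFst x),
    fun x => leftCut η (reflFst (swp x)), leftCut η] : Fin 4 → ℝ × ℝ → ℝ) e

/-- The index of the coordinate direction tangential to the edge `e`. -/
def tangIdx (e : Fin 4) : Fin 2 := (![0, 1, 0, 1] : Fin 4 → Fin 2) e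

lemma isSmoothApprox_cornerCut : IsSmoothApprox (fun n => cornerCut (ηs n)) (cornerCut 0) where
  smooth n := contDiff_cornerCut (ηs_pos n)
  memLp := memLp_of_mem_Icc (measurable_cornerCut 0) fun _ hx => cornerCut_mem le_rfl hx
  ne_top _ h0 h1 := NQ_cornerCut_zero_ne_top h0.le h1
  tendsto _ h0 h1 := tendsto_NQ_cornerCut_sub h0.le h1 (fun n => (ηs_pos n).le) tendsto_ηs

lemma pairingBound_cornerCut : PairingBound 1 fun n => cornerCut (ηs n) := by
  intro s h0 h1
  have hR : (9 * rieszInt (2 - 2 * s)) ^ (1 / 2 : ℝ) ≠ ⊤ := by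
    have := rieszInt_lt_top (a := 2 - 2 * s) (by linarith) (by linarith)
    finiteness
  refine ⟨((9 * rieszInt (2 - 2 * s)) ^ (1 / 2 : ℝ)).toNNReal, fun n u hu => ?_⟩
  rw [ENNReal.coe_toNNReal hR]
  exact enorm_integral_mul_pd_cornerCut_le h0 (ηs_pos n) hu

lemma isSmoothApprox_leftCut : IsSmoothApprox (fun n => leftCut (ηs n)) (leftCut 0) :=
  isSmoothApprox_cornerCut.add (isSmoothApprox_cornerCut.comp measurePreserving_reflSnd
    euclDist_reflSnd fun n => contDiff_comp_reflSnd (isSmoothApprox_cornerCut.smooth n))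

/-- Reflection in the tangential variable reverses the sign of the tangential derivative, hence c =
-1. -/
lemma pairingBound_leftCut : PairingBound 1 fun n => leftCut (ηs n) := by
  have hs := fun n => contDiff_one_of_infty (isSmoothApprox_cornerCut.smooth n)
  refine pairingBound_cornerCut.add (pairingBound_cornerCut.comp measurePreserving_reflSnd
    (fun x => by simp [reflSnd_apply]) (c := -1) (by norm_num)
    (fun n x => ?_) fun s u => seminormAH_one_comp_reflSnd s u) hs
      fun n => contDiff_comp_reflSnd (hs n)
  rw [pd_one_comp_reflSnd (hs n)]
  ring

lemma isSmoothApprox_edgeCut (e : Fin 4) :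
    IsSmoothApprox (fun n => edgeCut (ηs n) e) (edgeCut 0 e) := by
  have h := isSmoothApprox_leftCut
  have h1 := h.comp measurePreserving_reflFst euclDist_reflFst
    fun n => contDiff_comp_reflFst (h.smooth n)
  fin_cases e
  · exact h.comp measurePreserving_swp euclDist_swp fun n => contDiff_comp_swp (h.smooth n)
  · exact h1
  · exact h1.comp measurePreserving_swp euclDist_swp fun n => contDiff_comp_swp (h1.smooth n)
  · exact h

lemma pairingBound_edgeCut (e : Fin 4) :
    PairingBound (tangIdx e) fun n => edgeCut (ηs n) e := by
  have hs := fun n => contDiff_one_of_infty (isSmoothApprox_leftCut.smooth n)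
  have h := pairingBound_leftCut
  have h1 := h.comp measurePreserving_reflFst (fun x => by simp [reflFst_apply]) (c := 1) (j := 1)
    (by norm_num) (fun n x => by rw [pd_one_comp_reflFst (hs n), one_mul])
    fun s u => seminormAH_one_comp_reflFst s u
  have hswp : ∀ {χ : ℕ → ℝ × ℝ → ℝ}, (∀ n, ContDiff ℝ 1 (χ n)) → PairingBound 1 χ →
      PairingBound 0 fun n x => χ n (swp x) := fun hχ hb =>
    hb.comp measurePreserving_swp (fun x => by simp [swp_apply]) (c := 1) (by norm_num)
      (fun n x => by rw [pd_zero_comp_swp (hχ n), one_mul]) fun s u => seminormAH_one_comp_swp s u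
  fin_cases e
  · exact hswp hs h
  · exact h1
  · exact hswp (fun n => contDiff_comp_reflFst (hs n)) h1
  · exact h

/-- The trace of `edgeCut η e` on the edge `e`. -/
noncomputable def cutTrace (η t : ℝ) : ℝ :=
  (1 - t) * (t ^ 2 / (t ^ 2 + η)) + t * ((1 - t) ^ 2 / ((1 - t) ^ 2 + η))

lemma edgeCut_edgePt (η : ℝ) (e e' : Fin 4) (t : ℝ) :
    edgeCut η e (edgePt e' t) = if e' = e then cutTrace η t else 0 := by
  fin_cases e <;> fin_cases e' <;>
    simp [edgeCut, edgePt, leftCut, cornerCut, swp_apply, reflFst_apply, reflSnd_apply, cutTrace]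

/-- Inside the interval both quotients tend to 1, so the weights 1 - t and t add up to 1. At the end
points the values remain 0, so convergence is not uniform, but domination by 1 gives it in L². -/
lemma tendsto_cutTrace :
    Tendsto (fun n => eLpNorm (fun t => cutTrace (ηs n) t - 1) 2 μI) atTop (𝓝 0) := by
  have h0 : Tendsto (fun n => eLpNorm (fun t => cutTrace (ηs n) t - 1) 2 μI ^ 2) atTop (𝓝 0) := by
    simp only [eLpNorm_two_sq]
    have := tendsto_lintegral_of_dominated_convergence (μ := μI)
      (F := fun n t => ‖cutTrace (ηs n) t - 1‖ₑ ^ 2) (f := fun _ => 0)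
      (fun _ => 1) (fun n => ?_) (fun n => ?_) ?_ ?_
    · simpa using this
    · unfold cutTrace
      fun_prop
    · filter_upwards [ae_restrict_mem measurableSet_Ioo] with t ht
      have hf : ∀ r : ℝ, 0 ≤ r ^ 2 / (r ^ 2 + ηs n) ∧ r ^ 2 / (r ^ 2 + ηs n) ≤ 1 := fun r => by
        have := ηs_pos n
        exact ⟨by positivity, (div_le_one (by positivity)).2 (by linarith)⟩
      obtain ⟨p1, p2⟩ := hf t
      obtain ⟨q1, q2⟩ := hf (1 - t)
      have : |cutTrace (ηs n) t - 1| ≤ 1 := by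
        rw [cutTrace, abs_le]
        constructor <;> nlinarith [ht.1, ht.2]
      rw [Real.enorm_eq_ofReal_abs]
      exact pow_le_one₀ zero_le (ENNReal.ofReal_le_one.2 this)
    · simp
    · filter_upwards [ae_restrict_mem measurableSet_Ioo] with t ht
      have hf : ∀ r : ℝ, r ≠ 0 → Tendsto (fun n => r ^ 2 / (r ^ 2 + ηs n)) atTop (𝓝 1) := by
        intro r hr
        have : Tendsto (fun n => r ^ 2 / (r ^ 2 + ηs n)) atTop (𝓝 (r ^ 2 / (r ^ 2 + 0))) :=
          tendsto_const_nhds.div (tendsto_ηs.const_add (r ^ 2)) (by positivity)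
        simpa [hr] using this
      have h1 := ((hf t ht.1.ne').const_mul (1 - t)).add
        ((hf (1 - t) (sub_pos.2 ht.2).ne').const_mul t)
      have h2 : Tendsto (fun n => cutTrace (ηs n) t - 1) atTop (𝓝 0) := by
        simpa [cutTrace] using h1.sub_const 1
      have := ((ENNReal.continuous_pow 2).tendsto _).comp h2.enorm
      simpa [Function.comp_def] using this
  have h1 := (ENNReal.continuous_rpow_const (y := 1 / 2)).tendsto 0 |>.comp h0
  rw [ENNReal.zero_rpow_of_pos (by norm_num)] at h1
  refine h1.congr fun n => ?_
  rw [Function.comp_apply, ← ENNReal.rpow_natCast, ← ENNReal.rpow_mul]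
  norm_num

lemma IsSmoothApprox.tendsto_normH (h : IsSmoothApprox ψ φ) (h0 : 0 < σ) (h1 : σ < 1) :
    Tendsto (fun n => normH σ fun x => ψ n x - φ x) atTop (𝓝 0) := by
  have h2 := (ENNReal.continuous_rpow_const (y := 1 / 2)).tendsto 0 |>.comp (h.tendsto σ h0 h1)
  rw [ENNReal.zero_rpow_of_pos (by norm_num)] at h2
  refine h2.congr fun n => ?_
  rw [Function.comp_apply, normH_eq h0 h1 (h.memLp_sub n)]

lemma tendsto_edgeCut_edgePt (e e' : Fin 4) :
    Tendsto (fun n => eLpNorm (fun t => edgeCut (ηs n) e (edgePt e' t) -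
      if e' = e then 1 else 0) 2 μI) atTop (𝓝 0) := by
  simp only [edgeCut_edgePt]
  by_cases h : e' = e
  · simpa [h] using tendsto_cutTrace
  · simp [h]

/-- This makes the unregularized cutoff admissible in the definition of the weak flux; 3/4 is an
arbitrary exponent in (1/2, 1). -/
lemma isTrace_edgeCut (e e' : Fin 4) :
    IsTrace (edgeCut 0 e) e' fun _ => if e' = e then 1 else 0 := by
  have h := isSmoothApprox_edgeCut e
  exact ⟨memLp_const _, 3 / 4, by norm_num, by norm_num, _, h.smooth,
    h.tendsto_normH (by norm_num) (by norm_num), tendsto_edgeCut_edgePt e e'⟩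

end

/-! ### The weak flux and part (ii). -/

section

variable {σ s : ℝ} {u : Fin 2 → ℝ × ℝ → ℝ} {d : ℝ × ℝ → ℝ} {e : Fin 4} {F : ℝ}

lemma NQ_ne_top_of_contDiff {ψ : ℝ × ℝ → ℝ} (hψ : ContDiff ℝ 1 ψ) (h0 : 0 ≤ σ) (h1 : σ < 1) :
    NQ σ ψ ≠ ⊤ := by
  rw [NQ_ne_top_iff (memLp_of_continuous hψ.continuous)]
  refine ((gagliardoSq_le_gradSq hψ).trans_lt (ENNReal.mul_lt_top
    (rieszInt_lt_top (by linarith) (by linarith)) ?_)).ne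
  have hp : ∀ i, ∫⁻ x, ‖pd i ψ x‖ₑ ^ 2 ∂μQ < ⊤ := fun i => by
    rw [← eLpNorm_two_sq]
    exact ENNReal.pow_lt_top (memLp_of_continuous (continuous_pd hψ i)).2
  rw [gradSq, lintegral_indicator measurableSet_Q]
  calc _ = ∫⁻ x, (‖pd 0 ψ x‖ₑ ^ 2 + ‖pd 1 ψ x‖ₑ ^ 2) ∂μQ := by
        refine lintegral_congr fun x => ?_
        rw [ENNReal.ofReal_add (sq_nonneg _) (sq_nonneg _)]
        simp only [Real.enorm_eq_ofReal_abs, ← ENNReal.ofReal_pow (abs_nonneg _), sq_abs]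
    _ < ⊤ := by
        rw [lintegral_add_left ((continuous_pd hψ 0).measurable.enorm.pow_const 2)]
        exact ENNReal.add_lt_top.2 ⟨hp 0, hp 1⟩

lemma nQ_sub_le {v w φ : ℝ × ℝ → ℝ} (hv : MemLp (fun x => v x - φ x) 2 μQ)
    (hw : MemLp (fun x => w x - φ x) 2 μQ) (hNv : NQ σ (fun x => v x - φ x) ≠ ⊤)
    (hNw : NQ σ (fun x => w x - φ x) ≠ ⊤) :
    nQ σ (fun x => v x - w x) ≤ 2 * (nQ σ (fun x => v x - φ x) + nQ σ (fun x => w x - φ x)) := by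
  have e : (fun x => v x - w x) = fun x => (v x - φ x) - (w x - φ x) := by
    ext x
    ring
  have h := NQ_sub_le (σ := σ) hv hw
  have h2 := ENNReal.toReal_mono (by finiteness) h
  rw [ENNReal.toReal_add (by finiteness) (by finiteness), ENNReal.toReal_mul, ENNReal.toReal_mul,
    ENNReal.toReal_ofNat] at h2
  rw [e, nQ]
  refine Real.sqrt_le_iff.2 ⟨by have := nQ_nonneg σ (fun x => v x - φ x); have := nQ_nonneg σ (fun x => w x - φ x); positivity, h2.trans ?_⟩
  have s1 : nQ σ (fun x => v x - φ x) ^ 2 = (NQ σ (fun x => v x - φ x)).toReal :=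
    Real.sq_sqrt ENNReal.toReal_nonneg
  have s2 : nQ σ (fun x => w x - φ x) ^ 2 = (NQ σ (fun x => w x - φ x)).toReal :=
    Real.sq_sqrt ENNReal.toReal_nonneg
  rw [← s1, ← s2]
  nlinarith [nQ_nonneg σ (fun x => v x - φ x), nQ_nonneg σ (fun x => w x - φ x)]

lemma ofReal_nQ (h0 : 0 < σ) (h1 : σ < 1) {v : ℝ × ℝ → ℝ} (hv : MemLp v 2 μQ) (hN : NQ σ v ≠ ⊤) :
    ENNReal.ofReal (nQ σ v) = normH σ v := by
  rw [normH_eq h0 h1 hv, nQ, Real.sqrt_eq_rpow, ENNReal.toReal_rpow, ENNReal.ofReal_toReal]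
  exact ENNReal.rpow_ne_top_of_nonneg (by norm_num) hN

/-- The regularized cutoffs converge in H^σ and Green's functional is continuous there, so its
values form a Cauchy sequence. -/
lemma exists_tendsto_Lf_edgeCut (hs0 : 0 < s) (hs1 : s ≤ 1 / 2) (hu : ∀ i, MemLp (u i) 2 μQ)
    (hNu : ∀ i, NQ s (u i) ≠ ⊤) (hd : MemLp d 2 μQ) (e : Fin 4) :
    ∃ F, Tendsto (fun n => Lf u d (edgeCut (ηs n) e)) atTop (𝓝 F) := by
  -- The exponent 1 - s/2 exceeds 1/2 and satisfies s + σ = 1 + s/2 > 1, as the pairing requires.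
  obtain ⟨C, hC0, hC⟩ := exists_abs_Lf_le (s := s) (σ := 1 - s / 2) hs0 (by linarith) (by linarith)
    (by linarith) (by linarith)
  have h := isSmoothApprox_edgeCut e
  have hc := fun n => contDiff_one_of_infty (h.smooth n)
  set φ := edgeCut 0 e
  set ψ : ℕ → ℝ × ℝ → ℝ := fun n => edgeCut (ηs n) e
  set σ := 1 - s / 2 with hσ
  have hσ0 : 0 < σ := by linarith
  have hσ1 : σ < 1 := by linarith
  have hNφ := h.ne_top σ hσ0 hσ1
  have hN : ∀ n, NQ σ (fun x => ψ n x - φ x) ≠ ⊤ := by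
    intro n
    have h1 := NQ_ne_top_of_contDiff (hc n) hσ0.le hσ1
    exact ((NQ_sub_le (memLp_of_continuous (hc n).continuous) h.memLp).trans_lt (by finiteness)).ne
  set K := C * (nQ s (u 0) + nQ s (u 1)) + (normL2 d).toReal with hK
  have hK0 : 0 ≤ K := by
    have := nQ_nonneg s (u 0)
    have := nQ_nonneg s (u 1)
    positivity
  refine cauchySeq_tendsto_of_complete (cauchySeq_of_edist_le_add
    (a := fun n => ENNReal.ofReal (K * (2 * nQ σ fun x => ψ n x - φ x))) (fun n m => ?_) ?_)
  · have p : ∀ n, 0 ≤ K * (2 * nQ σ fun x => ψ n x - φ x) := fun n =>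
      mul_nonneg hK0 (mul_nonneg zero_le_two (nQ_nonneg _ _))
    rw [edist_dist, ← ENNReal.ofReal_add (p n) (p m), Real.dist_eq, ← Lf_sub_right hu hd (hc n) (hc m)]
    refine ENNReal.ofReal_le_ofReal ((hC u d _ hu hNu hd ((hc n).sub (hc m))
      (NQ_ne_top_of_contDiff ((hc n).sub (hc m)) hσ0.le hσ1)).trans ?_)
    rw [← mul_add, ← mul_add]
    exact mul_le_mul_of_nonneg_left (nQ_sub_le (h.memLp_sub n) (h.memLp_sub m) (hN n) (hN m)) hK0
  · have h2 := ((tendsto_nQ_zero (h.tendsto σ hσ0 hσ1)).const_mul 2).const_mul K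
    simpa using ENNReal.tendsto_ofReal h2

lemma eventually_NQ_le_of_tendsto_normH {ψ : ℕ → ℝ × ℝ → ℝ} {φ : ℝ × ℝ → ℝ}
    (hψ : ∀ n, MemLp (ψ n) 2 μQ) (hφ : MemLp φ 2 μQ) (h0 : 0 < σ) (h1 : σ < 1)
    (h : Tendsto (fun n => normH σ fun x => ψ n x - φ x) atTop (𝓝 0)) :
    ∀ᶠ n in atTop, NQ σ (ψ n) ≤ 2 + 2 * NQ σ φ := by
  filter_upwards [h.eventually_le_const (show (0 : ℝ≥0∞) < 1 by norm_num)] with n hn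
  have h2 := NQ_add_le (σ := σ) ((hψ n).sub hφ) hφ
  have e : (fun x => (ψ n - φ) x + φ x) = ψ n := by
    ext x
    simp
  rw [e] at h2
  refine h2.trans (add_le_add ?_ le_rfl)
  have h3 : normH σ (ψ n - φ) ≤ 1 := hn
  rw [normH_eq h0 h1 ((hψ n).sub hφ)] at h3
  have h4 : NQ σ (ψ n - φ) ≤ 1 := by
    by_contra! hlt
    exact absurd h3 (not_le.2 (ENNReal.one_lt_rpow hlt (by norm_num)))
  exact mul_le_of_le_one_right zero_le h4

/-- Independence of the test function: one concrete sequence decides the value for every admissible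
ε, φ and smooth approximation of φ. This yields both existence and uniqueness of the flux. -/
lemma isWeakFlux_iff (hs0 : 0 < s) (hs1 : s ≤ 1 / 2) (hu : ∀ i, MemLp (u i) 2 μQ)
    (hNu : ∀ i, NQ s (u i) ≠ ⊤) (hd : HasWeakDiv u d) :
    IsWeakFlux s u d e F ↔ Tendsto (fun n => Lf u d (edgeCut (ηs n) e)) atTop (𝓝 F) := by
  have h := isSmoothApprox_edgeCut e
  constructor
  · intro hF
    -- The limit cutoff is itself an admissible φ; any ε in (0, s) would serve.
    refine hF (s / 2) (by linarith) (by linarith) (edgeCut 0 e) ?_ (isTrace_edgeCut e) _ h.smooth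
      (h.tendsto_normH (by linarith) (by linarith))
    rw [MemH, normH_eq (by linarith) (by linarith) h.memLp]
    exact ENNReal.rpow_lt_top_of_nonneg (by norm_num) (h.ne_top _ (by linarith) (by linarith))
  · intro hF ε hε hεs φ hφ hT ψ hψ hψφ
    have hφm := memLp_of_normH_lt_top hφ
    have hψm := fun n => memLp_of_continuous (hψ n).continuous
    have hcm := fun n => memLp_of_continuous (h.smooth n).continuous
    have hNφ := (NQ_lt_top (by linarith) (by linarith) hφ).ne
    have hNc := h.ne_top (1 - ε) (by linarith) (by linarith)
    -- Both sequences are bounded in H^(1-ε) and have the same limiting traces, so Green's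
    -- functional vanishes in the limit on their difference. The pairing applies since s + (1 - ε) >
    -- 1, and 1 - ε > 1/2 because ε < s ≤ 1/2.
    have hz := tendsto_Lf_zero (σ := 1 - ε) hs0 (by linarith) (by linarith) (by linarith)
      (by linarith) hu hNu hd (χ := fun n x => ψ n x - edgeCut (ηs n) e x)
      (M := 2 * (2 + 2 * NQ (1 - ε) φ) + 2 * (2 + 2 * NQ (1 - ε) (edgeCut 0 e)))
      (fun n => contDiff_one_of_infty ((hψ n).sub (h.smooth n))) (by finiteness) ?_ ?_
    · have := hz.add hF
      rw [zero_add] at this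
      refine this.congr fun n => ?_
      rw [Lf_sub_right hu hd.memLp (contDiff_one_of_infty (hψ n))
        (contDiff_one_of_infty (h.smooth n)), sub_add_cancel]
      rfl
    · filter_upwards [eventually_NQ_le_of_tendsto_normH hψm hφm (by linarith) (by linarith) hψφ,
        eventually_NQ_le_of_tendsto_normH hcm h.memLp (by linarith) (by linarith)
          (h.tendsto_normH (σ := 1 - ε) (by linarith) (by linarith))] with n h1 h2
      refine (NQ_sub_le (hψm n) (hcm n)).trans ?_
      gcongr
    · intro e'
      have h1 := (hT e').tendsto (by linarith) (by linarith) hψ hψφ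
      have h2 := tendsto_edgeCut_edgePt e e'
      have h3 := h1.add h2
      rw [add_zero] at h3
      refine tendsto_of_tendsto_of_tendsto_of_le_of_le tendsto_const_nhds h3 (fun _ => zero_le)
        fun n => ?_
      have m1 := (memLp_comp_edgePt (hψ n).continuous e').sub (hT e').1
      have m2 := (memLp_comp_edgePt (h.smooth n).continuous e').sub (hT e').1
      refine le_trans (le_of_eq ?_) (eLpNorm_sub_le m1.1 m2.1 one_le_two)
      congr 1
      ext t
      simp

/-- The three terms of Green's formula are treated differently: the normal component by the pairing
bound, the tangential one by the anisotropic estimate for the cutoffs, the divergence by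
Cauchy-Schwarz. All bounds are uniform in the regularization and pass to the limit. -/
lemma exists_enorm_le_of_tendsto_Lf (hs0 : 0 < s) (hs1 : s ≤ 1 / 2) (e : Fin 4) {l : Fin 2}
    (hl : tangIdx e = l + 1) : ∃ C : ℝ≥0, ∀ (u : Fin 2 → ℝ × ℝ → ℝ) (d : ℝ × ℝ → ℝ) (F : ℝ),
      (∀ i, MemLp (u i) 2 μQ) → (∀ i, NQ s (u i) ≠ ⊤) → MemLp d 2 μQ →
      Tendsto (fun n => Lf u d (edgeCut (ηs n) e)) atTop (𝓝 F) →
      ‖F‖ₑ ≤ C * (normH s (u l) + seminormAH (l + 1) s (u (l + 1)) + normL2 d) := by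
  have h := isSmoothApprox_edgeCut e
  have hc := fun n => contDiff_one_of_infty (h.smooth n)
  have hσ1 : 1 - s / 2 < 1 := by linarith
  have hσ0 : 0 < 1 - s / 2 := by linarith
  set σ := 1 - s / 2 with hσ
  obtain ⟨C₁, hC0, hC₁⟩ := exists_pairing_le (s := s) (σ := σ) hs0 (by linarith) (by linarith)
    hσ1 (by linarith)
  obtain ⟨C₂, hC₂⟩ := pairingBound_edgeCut e s hs0 (by linarith)
  rw [hl] at hC₂
  have hNφ := h.ne_top σ hσ0 hσ1
  set M : ℝ := √(2 + 2 * NQ σ (edgeCut 0 e)).toReal with hM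
  have hM0 : 0 ≤ M := Real.sqrt_nonneg _
  have hev : ∀ᶠ n in atTop, nQ σ (edgeCut (ηs n) e) ≤ M := by
    filter_upwards [eventually_NQ_le_of_tendsto_normH
      (fun n => memLp_of_continuous (hc n).continuous) h.memLp hσ0 hσ1
      (h.tendsto_normH hσ0 hσ1)] with n hn
    exact Real.sqrt_le_sqrt (ENNReal.toReal_mono (by finiteness) hn)
  refine ⟨(C₁ * M).toNNReal + C₂ + M.toNNReal, fun u d F hu hNu hd hF => ?_⟩
  refine le_of_tendsto hF.enorm ?_
  filter_upwards [hev] with n hn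
  have hNn := NQ_ne_top_of_contDiff (hc n) hσ0.le hσ1
  have e1 : Lf u d (edgeCut (ηs n) e) = (∫ x, u l x * pd l (edgeCut (ηs n) e) x ∂μQ) +
      (∫ x, u (l + 1) x * pd (l + 1) (edgeCut (ηs n) e) x ∂μQ) +
      ∫ x, d x * edgeCut (ηs n) e x ∂μQ := by
    rw [Lf_eq hu (hc n)]
    fin_cases l
    · rfl
    · rw [add_comm (∫ x, u 0 x * pd 0 _ x ∂μQ)]
      rfl
  have b1 : ‖∫ x, u l x * pd l (edgeCut (ηs n) e) x ∂μQ‖ₑ ≤ (C₁ * M).toNNReal * normH s (u l) := by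
    rw [← ofReal_nQ hs0 (by linarith) (hu l) (hNu l), Real.enorm_eq_ofReal_abs]
    change _ ≤ ENNReal.ofReal (C₁ * M) * _
    rw [← ENNReal.ofReal_mul (by positivity)]
    refine ENNReal.ofReal_le_ofReal ((hC₁ _ _ (hu l) (hNu l) (hc n) hNn l).trans ?_)
    have := mul_le_mul_of_nonneg_left hn (mul_nonneg hC0.le (nQ_nonneg s (u l)))
    linarith
  have b3 : ‖∫ x, d x * edgeCut (ηs n) e x ∂μQ‖ₑ ≤ M.toNNReal * normL2 d := by
    have hm := memLp_of_continuous (hc n).continuous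
    have h1 := abs_integral_mul_le hd hm
    rw [Real.enorm_eq_ofReal_abs]
    have e2 : normL2 d = ENNReal.ofReal (normL2 d).toReal := (ENNReal.ofReal_toReal hd.2.ne).symm
    rw [e2]
    change _ ≤ ENNReal.ofReal M * _
    rw [← ENNReal.ofReal_mul hM0]
    refine ENNReal.ofReal_le_ofReal (h1.trans ?_)
    rw [mul_comm]
    exact mul_le_mul_of_nonneg_right ((normL2_toReal_le_nQ hNn).trans hn) ENNReal.toReal_nonneg
  have b2 := hC₂ n _ (hu (l + 1))
  rw [e1]
  refine (enorm_add_le _ _).trans ((add_le_add ((enorm_add_le _ _).trans (add_le_add b1 b2)) b3).trans ?_)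
  push_cast
  rw [mul_add, mul_add]
  gcongr ?_ * _ + ?_ * _ + ?_ * _
  · rw [add_assoc]; exact le_self_add
  · rw [add_right_comm]; exact le_add_self
  · exact le_add_self

lemma tangIdx_normalEdge (l k : Fin 2) : tangIdx (normalEdge l k) = l + 1 := by
  fin_cases l <;> fin_cases k <;> rfl

/-- The edges normal to l have tangential direction l + 1, so only u_l appears in the full norm and
u_{l+1} only in the seminorm. Summing the constants over all edges makes the final one independent
of l. -/
lemma existsUnique_isRTInterpolantDiv (hs0 : 0 < s) (hs1 : s ≤ 1 / 2) : ∃ C : ℝ≥0,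
    ∀ (u : Fin 2 → ℝ × ℝ → ℝ) (d : ℝ × ℝ → ℝ), (∀ i, MemH s (u i)) → HasWeakDiv u d →
      (∃! P, IsRTInterpolantDiv s u d P) ∧
      ∀ P, IsRTInterpolantDiv s u d P → ∀ l : Fin 2, normL2 (P l) ≤
        C * (normH s (u l) + seminormAH (l + 1) s (u (l + 1)) + normL2 d) := by
  choose C hC using fun l k : Fin 2 =>
    exists_enorm_le_of_tendsto_Lf hs0 hs1 (normalEdge l k) (tangIdx_normalEdge l k)
  refine ⟨2 * ∑ l, ∑ k, C l k, fun u d hu hd => ?_⟩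
  have hum := fun i => memLp_of_normH_lt_top (hu i)
  have hNu := fun i => (NQ_lt_top hs0 (by linarith) (hu i)).ne
  refine ⟨?_, fun P hP l => ?_⟩
  · refine existsUnique_RT0 (R := IsWeakFlux s u d) (fun e => ?_) fun e F F' hF hF' => ?_
    · obtain ⟨F, hF⟩ := exists_tendsto_Lf_edgeCut hs0 hs1 hum hNu hd.memLp e
      exact ⟨F, (isWeakFlux_iff hs0 hs1 hum hNu hd).2 hF⟩
    · exact tendsto_nhds_unique ((isWeakFlux_iff hs0 hs1 hum hNu hd).1 hF)
        ((isWeakFlux_iff hs0 hs1 hum hNu hd).1 hF')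
  · rw [ENNReal.coe_mul, ENNReal.coe_ofNat, mul_assoc]
    refine normL2_RT0_le_of_forall hP.1 l fun k => ?_
    refine (hC l k u d _ hum hNu hd.memLp
      ((isWeakFlux_iff hs0 hs1 hum hNu hd).1 (hP.2 _))).trans (mul_le_mul' ?_ le_rfl)
    refine ENNReal.coe_le_coe.2 ((Finset.single_le_sum (f := C l) (fun _ _ => zero_le)
      (Finset.mem_univ k)).trans ?_)
    exact Finset.single_le_sum (f := fun l => ∑ k, C l k) (fun _ _ => zero_le) (Finset.mem_univ l)

end

end RTSquare

theorem theorem5p1 :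
    (∀ s : ℝ, 1 / 2 < s → ∃ C : ℝ≥0, ∀ u : Fin 2 → ℝ × ℝ → ℝ, (∀ i, MemH s (u i)) →
      (∃! P, IsRTInterpolant u P) ∧
      ∀ P, IsRTInterpolant u P → ∀ l : Fin 2, normL2 (P l) ≤ C * normH s (u l)) ∧
    (∀ s : ℝ, 0 < s → s ≤ 1 / 2 → ∃ C : ℝ≥0,
      ∀ (u : Fin 2 → ℝ × ℝ → ℝ) (d : ℝ × ℝ → ℝ), (∀ i, MemH s (u i)) → HasWeakDiv u d →
      (∃! P, IsRTInterpolantDiv s u d P) ∧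
      ∀ P, IsRTInterpolantDiv s u d P → ∀ l : Fin 2,
        normL2 (P l) ≤
          C * (normH s (u l) + seminormAH (l + 1) s (u (l + 1)) + normL2 d)) :=
  ⟨fun _ hs => existsUnique_isRTInterpolant hs,
    fun _ h0 h1 => existsUnique_isRTInterpolantDiv h0 h1⟩
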